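/- Let $r,d\ge 1$ be integers. There is a constant $C_{r,d}$ such that for every Hermitian inner product $h$ on an $r$-dimensional complex vector space $V$ and all $v,w\in \mathrm{Sym}^dV$ $$d^{\,r-1}\int_{\mathbb PV^*}\langle\hat v,\hat w\rangle_{\widehat{\mathrm{Sym}^dh}}\,\frac{\omega_{FS,h}^{r-1}}{(r-1)!}=C_{r,d}\,\langle v,w\rangle_{\mathrm{Sym}^dh},\qquad \omega_{FS,h}=i\bar\partial\partial\log\hat h ,$$ and there is a constant $C$, depending only on $r$ and $d$, with the following property. Let $X$ be a compact Riemann surface, $L$ a holomorphic line bundle on $X$ with a smooth Hermitian metric $g$ such that $\omega_\infty=i\bar\partial\partial\log g$ is a Kähler form, and $E$ a holomorphic vector bundle of rank $r$ on $X$. Let $h_\infty$ be a Hermitian–Einstein metric on $E$, that is, $iF_{h_\infty}=\mu\,\omega_\infty I_E$ for the curvature $F_{h_\infty}$ of its Chern connection and a real constant $\mu$. (Then $\mu$ is the slope of $E$ measured with respect to $L$, $\mu=\deg E/(r\deg L)$.) Let $k\ge 0$ be an integer with $d\mu+k\ge \frac1r$; if $\mu=\deg E/r$, this just says $d\mu+k>0$,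 since $r(d\mu+k)$ is then an integer. Let $\varepsilon\ge 0$ and let $H$ be a smooth Hermitian metric on $\mathrm{Sym}^dE$ with $$\|H-\mathrm{Sym}^dh_\infty\|_{C^2(\mathrm{Sym}^dh_\infty)}\le\min(\varepsilon,\tfrac12).$$ Here the pointwise norm of the tensors is the one given by $\mathrm{Sym}^dh_\infty$ and $\omega_\infty$, and derivatives are taken with the Chern connection of $\mathrm{Sym}^dh_\infty$ and the Levi-Civita connection of $\omega_\infty$. Put $H_k=H\otimes g^{\otimes k}$ and let $s_1,\dots,s_N$ be a basis of $H^0(X,\mathrm{Sym}^dE\otimes L^k)$ which is orthonormal for the inner product $\int_X\langle s,t\rangle_{H_k}\,\omega_\infty$. Then for all $i,j$ $$\Big|\int_{\mathbb PE^*}\langle\hat s_i,\hat s_j\rangle_{\widehat{H_k}}\,dvol_{\widehat{H_k}}-C_{r,d}(d\mu+k)\delta_{ij}\Big|\le C\,\varepsilon\,(d\mu+k).$$ Notation: a vector $s\in \mathrm{Sym}^dV\otimes M$ ($M$ a line) defines the section $\hat s$ of $\mathcal O_{\mathbb PV^*}(d)\otimes M$ given by $f\mapsto (f^{\otimes d}\otimes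 \mathrm{id}_M)(s)$ for $f\in V^*\setminus 0$; inner products $H$ on $\mathrm{Sym}^dV$ and $m$ on $M$ induce the metric $\langle\hat s,\hat t\rangle([f])=m(\hat s(f),\hat t(f))/|f^{\otimes d}|^2$ on $\mathcal O(d)\otimes M$, with the norm dual to $H$ on $(\mathrm{Sym}^dV)^*$. Applied to the fibres of $E$, with $M=L_x^{\otimes k}$, this gives $\hat s_i$ and $\widehat{H_k}$ on $\mathcal O_{\mathbb PE^*}(d)\otimes L^k$. On $\mathrm{Sym}^d$ the inner product is $\langle v_1\cdots v_d,w_1\cdots w_d\rangle_{\mathrm{Sym}^dh}=\frac1{d!}\sum_{\sigma\in S_d}\prod_i\langle v_i,w_{\sigma(i)}\rangle_h$. Finally $dvol_{\widehat{H_k}}=\omega^r/r!$ with $\omega=i\bar\partial\partial\log\widehat{H_k}$. -/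

import Mathlib

open scoped TensorProduct ContDiff Manifold ComplexConjugate
open MeasureTheory Bundle

noncomputable section

/-! ### Multilinear algebra: symmetric powers, powers of covectors, induced sesquilinear forms

Sesquilinear forms are linear in the first and conjugate-linear in the second argument. -/

section Algebra

/-- Sesquilinear forms, linear in the first and conjugate-linear in the second variable. -/
abbrev SesqForm (V : Type*) [AddCommGroup V] [Module ℂ V] : Type _ := V →ₗ[ℂ] V →ₗ⋆[ℂ] ℂ

/-- A Hermitian inner product on a complex vector space. -/
structure HermitianMetric (V : Type*) [AddCommGroup V] [Module ℂ V] where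
  form : SesqForm V
  conj_symm : ∀ u v, conj (form u v) = form v u
  pos : ∀ u, u ≠ 0 → 0 < (form u u).re

variable {V W N : Type*} [AddCommGroup V] [Module ℂ V] [AddCommGroup W] [Module ℂ W]
  [AddCommGroup N] [Module ℂ N]

/-- The linear map out of the symmetric power given by a symmetric multilinear map. -/
def symLift (d : ℕ) (m : MultilinearMap ℂ (fun _ : Fin d => V) N)
    (hm : ∀ (σ : Equiv.Perm (Fin d)) (v : Fin d → V), m (fun i => v (σ i)) = m v) :
    Sym[ℂ]^d V →ₗ[ℂ] N where
  toFun := AddCon.lift (addConGen (SymmetricPower.Rel ℂ (Fin d) V))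
    (PiTensorProduct.lift m).toAddMonoidHom
    (AddCon.addConGen_le.2 (by
      rintro _ _ ⟨σ, v⟩
      simp [AddCon.ker_rel, hm]))
  map_add' := map_add _
  map_smul' r x := by
    induction x using AddCon.induction_on with
    | H x => exact (PiTensorProduct.lift m).map_smul r x

@[simp] theorem symLift_tprod (d : ℕ) (m : MultilinearMap ℂ (fun _ : Fin d => V) N)
    (hm : ∀ (σ : Equiv.Perm (Fin d)) (v : Fin d → V), m (fun i => v (σ i)) = m v)
    (v : Fin d → V) : symLift d m hm (SymmetricPower.tprod ℂ v) = m v :=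
  PiTensorProduct.lift.tprod (φ := m) v

/-- `Sym^d` of a linear map: `v₁ ⋯ v_d ↦ T v₁ ⋯ T v_d`. -/
def symMap (d : ℕ) (T : V →ₗ[ℂ] W) : Sym[ℂ]^d V →ₗ[ℂ] Sym[ℂ]^d W :=
  symLift d ((SymmetricPower.tprod ℂ).compLinearMap fun _ => T)
    (fun σ v => by simpa using SymmetricPower.tprod_equiv (R := ℂ) σ (fun i => T (v i)))

/-- The functional `f^{⊗ d}` on `Sym^d V`: `v₁ ⋯ v_d ↦ f v₁ ⋯ f v_d`. -/
def covecPow (d : ℕ) (f : Module.Dual ℂ V) : Sym[ℂ]^d V →ₗ[ℂ] ℂ :=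
  symLift d ((MultilinearMap.mkPiAlgebra ℂ (Fin d) ℂ).compLinearMap fun _ => f)
    (fun σ v => by simpa using Equiv.prod_comp σ (fun i => f (v i)))

theorem covecPow_tprod (d : ℕ) (f : Module.Dual ℂ V) (v : Fin d → V) :
    covecPow d f (SymmetricPower.tprod ℂ v) = ∏ i, f (v i) := by
  simp [covecPow]

/-- The symmetrization `v₁ ⋯ v_d ↦ (1/d!) ∑_σ v_{σ 1} ⊗ ⋯ ⊗ v_{σ d}`. -/
def symmetrize (d : ℕ) : Sym[ℂ]^d V →ₗ[ℂ] ⨂[ℂ]^d V :=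
  symLift d ((d.factorial : ℂ)⁻¹ • ∑ σ : Equiv.Perm (Fin d),
      (PiTensorProduct.tprod ℂ (s := fun _ : Fin d => V)).domDomCongr σ)
    (fun τ v => by
      simp only [smul_apply, sum_apply,
        MultilinearMap.domDomCongr_apply]
      congr 1
      exact Fintype.sum_equiv (Equiv.mulLeft τ) _ _ (fun σ => rfl))

/-- For fixed `w`, the functional `v₁ ⊗ ⋯ ⊗ v_k ↦ ∏ h(v_i, w_i)`. -/
def tensorPowAux (k : ℕ) (h : SesqForm V) (w : Fin k → V) : (⨂[ℂ]^k V) →ₗ[ℂ] ℂ :=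
  PiTensorProduct.lift ((MultilinearMap.mkPiAlgebra ℂ (Fin k) ℂ).compLinearMap
    fun i => h.flip (w i))

theorem tensorPowAux_tprod (k : ℕ) (h : SesqForm V) (w v : Fin k → V) :
    tensorPowAux k h w (PiTensorProduct.tprod ℂ v) = ∏ i, h (v i) (w i) := by
  simp [tensorPowAux]

/-- For fixed `s`, the multilinear map `w ↦ conj ⟨s, w₁ ⊗ ⋯ ⊗ w_k⟩`. -/
def tensorPowConj (k : ℕ) (h : SesqForm V) (s : ⨂[ℂ]^k V) :
    MultilinearMap ℂ (fun _ : Fin k => V) ℂ where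
  toFun w := conj (tensorPowAux k h w s)
  map_update_add' := by
    intro _ w i x y
    rw [← map_add]
    congr 1
    induction s using PiTensorProduct.induction_on with
    | smul_tprod r v =>
      simp only [map_smul, tensorPowAux_tprod, smul_eq_mul, ← mul_add]
      congr 1
      rw [← Finset.mul_prod_erase _ _ (Finset.mem_univ i),
        ← Finset.mul_prod_erase (s := Finset.univ) (a := i) _ (Finset.mem_univ i),
        ← Finset.mul_prod_erase (s := Finset.univ) (a := i) _ (Finset.mem_univ i)]
      simp only [Function.update_self, map_add, add_mul]
      congr 1 <;> congr 1 <;> refine Finset.prod_congr rfl fun j hj => ?_ <;>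
        simp [Finset.ne_of_mem_erase hj]
    | add a b ha hb => simp only [map_add, ha, hb]; ring
  map_update_smul' := by
    intro _ w i c x
    rw [smul_eq_mul, ← Complex.conj_conj c, ← map_mul]
    congr 1
    induction s using PiTensorProduct.induction_on with
    | smul_tprod r v =>
      simp only [map_smul, tensorPowAux_tprod, smul_eq_mul]
      rw [← Finset.mul_prod_erase _ _ (Finset.mem_univ i),
        ← Finset.mul_prod_erase (s := Finset.univ) (a := i) _ (Finset.mem_univ i)]
      simp only [Function.update_self, map_smulₛₗ, smul_eq_mul, Complex.conj_conj]
      rw [Finset.prod_congr rfl (g := fun j => h (v j) (Function.update w i x j))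
        fun j hj => by simp [Finset.ne_of_mem_erase hj]]
      ring
    | add a b ha hb => simp only [map_add, ha, hb]; ring

/-- The form on `V^{⊗ k}` induced by `h`:
`⟨v₁ ⊗ ⋯ ⊗ v_k, w₁ ⊗ ⋯ ⊗ w_k⟩ = ∏ h(v_i, w_i)`, see `tensorPowForm_tprod`. -/
def tensorPowForm (k : ℕ) (h : SesqForm V) : SesqForm (⨂[ℂ]^k V) :=
  LinearMap.mk₂'ₛₗ (RingHom.id ℂ) (starRingEnd ℂ)
    (fun s t => conj (PiTensorProduct.lift (tensorPowConj k h s) t))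
    (by
      intro s s' t
      have : tensorPowConj k h (s + s') = tensorPowConj k h s + tensorPowConj k h s' := by
        ext w; simp [tensorPowConj]
      simp [this])
    (by
      intro c s t
      have : tensorPowConj k h (c • s) = conj c • tensorPowConj k h s := by
        ext w; simp [tensorPowConj]
      simp [this])
    (by intro s t t'; simp)
    (by intro c s t; simp)

theorem tensorPowForm_tprod (k : ℕ) (h : SesqForm V) (v w : Fin k → V) :
    tensorPowForm k h (PiTensorProduct.tprod ℂ v) (PiTensorProduct.tprod ℂ w)
      = ∏ i, h (v i) (w i) := by
  simp [tensorPowForm, tensorPowConj, tensorPowAux_tprod]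

/-- The pull-back `(u, v) ↦ A (T u) (T v)`. -/
def pullForm (T : W →ₗ[ℂ] V) (A : SesqForm V) : SesqForm W :=
  LinearMap.mk₂'ₛₗ (RingHom.id ℂ) (starRingEnd ℂ) (fun u v => A (T u) (T v))
    (by simp) (by simp) (by simp) (by simp)

@[simp] theorem pullForm_apply (T : W →ₗ[ℂ] V) (A : SesqForm V) (u v : W) :
    pullForm T A u v = A (T u) (T v) := rfl

/-- The form `Sym^d h` on `Sym^d V`, see `symForm_tprod`. -/
def symForm (d : ℕ) (h : SesqForm V) : SesqForm (Sym[ℂ]^d V) :=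
  pullForm (symmetrize d) (tensorPowForm d h)

theorem symForm_tprod (d : ℕ) (h : SesqForm V) (v w : Fin d → V) :
    symForm d h (SymmetricPower.tprod ℂ v) (SymmetricPower.tprod ℂ w)
      = (d.factorial : ℂ)⁻¹ * ∑ σ : Equiv.Perm (Fin d), ∏ i, h (v i) (w (σ i)) := by
  have key : ∀ σ : Equiv.Perm (Fin d), ∑ τ : Equiv.Perm (Fin d), ∏ i, h (v (σ i)) (w (τ i))
      = ∑ τ : Equiv.Perm (Fin d), ∏ i, h (v i) (w (τ i)) := by
    intro σ
    refine Fintype.sum_equiv (Equiv.mulRight σ⁻¹) _ _ fun τ => ?_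
    rw [← Equiv.prod_comp σ (fun i => h (v i) (w ((Equiv.mulRight σ⁻¹ τ) i)))]
    simp
  have hd : (d.factorial : ℂ) ≠ 0 := by exact_mod_cast d.factorial_ne_zero
  simp only [symForm, symmetrize, pullForm_apply, symLift_tprod, smul_apply, sum_apply,
    MultilinearMap.domDomCongr_apply, map_smul, map_sum, map_smulₛₗ, LinearMap.smul_apply,
    LinearMap.sum_apply, tensorPowForm_tprod, smul_eq_mul]
  rw [← Finset.mul_sum, Finset.sum_comm]
  simp only [key, Finset.sum_const, Finset.card_univ, Fintype.card_perm, Fintype.card_fin,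
    nsmul_eq_mul, map_inv₀, map_natCast]
  field_simp

/-- The form `A ⊗ B` on `V ⊗ W`, see `tensorForm_tmul`. -/
def tensorForm (A : SesqForm V) (B : SesqForm W) : SesqForm (V ⊗[ℂ] W) :=
  LinearMap.flip (((TensorProduct.lift (TensorProduct.mapBilinear (.id ℂ) V W ℂ ℂ)).compr₂
    (.mul' ℂ ℂ)) ∘ₛₗ TensorProduct.map A.flip B.flip)

theorem tensorForm_tmul (A : SesqForm V) (B : SesqForm W) (v v' : V) (w w' : W) :
    tensorForm A B (v ⊗ₜ w) (v' ⊗ₜ w') = A v v' * B w w' := rfl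

/-- The square of the norm on the dual space that is dual to `(A u u)^{1/2}`. -/
def dualNormSq (A : SesqForm V) (φ : V →ₗ[ℂ] ℂ) : ℝ :=
  sSup ((fun u => ‖φ u‖ ^ 2) '' {u | (A u u).re ≤ 1})

/-- The section `ŝ` of `𝒪(d) ⊗ M` over `ℙV*` defined by `s ∈ Sym^d V ⊗ M`, as the function
`f ↦ (f^{⊗ d} ⊗ id)(s)` of the nonzero covector `f`; it is homogeneous of degree `d`. -/
def hatSection {M : Type*} [AddCommGroup M] [Module ℂ M] (d : ℕ) (f : Module.Dual ℂ V) :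
    (Sym[ℂ]^d V) ⊗[ℂ] M →ₗ[ℂ] M :=
  (TensorProduct.lid ℂ M).toLinearMap ∘ₗ LinearMap.rTensor M (covecPow d f)

/-- The Hermitian metric on `𝒪_{ℙV*}(d)` induced by an inner product `A` on `Sym^d V`: the value of
`⟨ŝ, t̂⟩` at the line spanned by the nonzero covector `f`, namely
`f^{⊗ d}(s) conj (f^{⊗ d}(t)) / |f ⋯ f|²`, the norm being the one dual to `A`. -/
def hatInner (d : ℕ) (A : SesqForm (Sym[ℂ]^d V)) (s t : Sym[ℂ]^d V) (f : Module.Dual ℂ V) : ℂ :=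
  covecPow d f s * conj (covecPow d f t) / dualNormSq A (covecPow d f)

/-- The Hermitian metric on `𝒪_{ℙV*}(d) ⊗ M` induced by inner products `A` on `Sym^d V` and `B`
on the line `M`: the value of `⟨ŝ, t̂⟩` at the line spanned by the nonzero covector `f`. -/
def hatInnerTwist {M : Type*} [AddCommGroup M] [Module ℂ M] (d : ℕ)
    (A : SesqForm (Sym[ℂ]^d V)) (B : SesqForm M) (s t : (Sym[ℂ]^d V) ⊗[ℂ] M)
    (f : Module.Dual ℂ V) : ℂ :=
  B (hatSection d f s) (hatSection d f t) / dualNormSq A (covecPow d f)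

theorem covecPow_smul (d : ℕ) (c : ℂ) (f : Module.Dual ℂ V) :
    covecPow d (c • f) = c ^ d • covecPow d f := by
  refine LinearMap.ext_on_range (SymmetricPower.span_tprod_eq_top ℂ (Fin d) V) fun v => ?_
  simp [covecPow_tprod, Finset.prod_mul_distrib]

theorem dualNormSq_smul (A : SesqForm V) (c : ℂ) (φ : V →ₗ[ℂ] ℂ) :
    dualNormSq A (c • φ) = ‖c‖ ^ 2 * dualNormSq A φ := by
  unfold dualNormSq
  rw [← smul_eq_mul, ← Real.sSup_smul_of_nonneg (by positivity), ← Set.image_smul,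
    Set.image_image]
  simp [mul_pow]

/-- The pairing `⟨ŝ, t̂⟩` depends only on the line spanned by the covector. -/
theorem hatInnerTwist_smul {M : Type*} [AddCommGroup M] [Module ℂ M] (d : ℕ)
    (A : SesqForm (Sym[ℂ]^d V)) (B : SesqForm M) (s t : (Sym[ℂ]^d V) ⊗[ℂ] M)
    (f : Module.Dual ℂ V) (c : ℂ) (hc : c ≠ 0) :
    hatInnerTwist d A B s t (c • f) = hatInnerTwist d A B s t f := by
  have h : ∀ u : (Sym[ℂ]^d V) ⊗[ℂ] M, hatSection d (c • f) u = c ^ d • hatSection d f u := by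
    intro u
    simp [hatSection, covecPow_smul, LinearMap.rTensor_smul]
  have hc' : (((‖c ^ d‖ ^ 2 : ℝ)) : ℂ) ≠ 0 := by
    exact_mod_cast pow_ne_zero 2 (norm_ne_zero_iff.2 (pow_ne_zero d hc))
  have hB : ∀ (a : ℂ) (x y : M), B (a • x) (a • y) = ((‖a‖ ^ 2 : ℝ) : ℂ) * B x y := by
    intro a x y
    rw [LinearMap.map_smul, LinearMap.smul_apply, LinearMap.map_smulₛₗ, smul_eq_mul, smul_eq_mul,
      ← mul_assoc, Complex.mul_conj']
    norm_cast
  unfold hatInnerTwist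
  rw [h, h, covecPow_smul, dualNormSq_smul, hB, Complex.ofReal_mul, mul_div_mul_left _ _ hc']

end Algebra

/-! ### Complex derivatives and local forms -/

section LocalCalculus

variable {A B : Type*} [NormedAddCommGroup A] [NormedSpace ℂ A] [NormedAddCommGroup B]
  [NormedSpace ℂ B]

/-- The Wirtinger derivative `∂_v f = (D f(v) - i D f(i v)) / 2`. -/
def dHol (f : A → B) (p v : A) : B :=
  (1 / 2 : ℂ) • (fderiv ℝ f p v - Complex.I • fderiv ℝ f p (Complex.I • v))

/-- The Wirtinger derivative `∂̄_v f = (D f(v) + i D f(i v)) / 2`. -/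
def dAnti (f : A → B) (p v : A) : B :=
  (1 / 2 : ℂ) • (fderiv ℝ f p v + Complex.I • fderiv ℝ f p (Complex.I • v))

/-- For a positive function `N` of `m` complex variables, the matrix `(ω_{ab})` with
`i ∂̄∂ log N = i ∑ ω_{ab} dζ_a ∧ dζ̄_b`. -/
def curvMatrix {m : ℕ} (N : (Fin m → ℂ) → ℝ) (ζ : Fin m → ℂ) : Matrix (Fin m) (Fin m) ℂ :=
  Matrix.of fun a b =>
    -dHol (fun y => dAnti (fun x => (Real.log (N x) : ℂ)) y (Pi.single b 1)) ζ (Pi.single a 1)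

/-- The coefficient of `ω^m / m!`, `ω = i ∂̄∂ log N`, with respect to Lebesgue measure on `ℂ^m`
(recall `i dζ ∧ dζ̄ = 2 dx ∧ dy`). -/
def volCoeff {m : ℕ} (N : (Fin m → ℂ) → ℝ) (ζ : Fin m → ℂ) : ℂ :=
  2 ^ m * (curvMatrix N ζ).det

/-! In what follows `G` is a family of positive definite sesquilinear forms on a vector space `S`,
depending on `z ∈ ℂ`: a Hermitian metric on a holomorphic bundle, in a holomorphic frame. -/

variable {S : Type*} [AddCommGroup S] [Module ℂ S]

/-- The `dz`-component of the Chern connection form of `G` in the frame: `θ u` is determined by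
`G (θ u, v) = ∂_z (G (u, v))` for all constant `v`. -/
def chernForm (G : ℂ → S → S → ℂ) (z : ℂ) (u : S) : S :=
  Function.invFun (G z) (fun v => dHol (fun y => G y u v) z 1)

/-- The covariant derivative `∇_z B` of a family of sesquilinear forms `B`, for the Chern
connection of `G`. -/
def covHol (G B : ℂ → S → S → ℂ) (z : ℂ) (u v : S) : ℂ :=
  dHol (fun y => B y u v) z 1 - B z (chernForm G z u) v

/-- The covariant derivative `∇_z̄ B` of a family of sesquilinear forms `B`, for the Chern
connection of `G`. -/
def covAnti (G B : ℂ → S → S → ℂ) (z : ℂ) (u v : S) : ℂ :=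
  dAnti (fun y => B y u v) z 1 - B z u (chernForm G z v)

/-- The operator norm of the sesquilinear form `B` with respect to `G`. -/
def formNorm (G B : S → S → ℂ) : ENNReal :=
  ⨆ (u : S) (v : S) (_ : (G u u).re ≤ 1) (_ : (G v v).re ≤ 1), ‖B u v‖ₑ

/-- `|B| + |∇B| + |∇²B|` at `z`, for the Chern connection of `G` and the Levi-Civita connection of
the Kähler metric `i ρ dz ∧ dz̄`, whose Christoffel symbol is `∂_z log ρ`; a component in the
direction of `j` differentials has weight `ρ^{-j/2}`. -/
def C2NormAt (G : ℂ → S → S → ℂ) (ρ : ℂ → ℝ) (B : ℂ → S → S → ℂ) (z : ℂ) : ENNReal :=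
  let γ : ℂ := dHol (fun y => (Real.log (ρ y) : ℂ)) z 1
  let B₁ := covHol G B
  let B₂ := covAnti G B
  formNorm (G z) (B z)
    + ENNReal.ofReal ((√(ρ z))⁻¹) * (formNorm (G z) (B₁ z) + formNorm (G z) (B₂ z))
    + ENNReal.ofReal ((ρ z)⁻¹) *
      (formNorm (G z) (fun u v => covHol G B₁ z u v - γ * B₁ z u v)
        + formNorm (G z) (covAnti G B₁ z)
        + formNorm (G z) (covHol G B₂ z)
        + formNorm (G z) (fun u v => covAnti G B₂ z u v - conj γ * B₂ z u v))

end LocalCalculus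

/-! ### The constant `C_{r,d}` -/

/-- The covector `e₀* + ∑ y_j e_{j+1}*` on `ℂ^{n+1}`. The lines spanned by these covectors form an
affine chart of `ℙ((ℂ^{n+1})*)`, with null complement. -/
def affineCovector {n : ℕ} (y : Fin n → ℂ) : Module.Dual ℂ (Fin (n + 1) → ℂ) :=
  ∑ j, (Fin.cons 1 y : Fin (n + 1) → ℂ) j • LinearMap.proj j

/-- `C` is the constant `C_{r,d}`, `r = n + 1`: for every Hermitian inner product `h` on
`V = ℂ^{n+1}` and all `v, w ∈ Sym^d V`,
`d^{r-1} ∫_{ℙV*} ⟨v̂, ŵ⟩ ω_{FS,h}^{r-1} / (r-1)! = C ⟨v, w⟩`, where the left pairing is the metric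
on `𝒪(d)` induced by `Sym^d h`, the right one is `Sym^d h`, and `ω_{FS,h} = i ∂̄∂ log ĥ`. In the
affine chart, the frame of `𝒪(1)` dual to `affineCovector y` has `ĥ`-norm squared
`1 / |affineCovector y|²`. -/
def IsFibreConstant (n d : ℕ) (C : ℝ) : Prop :=
  ∀ (h : HermitianMetric (Fin (n + 1) → ℂ)) (v w : Sym[ℂ]^d (Fin (n + 1) → ℂ)),
    (d : ℂ) ^ n * ∫ y : Fin n → ℂ, hatInner d (symForm d h.form) v w (affineCovector y) *
        volCoeff (fun y => 1 / dualNormSq h.form (affineCovector y)) y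
      = C * symForm d h.form v w

/-! ### Holomorphic bundles over a Riemann surface

Local computations use the chart of `X` and the trivializations (holomorphic frames) of the bundles
at a point `c`. -/

section Bundles

variable {X : Type*} [TopologicalSpace X] [ChartedSpace ℂ X]

section OneBundle

variable (F : Type*) [NormedAddCommGroup F] [NormedSpace ℂ F]
  (E : X → Type*) [TopologicalSpace (TotalSpace F E)] [∀ x, AddCommGroup (E x)]
  [∀ x, Module ℂ (E x)] [∀ x, TopologicalSpace (E x)] [FiberBundle F E] [VectorBundle ℂ F E]

/-- The common domain in `X` of the chart and of the frame of `E` at `c`. -/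
def frameSet (c : X) : Set X := (chartAt ℂ c).source ∩ (trivializationAt F E c).baseSet

/-- The image in `ℂ` of the common domain of the chart and the frame at `c`. -/
def frameDom (c : X) : Set ℂ := chartAt ℂ c '' frameSet F E c

variable {E}

/-- A family of forms on the fibres of `E`, in the chart and frame at `c`. -/
def frameForm (h : ∀ x, SesqForm (E x)) (c : X) (z : ℂ) : SesqForm F :=
  pullForm ((trivializationAt F E c).symmₗ ℂ ((chartAt ℂ c).symm z)) (h ((chartAt ℂ c).symm z))

/-- A family of forms on the fibres of `Sym^d E`, in the chart and frame at `c`. -/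
def symFrameForm (d : ℕ) (H : ∀ x, SesqForm (Sym[ℂ]^d (E x))) (c : X) (z : ℂ) :
    SesqForm (Sym[ℂ]^d F) :=
  pullForm (symMap d ((trivializationAt F E c).symmₗ ℂ ((chartAt ℂ c).symm z)))
    (H ((chartAt ℂ c).symm z))

/-- `h` is a smooth Hermitian metric on `E`. -/
def IsSmoothMetric (h : ∀ x, HermitianMetric (E x)) : Prop :=
  ∀ (c : X) (u v : F),
    ContDiffOn ℝ ∞ (fun z => frameForm F (fun x => (h x).form) c z u v) (frameDom F E c)

/-- `H` is a smooth Hermitian metric on `Sym^d E`. -/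
def IsSmoothSymMetric (d : ℕ) (H : ∀ x, HermitianMetric (Sym[ℂ]^d (E x))) : Prop :=
  ∀ (c : X) (u v : Sym[ℂ]^d F),
    ContDiffOn ℝ ∞ (fun z => symFrameForm F d (fun x => (H x).form) c z u v) (frameDom F E c)

end OneBundle

section LineBundle

variable {L : X → Type*} [TopologicalSpace (TotalSpace ℂ L)] [∀ x, AddCommGroup (L x)]
  [∀ x, Module ℂ (L x)] [∀ x, TopologicalSpace (L x)] [FiberBundle ℂ L] [VectorBundle ℂ ℂ L]

/-- The square of the `g`-norm of the frame of `L` at `c`. -/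
def lineNormSq (g : ∀ x, HermitianMetric (L x)) (c : X) (z : ℂ) : ℝ :=
  (frameForm ℂ (fun x => (g x).form) c z 1 1).re

/-- The coefficient `ρ` of `ω_∞ = i ∂̄∂ log g = i ρ dz ∧ dz̄` in the chart at `c`. -/
def kahlerCoeff (g : ∀ x, HermitianMetric (L x)) (c : X) (z : ℂ) : ℝ :=
  (-dHol (fun y => dAnti (fun x => (Real.log (lineNormSq g c x) : ℂ)) y 1) z 1).re

/-- `ω_∞ = i ∂̄∂ log g` is a Kähler form, i.e. positive. -/
def IsPositiveMetric (g : ∀ x, HermitianMetric (L x)) : Prop :=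
  ∀ (c : X), ∀ z ∈ frameDom ℂ L c, 0 < kahlerCoeff g c z

end LineBundle

section TwoBundles

variable {n : ℕ} {E : X → Type*} [TopologicalSpace (TotalSpace (Fin (n + 1) → ℂ) E)]
  [∀ x, AddCommGroup (E x)] [∀ x, Module ℂ (E x)] [∀ x, TopologicalSpace (E x)]
  [FiberBundle (Fin (n + 1) → ℂ) E] [VectorBundle ℂ (Fin (n + 1) → ℂ) E]
  {L : X → Type*} [TopologicalSpace (TotalSpace ℂ L)] [∀ x, AddCommGroup (L x)]
  [∀ x, Module ℂ (L x)] [∀ x, TopologicalSpace (L x)] [FiberBundle ℂ L] [VectorBundle ℂ ℂ L]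

variable (n) in
/-- The Hermitian-Einstein equation `i F_h = μ ω_∞ I_E` with `ω_∞ = i ∂̄∂ log g`. In a holomorphic
frame, with Chern connection form `θ dz`, the curvature is `∂_z̄ θ dz̄ ∧ dz`. -/
def IsHermitianEinstein (h : ∀ x, HermitianMetric (E x)) (g : ∀ x, HermitianMetric (L x))
    (μ : ℝ) : Prop :=
  ∀ (c : X), ∀ z ∈ frameDom (Fin (n + 1) → ℂ) E c ∩ frameDom ℂ L c, ∀ u : Fin (n + 1) → ℂ,
    -dAnti (fun y => chernForm
        (fun z u v => frameForm (Fin (n + 1) → ℂ) (fun x => (h x).form) c z u v) y u) z 1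
      = ((μ * kahlerCoeff g c z : ℝ) : ℂ) • u

variable (n) in
/-- The norm `‖H - Sym^d h‖` in `C^2(Sym^d h)` over `X`, with respect to the Kähler metric `ω_∞` on
`X`: the supremum over all points (in all the given frames) of the pointwise norm. -/
def symC2Dist (d : ℕ) (H : ∀ x, HermitianMetric (Sym[ℂ]^d (E x)))
    (h : ∀ x, HermitianMetric (E x)) (g : ∀ x, HermitianMetric (L x)) : ENNReal :=
  ⨆ (c : X), ⨆ z ∈ frameDom (Fin (n + 1) → ℂ) E c ∩ frameDom ℂ L c,
    C2NormAt
      (fun y u v => symFrameForm (Fin (n + 1) → ℂ) d (fun x => symForm d (h x).form) c y u v)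
      (kahlerCoeff g c)
      (fun y u v => symFrameForm (Fin (n + 1) → ℂ) d
        (fun x => (H x).form - symForm d (h x).form) c y u v) z

variable (E L) in
/-- The value at `x` of a section of `Sym^d E ⊗ L^k`, in the frame at `c`. -/
def frameCoord (d k : ℕ) (c x : X) :
    (Sym[ℂ]^d (E x)) ⊗[ℂ] (⨂[ℂ]^k (L x)) →ₗ[ℂ]
      (Sym[ℂ]^d (Fin (n + 1) → ℂ)) ⊗[ℂ] (⨂[ℂ]^k ℂ) :=
  TensorProduct.map
    (symMap d ((trivializationAt (Fin (n + 1) → ℂ) E c).linearMapAt ℂ x))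
    (PiTensorProduct.map fun _ => (trivializationAt ℂ L c).linearMapAt ℂ x)

variable (n E L) in
/-- `H⁰(X, Sym^d E ⊗ L^k)`: the sections whose coordinates in the frames are holomorphic. -/
def holSections (d k : ℕ) :
    Submodule ℂ (∀ x, (Sym[ℂ]^d (E x)) ⊗[ℂ] (⨂[ℂ]^k (L x))) where
  carrier := {s | ∀ (c : X)
    (ℓ : Module.Dual ℂ ((Sym[ℂ]^d (Fin (n + 1) → ℂ)) ⊗[ℂ] (⨂[ℂ]^k ℂ))),
    DifferentiableOn ℂ (fun z => ℓ (frameCoord E L d k c ((chartAt ℂ c).symm z)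
      (s ((chartAt ℂ c).symm z)))) (frameDom (Fin (n + 1) → ℂ) E c ∩ frameDom ℂ L c)}
  add_mem' := by
    intro s t hs ht c ℓ
    simp only [Pi.add_apply, map_add]
    exact (hs c ℓ).add (ht c ℓ)
  zero_mem' := by
    intro c ℓ
    simp
  smul_mem' := by
    intro a s hs c ℓ
    simp only [Pi.smul_apply, map_smul]
    exact (hs c ℓ).const_smul a

/-- The metric `H_k = H ⊗ g^k` on the fibre of `Sym^d E ⊗ L^k` at `x`. -/
def twistForm (d k : ℕ) (H : ∀ x, HermitianMetric (Sym[ℂ]^d (E x)))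
    (g : ∀ x, HermitianMetric (L x)) (x : X) :
    SesqForm ((Sym[ℂ]^d (E x)) ⊗[ℂ] (⨂[ℂ]^k (L x))) :=
  tensorForm (H x).form (tensorPowForm k (g x).form)

/-- The covector on the fibre of `E` over the point with coordinate `ζ 0`, with affine fibre
coordinates `ζ 1, …, ζ n` in the frame at `c`. The line that it spans is the point of `ℙE*` with
holomorphic coordinates `ζ`. -/
def frameCovector (c : X) (ζ : Fin (n + 1) → ℂ) :
    Module.Dual ℂ (E ((chartAt ℂ c).symm (ζ 0))) :=
  affineCovector (Fin.tail ζ) ∘ₗ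
    (trivializationAt (Fin (n + 1) → ℂ) E c).linearMapAt ℂ ((chartAt ℂ c).symm (ζ 0))

/-- The squared norm, in the metric `Ĥ_k` on `𝒪_{ℙE*}(d) ⊗ L^k`, of the holomorphic frame dual to
`frameCovector` and tensored with the frame of `L^k`. -/
def hatFrameNormSq (d k : ℕ) (H : ∀ x, HermitianMetric (Sym[ℂ]^d (E x)))
    (g : ∀ x, HermitianMetric (L x)) (c : X) (ζ : Fin (n + 1) → ℂ) : ℝ :=
  lineNormSq g c (ζ 0) ^ k /
    dualNormSq (H ((chartAt ℂ c).symm (ζ 0))).form (covecPow d (frameCovector c ζ))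

variable (n E L) in
/-- A decomposition of the compact surface into finitely many disjoint Borel pieces, each of them
contained in a compact set inside the domain of a chart and of frames of `E` and `L`. Integrals are
computed piece by piece. -/
structure FrameCover where
  m : ℕ
  center : Fin m → X
  compactSet : Fin m → Set X
  isCompact : ∀ i, IsCompact (compactSet i)
  subset : ∀ i, compactSet i ⊆ frameSet (Fin (n + 1) → ℂ) E (center i) ∩ frameSet ℂ L (center i)
  cover : ⋃ i, compactSet i = Set.univ

/-- The `i`-th piece, in the `i`-th chart; the pieces themselves partition `X`. -/
def FrameCover.piece (𝒰 : FrameCover n E L) (i : Fin 𝒰.m) : Set ℂ :=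
  chartAt ℂ (𝒰.center i) '' (𝒰.compactSet i \ ⋃ j < i, 𝒰.compactSet j)

set_option linter.unusedSectionVars false in
theorem FrameCover.nonempty [CompactSpace X] : Nonempty (FrameCover n E L) := by
  have : LocallyCompactSpace X := ChartedSpace.locallyCompactSpace ℂ X
  have h : ∀ x : X, ∃ K : Set X, IsCompact K ∧ x ∈ interior K ∧
      K ⊆ frameSet (Fin (n + 1) → ℂ) E x ∩ frameSet ℂ L x := by
    intro x
    apply exists_compact_subset
    · exact (((chartAt ℂ x).open_source.inter (trivializationAt _ E x).open_baseSet).inter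
        ((chartAt ℂ x).open_source.inter (trivializationAt _ L x).open_baseSet))
    · exact ⟨⟨mem_chart_source ℂ x, FiberBundle.mem_baseSet_trivializationAt' x⟩,
        ⟨mem_chart_source ℂ x, FiberBundle.mem_baseSet_trivializationAt' x⟩⟩
  choose K hK hx hsub using h
  obtain ⟨t, ht⟩ := isCompact_univ.elim_finite_subcover (fun x => interior (K x))
    (fun x => isOpen_interior) (fun x _ => Set.mem_iUnion.2 ⟨x, hx x⟩)
  let e := t.equivFin
  refine ⟨⟨t.card, fun i => e.symm i, fun i => K (e.symm i), fun i => hK _, fun i => hsub _, ?_⟩⟩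
  refine Set.eq_univ_of_forall fun x => ?_
  obtain ⟨y, hy, hxy⟩ := Set.mem_iUnion₂.1 (ht (Set.mem_univ x))
  exact Set.mem_iUnion.2 ⟨e ⟨y, hy⟩, by simpa using interior_subset hxy⟩

/-- The integral `∫_X f ω_∞`. -/
def FrameCover.integralBase (𝒰 : FrameCover n E L) (g : ∀ x, HermitianMetric (L x))
    (f : X → ℂ) : ℂ :=
  ∑ i, ∫ z in 𝒰.piece i, f ((chartAt ℂ (𝒰.center i)).symm z) *
    ((2 * kahlerCoeff g (𝒰.center i) z : ℝ) : ℂ)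

/-- The integral `∫_{ℙE*} f dvol`, `dvol = ω^r / r!`, `ω = i ∂̄∂ log Ĥ_k`, of a function `f` on
`ℙE*`, given as a function of a point of `X` and a nonzero covector on the fibre of `E` which is
invariant under scaling of the covector. -/
def FrameCover.integralProj (𝒰 : FrameCover n E L) (d k : ℕ)
    (H : ∀ x, HermitianMetric (Sym[ℂ]^d (E x))) (g : ∀ x, HermitianMetric (L x))
    (f : ∀ x, Module.Dual ℂ (E x) → ℂ) : ℂ :=
  ∑ i, ∫ ζ in {ζ : Fin (n + 1) → ℂ | ζ 0 ∈ 𝒰.piece i},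
    f ((chartAt ℂ (𝒰.center i)).symm (ζ 0)) (frameCovector (𝒰.center i) ζ) *
      volCoeff (hatFrameNormSq d k H g (𝒰.center i)) ζ

/-- The function `⟨ŝ, t̂⟩` on `ℙE*`, in the metric `Ĥ_k` on `𝒪_{ℙE*}(d) ⊗ L^k`. -/
def hatPairing (d k : ℕ) (H : ∀ x, HermitianMetric (Sym[ℂ]^d (E x)))
    (g : ∀ x, HermitianMetric (L x)) (s t : ∀ x, (Sym[ℂ]^d (E x)) ⊗[ℂ] (⨂[ℂ]^k (L x)))
    (x : X) (f : Module.Dual ℂ (E x)) : ℂ :=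
  hatInnerTwist d (H x).form (tensorPowForm k (g x).form) (s x) (t x) f

end TwoBundles

end Bundles

end

/-! ### Hermitian inner products on symmetric powers -/

noncomputable section

section HermitianAlgebra

variable {V W : Type*} [AddCommGroup V] [Module ℂ V] [AddCommGroup W] [Module ℂ W]

/-! Work in a chart of the surface and a frame of the bundles. Let `G` be `Sym^d` of the
Hermitian-Einstein metric, `ρ` the coefficient of `ω_∞`, `ν` the squared norm of the frame of `L`,
and `f` a covector with affine fibre coordinates. The metric on `𝒪(d) ⊗ L^k` has squared frame norm
`ν^k / Q`, where `Q` is the squared dual norm of `f^{⊗ d}`. Its curvature in a direction `a` is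
therefore `k ρ |a₀|² + ∂_a ∂̄_a log Q`. Everything rests on computing the last term, and on
controlling its change when `G` becomes `H = G + B`.

Unperturbed metric. Let `u` be the Riesz vector of `f^{⊗ d}`, and `w` that of its covariant
derivative along `a`. The Chern curvature of `G` is the scalar `d μ ρ`, because a derivation of
`Sym^d` collects `d` equal contributions (`symDeriv_family`). Hence the curvature form is `(dμ + k)
ρ |a₀|² + q₀` with `q₀ = |w|²/|u|² - |⟨u, w⟩|²/|u|⁴`, which is nonnegative by Cauchy-Schwarz. Over
each point there is a horizontal direction on which `q₀` vanishes
(`IsEinsteinChart.exists_matForm_eq`). So the determinant splits, and the volume form is exactly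
`(dμ + k) ω_∞` times `d^n` times the Fubini-Study volume of the fibre
(`IsEinsteinChart.volCoeff_eq`). Integration over the fibre then gives `C_{r,d} (dμ + k) ⟨s, t⟩` at
every point of the base.

Fibre constant. Monomials are orthogonal for a Gaussian measure on the covectors, and their products
integrate to `Sym^d h` up to a factor. Writing a covector as `t (1, y)` and integrating over `t`
turns this into the integral over the affine chart of projective space. The determinant of the
orthonormal frame cancels against the Fubini-Study density, so the constant does not depend on `h`.

Perturbed metric. `mixed_hessian_log` expresses `∂_a ∂̄_a log Q` through `B`, `∇B` and `∇_z ∇_z̄ B`,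
where `∇` is the Chern connection of `G`. `curvature_perturbation` then bounds the change by `480 e
(q₀ + ρ |a₀|²)`, where `e` is the bound on the `C²` norm of `B`. Since `dμ + k ≥ 1/r`, this is at
most `480 r e` times the unperturbed form itself. Such a relatively small change alters the
determinant by a relative error `O(e)`, with a constant depending only on `r`
(`norm_det_add_sub_le`). The dual norm `Q` also has relative error `O(e)`, so the whole integrand
does.

Finally the off-diagonal integrand is dominated by the mean of the two diagonal ones, whose
unperturbed integrals are known exactly. As `G ≤ 2H`, these are controlled by the `H`-norms of the
sections, which are `1` (`chart_integral_estimate`). -/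

theorem sesq_eq_sum {ι : Type*} [Fintype ι] (A : SesqForm V) (b : Module.Basis ι ℂ V) (u v : V) :
    A u v = ∑ i, ∑ j, b.repr u i * conj (b.repr v j) * A (b i) (b j) := by
  conv_lhs => rw [← b.sum_repr u, ← b.sum_repr v]
  rw [map_sum A, LinearMap.sum_apply]
  refine Finset.sum_congr rfl fun i _ => ?_
  rw [map_sum]
  refine Finset.sum_congr rfl fun j _ => ?_
  rw [LinearMap.map_smul, LinearMap.smul_apply, LinearMap.map_smulₛₗ, smul_eq_mul, smul_eq_mul,
    mul_assoc]

theorem dual_eq_sum {ι : Type*} [Fintype ι] (φ : V →ₗ[ℂ] ℂ) (b : Module.Basis ι ℂ V) (v : V) :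
    φ v = ∑ i, b.repr v i * φ (b i) := by
  conv_lhs => rw [← b.sum_repr v]
  simp only [map_sum, map_smul, smul_eq_mul]

namespace HermitianMetric

theorem self_eq_ofReal (h : HermitianMetric V) (u : V) :
    h.form u u = (((h.form u u).re : ℝ) : ℂ) :=
  (Complex.conj_eq_iff_re.1 (h.conj_symm u u)).symm

theorem re_self_nonneg (h : HermitianMetric V) (u : V) : 0 ≤ (h.form u u).re := by
  by_cases hu : u = 0
  · simp [hu]
  · exact (h.pos u hu).le

/-- The pull-back of a Hermitian inner product along an injective linear map. -/
def pull (h : HermitianMetric V) (T : W →ₗ[ℂ] V) (hT : Function.Injective T) :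
    HermitianMetric W where
  form := pullForm T h.form
  conj_symm u v := h.conj_symm _ _
  pos u hu := h.pos _ fun h0 => hu (hT (by simpa using h0))

/-- The inner product in Mathlib's convention, conjugate-linear in the first variable. -/
abbrev core (h : HermitianMetric V) : InnerProductSpace.Core ℂ V where
  inner u v := h.form v u
  conj_inner_symm u v := h.conj_symm u v
  re_inner_nonneg u := h.re_self_nonneg u
  add_left u v w := by simp
  smul_left u v c := by simp
  definite u hu := by
    by_contra h0
    have := h.pos u h0
    rw [hu] at this
    simp at this

theorem norm_form_le (h : HermitianMetric V) (u v : V) :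
    ‖h.form u v‖ ≤ √(h.form u u).re * √(h.form v v).re := by
  let := h.core
  have := InnerProductSpace.Core.norm_inner_le_norm (𝕜 := ℂ) v u
  rw [mul_comm]
  exact this

theorem exists_orthonormal_basis [FiniteDimensional ℂ V] (h : HermitianMetric V) :
    ∃ b : Module.Basis (Fin (Module.finrank ℂ V)) ℂ V,
      ∀ i j, h.form (b i) (b j) = if i = j then 1 else 0 := by
  let : NormedAddCommGroup V := h.core.toNormedAddCommGroup
  let : InnerProductSpace ℂ V := InnerProductSpace.ofCore h.core.toCore
  refine ⟨(stdOrthonormalBasis ℂ V).toBasis, fun i j => ?_⟩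
  have := orthonormal_iff_ite.1 (stdOrthonormalBasis ℂ V).orthonormal j i
  rw [OrthonormalBasis.coe_toBasis]
  simp only [eq_comm (a := i)]
  exact this

theorem form_eq_sum {ι : Type*} [Fintype ι] [DecidableEq ι] (h : HermitianMetric V)
    (b : Module.Basis ι ℂ V)
    (hb : ∀ i j, h.form (b i) (b j) = if i = j then 1 else 0) (u v : V) :
    h.form u v = ∑ i, b.repr u i * conj (b.repr v i) := by
  simp [sesq_eq_sum h.form b u v, hb]

theorem exists_riesz [FiniteDimensional ℂ V] (h : HermitianMetric V) (φ : V →ₗ[ℂ] ℂ) :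
    ∃ u, ∀ v, h.form v u = φ v := by
  obtain ⟨b, hb⟩ := h.exists_orthonormal_basis
  refine ⟨∑ i, conj (φ (b i)) • b i, fun v => ?_⟩
  rw [h.form_eq_sum b hb, dual_eq_sum φ b v]
  simp [Finsupp.single_apply]

theorem ext_left (h : HermitianMetric V) {u u' : V} (H : ∀ v, h.form u v = h.form u' v) :
    u = u' := by
  by_contra hne
  have := h.pos (u - u') (sub_ne_zero.2 hne)
  have h0 : h.form (u - u') (u - u') = 0 := by
    rw [map_sub h.form, LinearMap.sub_apply, H, sub_self]
  exact absurd this (by rw [h0]; simp)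

theorem ext_right (h : HermitianMetric V) {u u' : V} (H : ∀ v, h.form v u = h.form v u') :
    u = u' :=
  h.ext_left fun v => by rw [← h.conj_symm v u, ← h.conj_symm v u', H]

/-- Cauchy-Schwarz bounds the supremum by `h.form u u`, and for `u ≠ 0` the vector `u` divided by
its norm attains it. -/
theorem dualNormSq_eq (h : HermitianMetric V) {φ : V →ₗ[ℂ] ℂ} {u : V}
    (hu : ∀ v, h.form v u = φ v) : dualNormSq h.form φ = (h.form u u).re := by
  have key : ∀ v, ‖φ v‖ ^ 2 ≤ (h.form v v).re * (h.form u u).re := by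
    intro v
    rw [← hu v]
    have := pow_le_pow_left₀ (norm_nonneg _) (h.norm_form_le v u) 2
    rwa [mul_pow, Real.sq_sqrt (h.re_self_nonneg _), Real.sq_sqrt (h.re_self_nonneg _)] at this
  apply le_antisymm
  · refine csSup_le ⟨_, ⟨0, by simp, rfl⟩⟩ ?_
    rintro _ ⟨v, hv, rfl⟩
    exact (key v).trans (mul_le_of_le_one_left (h.re_self_nonneg _) hv)
  · by_cases h0 : u = 0
    · subst h0
      simp only [map_zero, Complex.zero_re]
      exact Real.sSup_nonneg (by rintro _ ⟨v, -, rfl⟩; positivity)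
    have hp := h.pos u h0
    refine le_csSup ⟨(h.form u u).re, ?_⟩ ⟨(((√(h.form u u).re)⁻¹ : ℝ) : ℂ) • u, ?_, ?_⟩
    · rintro _ ⟨v, hv, rfl⟩
      exact (key v).trans (mul_le_of_le_one_left (h.re_self_nonneg _) hv)
    · have : h.form ((((√(h.form u u).re)⁻¹ : ℝ) : ℂ) • u) ((((√(h.form u u).re)⁻¹ : ℝ) : ℂ) • u)
          = (((√(h.form u u).re)⁻¹ * ((√(h.form u u).re)⁻¹ * (h.form u u).re) : ℝ) : ℂ) := by
        rw [LinearMap.map_smul, LinearMap.smul_apply, LinearMap.map_smulₛₗ]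
        conv_lhs => rw [h.self_eq_ofReal u]
        simp
      rw [Set.mem_ofPred_eq, this, Complex.ofReal_re, ← mul_assoc, ← mul_inv,
        Real.mul_self_sqrt hp.le, inv_mul_cancel₀ hp.ne']
    · show ‖φ _‖ ^ 2 = _
      rw [LinearMap.map_smul, ← hu, h.self_eq_ofReal u]
      simp only [smul_eq_mul, ← Complex.ofReal_mul, Complex.norm_real, Complex.ofReal_re,
        Real.norm_eq_abs, sq_abs]
      rw [mul_pow, inv_pow, Real.sq_sqrt hp.le]
      field_simp

theorem dualNormSq_pos [FiniteDimensional ℂ V] (h : HermitianMetric V) {φ : V →ₗ[ℂ] ℂ}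
    (hφ : φ ≠ 0) : 0 < dualNormSq h.form φ := by
  obtain ⟨u, hu⟩ := h.exists_riesz φ
  rw [h.dualNormSq_eq hu]
  refine h.pos u fun h0 => hφ (LinearMap.ext fun v => ?_)
  rw [← hu, h0]; simp

theorem dualNormSq_eq_sum {ι : Type*} [Fintype ι] [DecidableEq ι] (h : HermitianMetric V)
    (b : Module.Basis ι ℂ V)
    (hb : ∀ i j, h.form (b i) (b j) = if i = j then 1 else 0) (φ : V →ₗ[ℂ] ℂ) :
    dualNormSq h.form φ = ∑ i, ‖φ (b i)‖ ^ 2 := by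
  have hu : ∀ v, h.form v (∑ i, conj (φ (b i)) • b i) = φ v := by
    intro v
    rw [h.form_eq_sum b hb, dual_eq_sum φ b v]
    simp [Finsupp.single_apply]
  rw [h.dualNormSq_eq hu, hu, map_sum, Complex.re_sum]
  refine Finset.sum_congr rfl fun i _ => ?_
  rw [map_smul, smul_eq_mul, Complex.conj_mul', ← Complex.ofReal_pow, Complex.ofReal_re]

end HermitianMetric

instance SymmetricPower.finiteDimensional (d : ℕ) [FiniteDimensional ℂ V] :
    FiniteDimensional ℂ (Sym[ℂ]^d V) :=
  Module.Finite.of_surjective (SymmetricPower.mk ℂ (Fin d) V)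
    (LinearMap.range_eq_top.1 (SymmetricPower.range_mk _ _ _))

theorem sym_hom_ext {d : ℕ} {N : Type*} [AddCommGroup N] [Module ℂ N] {σ : ℂ →+* ℂ}
    {f g : Sym[ℂ]^d V →ₛₗ[σ] N}
    (h : ∀ v, f (SymmetricPower.tprod ℂ v) = g (SymmetricPower.tprod ℂ v)) : f = g :=
  LinearMap.ext_on_range (SymmetricPower.span_tprod_eq_top ℂ (Fin d) V) h

theorem sym_induction {d : ℕ} {p : Sym[ℂ]^d V → Prop}
    (ht : ∀ v, p (SymmetricPower.tprod ℂ v)) (h0 : p 0) (ha : ∀ x y, p x → p y → p (x + y))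
    (hs : ∀ (c : ℂ) x, p x → p (c • x)) (s : Sym[ℂ]^d V) : p s := by
  have : s ∈ Submodule.span ℂ (Set.range (SymmetricPower.tprod ℂ (ι := Fin d) (M := V))) := by
    rw [SymmetricPower.span_tprod_eq_top]; trivial
  induction this using Submodule.span_induction with
  | mem x hx => obtain ⟨v, rfl⟩ := hx; exact ht v
  | zero => exact h0
  | add x y _ _ hx hy => exact ha x y hx hy
  | smul c x _ hx => exact hs c x hx

/-- Products of basis vectors span the symmetric power: the universal symmetric product, followed by
the quotient by their span, is a multilinear map vanishing on tuples of basis vectors, hence zero.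
-/
theorem sym_basis_induction {d : ℕ} {ι : Type*} [Finite ι] (b : Module.Basis ι ℂ V)
    {p : Sym[ℂ]^d V → Prop}
    (ht : ∀ i : Fin d → ι, p (SymmetricPower.tprod ℂ fun k => b (i k))) (h0 : p 0)
    (ha : ∀ x y, p x → p y → p (x + y))
    (hs : ∀ (c : ℂ) x, p x → p (c • x)) (s : Sym[ℂ]^d V) : p s := by
  set q := Submodule.span ℂ
    (Set.range fun i : Fin d → ι => SymmetricPower.tprod ℂ fun k => b (i k)) with hq
  have key : q.mkQ.compMultilinearMap (SymmetricPower.tprod ℂ (ι := Fin d) (M := V)) = 0 := by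
    refine Module.Basis.ext_multilinear (fun _ => b) fun i => ?_
    simp only [LinearMap.compMultilinearMap_apply, Submodule.mkQ_apply,
      zero_apply, Submodule.Quotient.mk_eq_zero]
    exact Submodule.subset_span ⟨i, rfl⟩
  have mem : ∀ s, s ∈ q := by
    refine fun s => sym_induction (p := fun s => s ∈ q) (fun v => ?_) q.zero_mem
      (fun _ _ => q.add_mem) (fun c _ => q.smul_mem c) s
    have := congrArg (fun m => m v) key
    simpa using this
  have := mem s
  induction this using Submodule.span_induction with
  | mem x hx => obtain ⟨v, rfl⟩ := hx; exact ht v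
  | zero => exact h0
  | add x y _ _ hx hy => exact ha x y hx hy
  | smul c x _ hx => exact hs c x hx

@[simp] theorem symMap_tprod (d : ℕ) (T : V →ₗ[ℂ] W) (v : Fin d → V) :
    symMap d T (SymmetricPower.tprod ℂ v) = SymmetricPower.tprod ℂ fun i => T (v i) := by
  simp [symMap]

theorem symMap_comp {Z : Type*} [AddCommGroup Z] [Module ℂ Z] (d : ℕ) (S : W →ₗ[ℂ] Z)
    (T : V →ₗ[ℂ] W) : symMap d (S ∘ₗ T) = symMap d S ∘ₗ symMap d T :=
  sym_hom_ext fun v => by simp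

theorem symMap_id (d : ℕ) : symMap d (LinearMap.id : V →ₗ[ℂ] V) = LinearMap.id :=
  sym_hom_ext fun v => by simp

theorem symMap_injective_of_leftInverse (d : ℕ) {T : V →ₗ[ℂ] W} {S : W →ₗ[ℂ] V}
    (h : S ∘ₗ T = LinearMap.id) : Function.Injective (symMap d T) := by
  refine Function.LeftInverse.injective (g := symMap d S) fun x => ?_
  rw [← LinearMap.comp_apply, ← symMap_comp, h, symMap_id, LinearMap.id_apply]

theorem covecPow_comp (d : ℕ) (f : Module.Dual ℂ W) (T : V →ₗ[ℂ] W) :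
    covecPow d (f ∘ₗ T) = covecPow d f ∘ₗ symMap d T :=
  sym_hom_ext fun v => by simp [covecPow_tprod]

theorem sesq_sym_ext {d : ℕ} {A B : SesqForm (Sym[ℂ]^d V)}
    (h : ∀ v w, A (SymmetricPower.tprod ℂ v) (SymmetricPower.tprod ℂ w)
      = B (SymmetricPower.tprod ℂ v) (SymmetricPower.tprod ℂ w)) : A = B :=
  sym_hom_ext fun v => sym_hom_ext fun w => h v w

theorem symForm_pullForm (d : ℕ) (T : V →ₗ[ℂ] W) (h : SesqForm W) :
    symForm d (pullForm T h) = pullForm (symMap d T) (symForm d h) :=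
  sesq_sym_ext fun v w => by simp [symForm_tprod]

theorem symForm_conj_symm (d : ℕ) (h : HermitianMetric V) (s t : Sym[ℂ]^d V) :
    conj (symForm d h.form s t) = symForm d h.form t s := by
  induction s using sym_induction with
  | ht v =>
    induction t using sym_induction with
    | ht w =>
      rw [symForm_tprod, symForm_tprod]
      simp only [map_mul, map_sum, map_prod, h.conj_symm, map_inv₀, map_natCast]
      congr 1
      refine Fintype.sum_equiv (Equiv.inv _) _ _ fun σ => ?_
      rw [← Equiv.prod_comp σ (fun i => h.form (w i) (v _))]
      simp
    | h0 => simp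
    | ha x y hx hy => simp [hx, hy]
    | hs c x hx => simp [hx]
  | h0 => simp
  | ha x y hx hy => simp [hx, hy]
  | hs c x hx => simp [hx]

/-- All `d!` permuted tensors have the same class, so their average maps back to it. Symmetrization
is therefore injective, and this is what makes `Sym^d h` definite. -/
theorem mk_symmetrize (d : ℕ) (s : Sym[ℂ]^d V) :
    SymmetricPower.mk ℂ (Fin d) V (symmetrize d s) = s := by
  have : SymmetricPower.mk ℂ (Fin d) V ∘ₗ symmetrize d = LinearMap.id := by
    refine sym_hom_ext fun v => ?_
    simp only [symmetrize, LinearMap.comp_apply, symLift_tprod, LinearMap.id_apply]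
    simp only [smul_apply, sum_apply, MultilinearMap.domDomCongr_apply, map_smul, map_sum]
    have : ∀ σ : Equiv.Perm (Fin d), SymmetricPower.mk ℂ (Fin d) V
        (PiTensorProduct.tprod ℂ fun i => v (σ i)) = SymmetricPower.tprod ℂ v := fun σ =>
      SymmetricPower.tprod_equiv σ v
    simp only [this, Finset.sum_const, Finset.card_univ, Fintype.card_perm, Fintype.card_fin]
    rw [← Nat.cast_smul_eq_nsmul ℂ, smul_smul, inv_mul_cancel₀, one_smul]
    exact_mod_cast d.factorial_ne_zero
  exact congrArg (fun f => f s) this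

theorem symmetrize_injective (d : ℕ) : Function.Injective (symmetrize d (V := V)) :=
  Function.LeftInverse.injective (mk_symmetrize d)

/-- Tensor products of the vectors of an orthonormal basis are again orthonormal, so the form is a
sum of squared coordinates. -/
theorem tensorPowForm_self_pos [FiniteDimensional ℂ V] (d : ℕ) (h : HermitianMetric V)
    {s : ⨂[ℂ]^d V} (hs : s ≠ 0) : 0 < (tensorPowForm d h.form s s).re := by
  obtain ⟨b, hb⟩ := h.exists_orthonormal_basis
  let B : Module.Basis _ ℂ (⨂[ℂ]^d V) := Basis.piTensorProduct fun _ : Fin d => b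
  have hB : ∀ i j, tensorPowForm d h.form (B i) (B j) = if i = j then 1 else 0 := by
    intro i j
    simp only [B, Basis.piTensorProduct_apply, tensorPowForm_tprod, hb]
    by_cases hij : i = j
    · simp [hij]
    · obtain ⟨k, hk⟩ := Function.ne_iff.1 hij
      rw [if_neg hij]
      exact Finset.prod_eq_zero (Finset.mem_univ k) (if_neg hk)
  have : tensorPowForm d h.form s s = ∑ i, B.repr s i * conj (B.repr s i) := by
    simp [sesq_eq_sum (tensorPowForm d h.form) B s s, hB]
  rw [this, Complex.re_sum]
  simp only [Complex.mul_conj', ← Complex.ofReal_pow, Complex.ofReal_re]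
  obtain ⟨i, hi⟩ : ∃ i, B.repr s i ≠ 0 := by
    by_contra! hc
    exact hs (B.repr.injective (by ext i; simp [hc i]))
  exact Finset.sum_pos' (fun i _ => by positivity) ⟨i, Finset.mem_univ i, by positivity⟩

namespace HermitianMetric

/-- The Hermitian inner product `Sym^d h`. -/
def sym [FiniteDimensional ℂ V] (d : ℕ) (h : HermitianMetric V) :
    HermitianMetric (Sym[ℂ]^d V) where
  form := symForm d h.form
  conj_symm := symForm_conj_symm d h
  pos s hs := tensorPowForm_self_pos d h fun h0 => hs (symmetrize_injective d (by simpa using h0))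

/-- All `d!` terms of the symmetrized product with `u ⋯ u` coincide. With this normalization of
`Sym^d h`, the norm of `f^{⊗ d}` is the `d`-th power of that of `f`. -/
theorem sym_riesz {d : ℕ} (h : HermitianMetric V) {f : Module.Dual ℂ V} {u : V}
    (hu : ∀ v, h.form v u = f v) (s : Sym[ℂ]^d V) :
    symForm d h.form s (SymmetricPower.tprod ℂ fun _ => u) = covecPow d f s := by
  induction s using sym_induction with
  | ht v =>
    have hd : (d.factorial : ℂ) ≠ 0 := by exact_mod_cast d.factorial_ne_zero
    rw [symForm_tprod, covecPow_tprod]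
    simp only [hu, Finset.sum_const, Finset.card_univ, Fintype.card_perm, Fintype.card_fin,
      nsmul_eq_mul]
    field_simp
  | h0 => simp
  | ha x y hx hy => simp [hx, hy]
  | hs c x hx => simp [hx]

theorem dualNormSq_sym [FiniteDimensional ℂ V] (d : ℕ) (h : HermitianMetric V)
    (f : Module.Dual ℂ V) :
    dualNormSq (symForm d h.form) (covecPow d f) = dualNormSq h.form f ^ d := by
  obtain ⟨u, hu⟩ := h.exists_riesz f
  have := (h.sym d).dualNormSq_eq (φ := covecPow d f) (h.sym_riesz hu)
  rw [h.dualNormSq_eq hu]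
  rw [show (h.sym d).form = symForm d h.form from rfl, h.sym_riesz hu, covecPow_tprod] at this
  rw [this, Finset.prod_const, ← hu u, h.self_eq_ofReal u, ← Complex.ofReal_pow, Complex.ofReal_re,
    Complex.ofReal_re, Finset.card_univ, Fintype.card_fin]

end HermitianMetric

theorem dualNormSq_pullForm (T : W ≃ₗ[ℂ] V) (A : SesqForm V) (φ : V →ₗ[ℂ] ℂ) :
    dualNormSq (pullForm T.toLinearMap A) (φ ∘ₗ T.toLinearMap) = dualNormSq A φ := by
  unfold dualNormSq
  congr 1
  ext x
  constructor
  · rintro ⟨u, hu, rfl⟩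
    exact ⟨T u, hu, rfl⟩
  · rintro ⟨u, hu, rfl⟩
    exact ⟨T.symm u, by simpa using hu, by simp⟩

end HermitianAlgebra

end

/-! ### Wirtinger derivatives and families of sesquilinear forms -/

noncomputable section

open Filter Topology

section Wirtinger

variable {A B D : Type*} [NormedAddCommGroup A] [NormedSpace ℂ A] [NormedAddCommGroup B]
  [NormedSpace ℂ B] [NormedAddCommGroup D] [NormedSpace ℂ D]

theorem dHol_congr {f g : A → B} {p : A} (h : f =ᶠ[𝓝 p] g) (v : A) : dHol f p v = dHol g p v := by
  simp only [dHol, h.fderiv_eq]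

theorem dAnti_congr {f g : A → B} {p : A} (h : f =ᶠ[𝓝 p] g) (v : A) :
    dAnti f p v = dAnti g p v := by
  simp only [dAnti, h.fderiv_eq]

@[simp] theorem dHol_const (c : B) (p v : A) : dHol (fun _ => c) p v = 0 := by simp [dHol]

@[simp] theorem dAnti_const (c : B) (p v : A) : dAnti (fun _ => c) p v = 0 := by simp [dAnti]

section Rules

variable {f g : A → B} {p : A}

theorem dHol_add (hf : DifferentiableAt ℝ f p) (hg : DifferentiableAt ℝ g p) (v : A) :
    dHol (fun x => f x + g x) p v = dHol f p v + dHol g p v := by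
  simp only [dHol, fderiv_fun_add hf hg, add_apply, smul_add, smul_sub]
  abel

theorem dAnti_add (hf : DifferentiableAt ℝ f p) (hg : DifferentiableAt ℝ g p) (v : A) :
    dAnti (fun x => f x + g x) p v = dAnti f p v + dAnti g p v := by
  simp only [dAnti, fderiv_fun_add hf hg, add_apply, smul_add]
  abel

theorem dHol_sub (hf : DifferentiableAt ℝ f p) (hg : DifferentiableAt ℝ g p) (v : A) :
    dHol (fun x => f x - g x) p v = dHol f p v - dHol g p v := by
  simp only [dHol, fderiv_fun_sub hf hg, sub_apply, smul_sub]
  abel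

theorem dAnti_sub (hf : DifferentiableAt ℝ f p) (hg : DifferentiableAt ℝ g p) (v : A) :
    dAnti (fun x => f x - g x) p v = dAnti f p v - dAnti g p v := by
  simp only [dAnti, fderiv_fun_sub hf hg, sub_apply, smul_sub, smul_add]
  abel

theorem dHol_clm (T : B →L[ℂ] D) (hf : DifferentiableAt ℝ f p) (v : A) :
    dHol (fun x => T (f x)) p v = T (dHol f p v) := by
  have : fderiv ℝ (fun x => T (f x)) p = (T.restrictScalars ℝ).comp (fderiv ℝ f p) :=
    ((T.restrictScalars ℝ).hasFDerivAt.comp p hf.hasFDerivAt).fderiv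
  simp [dHol, this]

theorem dAnti_clm (T : B →L[ℂ] D) (hf : DifferentiableAt ℝ f p) (v : A) :
    dAnti (fun x => T (f x)) p v = T (dAnti f p v) := by
  have : fderiv ℝ (fun x => T (f x)) p = (T.restrictScalars ℝ).comp (fderiv ℝ f p) :=
    ((T.restrictScalars ℝ).hasFDerivAt.comp p hf.hasFDerivAt).fderiv
  simp [dAnti, this]

theorem dHol_sum {ι : Type*} (s : Finset ι) {F : ι → A → B}
    (h : ∀ i ∈ s, DifferentiableAt ℝ (F i) p) (v : A) :
    dHol (fun x => ∑ i ∈ s, F i x) p v = ∑ i ∈ s, dHol (F i) p v := by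
  simp only [dHol, fderiv_fun_sum h, sum_apply, Finset.smul_sum, ← Finset.sum_sub_distrib]

theorem dAnti_sum {ι : Type*} (s : Finset ι) {F : ι → A → B}
    (h : ∀ i ∈ s, DifferentiableAt ℝ (F i) p) (v : A) :
    dAnti (fun x => ∑ i ∈ s, F i x) p v = ∑ i ∈ s, dAnti (F i) p v := by
  simp only [dAnti, fderiv_fun_sum h, sum_apply, Finset.smul_sum, ← Finset.sum_add_distrib]

variable (f p) in
-- Together with conjugate-linearity of `∂̄_v` in `v`, this makes second derivatives `∂_v ∂̄_w`
-- sesquilinear in the directions, so that curvature matrices can be studied one direction at a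
-- time.
theorem dHol_smul_dir (c : ℂ) (v : A) : dHol f p (c • v) = c • dHol f p v := by
  have key : ∀ w : A, fderiv ℝ f p (c • w)
      = (c.re : ℂ) • fderiv ℝ f p w + (c.im : ℂ) • fderiv ℝ f p (Complex.I • w) := by
    intro w
    have : c • w = c.re • w + c.im • (Complex.I • w) := by
      rw [← Complex.coe_smul c.re, ← Complex.coe_smul c.im, smul_smul, ← add_smul,
        Complex.re_add_im]
    rw [this, map_add, map_smul, map_smul, Complex.coe_smul, Complex.coe_smul]
  have hI : Complex.I • c • v = c • Complex.I • v := smul_comm _ _ _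
  simp only [dHol, hI, key]
  simp only [smul_smul, Complex.I_mul_I, neg_smul, one_smul, map_neg]
  conv_rhs => rw [← Complex.re_add_im c]
  have : Complex.I * Complex.I = -1 := Complex.I_mul_I
  match_scalars <;> first | ring1 | linear_combination ((c.im : ℂ) / 2) * this

variable (f p) in
theorem dAnti_smul_dir (c : ℂ) (v : A) : dAnti f p (c • v) = conj c • dAnti f p v := by
  have key : ∀ w : A, fderiv ℝ f p (c • w)
      = (c.re : ℂ) • fderiv ℝ f p w + (c.im : ℂ) • fderiv ℝ f p (Complex.I • w) := by
    intro w
    have : c • w = c.re • w + c.im • (Complex.I • w) := by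
      rw [← Complex.coe_smul c.re, ← Complex.coe_smul c.im, smul_smul, ← add_smul,
        Complex.re_add_im]
    rw [this, map_add, map_smul, map_smul, Complex.coe_smul, Complex.coe_smul]
  have hI : Complex.I • c • v = c • Complex.I • v := smul_comm _ _ _
  have hc : conj c = c.re - c.im * Complex.I := by
    apply Complex.ext <;> simp
  simp only [dAnti, hI, key, hc]
  simp only [smul_smul, Complex.I_mul_I, neg_smul, one_smul, map_neg]
  have : Complex.I * Complex.I = -1 := Complex.I_mul_I
  match_scalars <;> first | ring1 | linear_combination ((c.im : ℂ) / 2) * this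

variable (f p) in
theorem dHol_add_dir (v w : A) : dHol f p (v + w) = dHol f p v + dHol f p w := by
  simp only [dHol, smul_add, map_add]; module

variable (f p) in
theorem dAnti_add_dir (v w : A) : dAnti f p (v + w) = dAnti f p v + dAnti f p w := by
  simp only [dAnti, smul_add, map_add]; module

theorem fderiv_real_of_complex (hf : DifferentiableAt ℂ f p) :
    fderiv ℝ f p = (fderiv ℂ f p).restrictScalars ℝ :=
  (hf.hasFDerivAt.restrictScalars ℝ).fderiv

theorem dHol_of_complex (hf : DifferentiableAt ℂ f p) (v : A) :
    dHol f p v = fderiv ℂ f p v := by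
  simp only [dHol, fderiv_real_of_complex hf, ContinuousLinearMap.coe_restrictScalars', map_smul,
    smul_smul, Complex.I_mul_I]
  module

theorem dAnti_of_complex (hf : DifferentiableAt ℂ f p) (v : A) : dAnti f p v = 0 := by
  simp only [dAnti, fderiv_real_of_complex hf, ContinuousLinearMap.coe_restrictScalars', map_smul,
    smul_smul, Complex.I_mul_I]
  module

theorem ContDiffAt.dHol {m n : WithTop ℕ∞} (hf : ContDiffAt ℝ m f p) (hmn : n + 1 ≤ m) (v : A) :
    ContDiffAt ℝ n (fun x => dHol f x v) p := by
  unfold _root_.dHol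
  have h : ContDiffAt ℝ n (fderiv ℝ f) p := hf.fderiv_right hmn
  exact contDiffAt_const.smul ((h.clm_apply contDiffAt_const).sub
    (contDiffAt_const.smul (h.clm_apply contDiffAt_const)))

theorem ContDiffAt.dAnti {m n : WithTop ℕ∞} (hf : ContDiffAt ℝ m f p) (hmn : n + 1 ≤ m) (v : A) :
    ContDiffAt ℝ n (fun x => dAnti f x v) p := by
  unfold _root_.dAnti
  have h : ContDiffAt ℝ n (fderiv ℝ f) p := hf.fderiv_right hmn
  exact contDiffAt_const.smul ((h.clm_apply contDiffAt_const).add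
    (contDiffAt_const.smul (h.clm_apply contDiffAt_const)))

/-- Composition with a complex affine map. -/
theorem dHol_comp_affine (T : A →L[ℂ] B) (b : B) {F : B → D} {p : A}
    (hF : DifferentiableAt ℝ F (T p + b)) (v : A) :
    dHol (fun x => F (T x + b)) p v = dHol F (T p + b) (T v) := by
  have : fderiv ℝ (fun x => F (T x + b)) p = (fderiv ℝ F (T p + b)).comp (T.restrictScalars ℝ) :=
    (hF.hasFDerivAt.comp p ((T.restrictScalars ℝ).hasFDerivAt.add_const b)).fderiv
  simp [dHol, this]

theorem dAnti_comp_affine (T : A →L[ℂ] B) (b : B) {F : B → D} {p : A}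
    (hF : DifferentiableAt ℝ F (T p + b)) (v : A) :
    dAnti (fun x => F (T x + b)) p v = dAnti F (T p + b) (T v) := by
  have : fderiv ℝ (fun x => F (T x + b)) p = (fderiv ℝ F (T p + b)).comp (T.restrictScalars ℝ) :=
    (hF.hasFDerivAt.comp p ((T.restrictScalars ℝ).hasFDerivAt.add_const b)).fderiv
  simp [dAnti, this]

end Rules

section Scalar

variable {f g : A → ℂ} {p : A}

theorem dHol_mul (hf : DifferentiableAt ℝ f p) (hg : DifferentiableAt ℝ g p) (v : A) :
    dHol (fun x => f x * g x) p v = dHol f p v * g p + f p * dHol g p v := by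
  simp only [dHol, fderiv_fun_mul hf hg, add_apply, smul_apply, smul_eq_mul]
  ring

theorem dAnti_mul (hf : DifferentiableAt ℝ f p) (hg : DifferentiableAt ℝ g p) (v : A) :
    dAnti (fun x => f x * g x) p v = dAnti f p v * g p + f p * dAnti g p v := by
  simp only [dAnti, fderiv_fun_mul hf hg, add_apply, smul_apply, smul_eq_mul]
  ring

theorem dHol_const_mul (c : ℂ) (hf : DifferentiableAt ℝ f p) (v : A) :
    dHol (fun x => c * f x) p v = c * dHol f p v := by
  rw [dHol_mul (differentiableAt_const c) hf]; simp

theorem dAnti_const_mul (c : ℂ) (hf : DifferentiableAt ℝ f p) (v : A) :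
    dAnti (fun x => c * f x) p v = c * dAnti f p v := by
  rw [dAnti_mul (differentiableAt_const c) hf]; simp

theorem DifferentiableAt.conj' (hf : DifferentiableAt ℝ f p) :
    DifferentiableAt ℝ (fun x => conj (f x)) p :=
  (Complex.conjCLE.toContinuousLinearMap.differentiableAt (x := f p)).comp p hf

theorem ContDiffAt.conj' {n : WithTop ℕ∞} (hf : ContDiffAt ℝ n f p) :
    ContDiffAt ℝ n (fun x => conj (f x)) p :=
  (Complex.conjCLE.toContinuousLinearMap.contDiff.contDiffAt (x := f p)).comp p hf

theorem fderiv_conj_apply (hf : DifferentiableAt ℝ f p) (v : A) :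
    fderiv ℝ (fun x => conj (f x)) p v = conj (fderiv ℝ f p v) := by
  have : fderiv ℝ (fun x => conj (f x)) p
      = Complex.conjCLE.toContinuousLinearMap.comp (fderiv ℝ f p) :=
    (Complex.conjCLE.toContinuousLinearMap.hasFDerivAt.comp p hf.hasFDerivAt).fderiv
  simp [this]

theorem dHol_conj (hf : DifferentiableAt ℝ f p) (v : A) :
    dHol (fun x => conj (f x)) p v = conj (dAnti f p v) := by
  simp [dHol, dAnti, fderiv_conj_apply hf, map_ofNat]
  ring

theorem dAnti_conj (hf : DifferentiableAt ℝ f p) (v : A) :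
    dAnti (fun x => conj (f x)) p v = conj (dHol f p v) := by
  simp [dHol, dAnti, fderiv_conj_apply hf, map_ofNat]

theorem dHol_prod {ι : Type*} [DecidableEq ι] (s : Finset ι) {F : ι → A → ℂ}
    (h : ∀ i ∈ s, DifferentiableAt ℝ (F i) p) (v : A) :
    dHol (fun x => ∏ i ∈ s, F i x) p v
      = ∑ i ∈ s, dHol (F i) p v * ∏ j ∈ s.erase i, F j p := by
  have : fderiv ℝ (fun x => ∏ i ∈ s, F i x) p
      = ∑ i ∈ s, (∏ j ∈ s.erase i, F j p) • fderiv ℝ (F i) p :=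
    (HasFDerivAt.finsetProd fun i hi => (h i hi).hasFDerivAt).fderiv
  simp only [dHol, this, sum_apply, smul_apply, smul_eq_mul, Finset.mul_sum,
    ← Finset.sum_sub_distrib]
  exact Finset.sum_congr rfl fun i _ => by ring

/-- The mixed second derivative of the logarithm of a positive function. -/
theorem dHol_dAnti_log {q : A → ℝ} (hq : ContDiffAt ℝ 2 q p) (h0 : 0 < q p) (v : A) :
    dHol (fun y => dAnti (fun x => (Real.log (q x) : ℂ)) y v) p v
      = dHol (fun y => dAnti (fun x => (q x : ℂ)) y v) p v / q p
        - ‖dAnti (fun x => (q x : ℂ)) p v‖ ^ 2 / (q p : ℂ) ^ 2 := by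
  have hcq : ContDiffAt ℝ 2 (fun x => (q x : ℂ)) p :=
    Complex.ofRealCLM.contDiff.contDiffAt.comp p hq
  have hev : ∀ᶠ y in 𝓝 p, ContDiffAt ℝ 2 q y ∧ 0 < q y :=
    (hq.eventually (by simp)).and (hq.continuousAt.eventually (lt_mem_nhds h0))
  have h1 : (fun y => dAnti (fun x => (Real.log (q x) : ℂ)) y v)
      =ᶠ[𝓝 p] fun y => dAnti (fun x => (q x : ℂ)) y v * ((q y)⁻¹ : ℝ) := by
    filter_upwards [hev] with y hy
    have hd : DifferentiableAt ℝ q y := hy.1.differentiableAt (by simp)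
    have e1 : fderiv ℝ (fun x => (Real.log (q x) : ℂ)) y
        = Complex.ofRealCLM.comp ((q y)⁻¹ • fderiv ℝ q y) :=
      (Complex.ofRealCLM.hasFDerivAt.comp y (hd.hasFDerivAt.log hy.2.ne')).fderiv
    have e2 : fderiv ℝ (fun x => (q x : ℂ)) y = Complex.ofRealCLM.comp (fderiv ℝ q y) :=
      (Complex.ofRealCLM.hasFDerivAt.comp y hd.hasFDerivAt).fderiv
    simp [dAnti, e1, e2]
    ring
  have hd : DifferentiableAt ℝ q p := hq.differentiableAt (by simp)
  have e3 : fderiv ℝ (fun y => (((q y)⁻¹ : ℝ) : ℂ)) p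
      = Complex.ofRealCLM.comp (-(q p ^ 2)⁻¹ • fderiv ℝ q p) := by
    refine (Complex.ofRealCLM.hasFDerivAt.comp p
      ((hasDerivAt_inv h0.ne').comp_hasFDerivAt p hd.hasFDerivAt)).fderiv
  have e2 : fderiv ℝ (fun x => (q x : ℂ)) p = Complex.ofRealCLM.comp (fderiv ℝ q p) :=
    (Complex.ofRealCLM.hasFDerivAt.comp p hd.hasFDerivAt).fderiv
  have hdi : DifferentiableAt ℝ (fun y => (((q y)⁻¹ : ℝ) : ℂ)) p :=
    Complex.ofRealCLM.differentiableAt.comp p (hd.inv h0.ne')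
  rw [dHol_congr h1, dHol_mul ((hcq.dAnti (n := 1) (by norm_num) v).differentiableAt (by simp)) hdi]
  -- `q` is real-valued, so `∂q` is the conjugate of `∂̄q`.
  have e4 : (‖dAnti (fun x => (q x : ℂ)) p v‖ ^ 2 : ℂ)
      = dAnti (fun x => (q x : ℂ)) p v * dHol (fun x => (q x : ℂ)) p v := by
    rw [← Complex.mul_conj']
    congr 1
    rw [← dHol_conj (hcq.differentiableAt (by simp))]
    simp
  have e5 : dHol (fun y => (((q y)⁻¹ : ℝ) : ℂ)) p v
      = -dHol (fun x => (q x : ℂ)) p v / (q p : ℂ) ^ 2 := by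
    simp only [dHol, e2, e3]
    simp
    ring
  rw [e4, e5]
  have : (q p : ℂ) ≠ 0 := by exact_mod_cast h0.ne'
  push_cast
  field_simp
  ring

end Scalar

/-! ### Families of sesquilinear forms and their derivatives. -/

section Sesq

variable {S : Type*} [AddCommGroup S] [Module ℂ S]

/-- The function of two vectors is a sesquilinear form. -/
def IsSesq (k : S → S → ℂ) : Prop := ∃ F : SesqForm S, ∀ u v, k u v = F u v

theorem SesqForm.isSesq (F : SesqForm S) : IsSesq (fun u v => F u v) := ⟨F, fun _ _ => rfl⟩

theorem IsSesq.eq_sum {k : S → S → ℂ} (hk : IsSesq k) {ι : Type*} [Fintype ι]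
    (b : Module.Basis ι ℂ S) (u v : S) :
    k u v = ∑ i, ∑ j, b.repr u i * conj (b.repr v j) * k (b i) (b j) := by
  obtain ⟨F, hF⟩ := hk
  simp only [hF]
  exact sesq_eq_sum F b u v

theorem IsSesq.of_eq_sum {k : S → S → ℂ} {ι : Type*} [Fintype ι] (b : Module.Basis ι ℂ S)
    (c : ι → ι → ℂ) (h : ∀ u v, k u v = ∑ i, ∑ j, b.repr u i * conj (b.repr v j) * c i j) :
    IsSesq k := by
  refine ⟨LinearMap.mk₂'ₛₗ (RingHom.id ℂ) (starRingEnd ℂ) k ?_ ?_ ?_ ?_, fun u v => rfl⟩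
  · intro u u' v
    simp only [h, map_add, Finsupp.add_apply, add_mul, Finset.sum_add_distrib]
  · intro a u v
    simp only [h, map_smul, Finsupp.smul_apply, smul_eq_mul, Finset.mul_sum, RingHom.id_apply,
      mul_assoc]
  · intro u v v'
    simp only [h, map_add, Finsupp.add_apply, add_mul, mul_add, Finset.sum_add_distrib]
  · intro a u v
    simp only [h, map_smul, Finsupp.smul_apply, smul_eq_mul, Finset.mul_sum, map_mul]
    exact Finset.sum_congr rfl fun i _ => Finset.sum_congr rfl fun j _ => by ring

theorem IsSesq.add_left {k : S → S → ℂ} (hk : IsSesq k) (u u' v : S) :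
    k (u + u') v = k u v + k u' v := by obtain ⟨F, hF⟩ := hk; simp [hF]

theorem IsSesq.add_right {k : S → S → ℂ} (hk : IsSesq k) (u v v' : S) :
    k u (v + v') = k u v + k u v' := by obtain ⟨F, hF⟩ := hk; simp [hF]

theorem IsSesq.zero_left {k : S → S → ℂ} (hk : IsSesq k) (v : S) : k 0 v = 0 := by
  obtain ⟨F, hF⟩ := hk; simp [hF]

theorem IsSesq.neg_left {k : S → S → ℂ} (hk : IsSesq k) (u v : S) :
    k (-u) v = -k u v := by obtain ⟨F, hF⟩ := hk; simp [hF]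

theorem IsSesq.neg_right {k : S → S → ℂ} (hk : IsSesq k) (u v : S) :
    k u (-v) = -k u v := by obtain ⟨F, hF⟩ := hk; simp [hF]

theorem IsSesq.smul_left {k : S → S → ℂ} (hk : IsSesq k) (c : ℂ) (u v : S) :
    k (c • u) v = c * k u v := by obtain ⟨F, hF⟩ := hk; simp [hF]

theorem IsSesq.smul_right {k : S → S → ℂ} (hk : IsSesq k) (c : ℂ) (u v : S) :
    k u (c • v) = conj c * k u v := by obtain ⟨F, hF⟩ := hk; simp [hF]

variable [FiniteDimensional ℂ S] {K : A → S → S → ℂ} {p : A}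

theorem IsSesq.dHol_family (hK : ∀ᶠ y in 𝓝 p, IsSesq (K y))
    (hd : ∀ u v, DifferentiableAt ℝ (fun y => K y u v) p) (a : A) :
    IsSesq (fun u v => dHol (fun y => K y u v) p a) := by
  let b := Module.finBasis ℂ S
  refine IsSesq.of_eq_sum b (fun i j => dHol (fun y => K y (b i) (b j)) p a) fun u v => ?_
  have : (fun y => K y u v) =ᶠ[𝓝 p]
      fun y => ∑ i, ∑ j, b.repr u i * conj (b.repr v j) * K y (b i) (b j) := by
    filter_upwards [hK] with y hy using hy.eq_sum b u v
  rw [dHol_congr this, dHol_sum _ fun i _ => DifferentiableAt.fun_sum fun j _ =>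
    (hd _ _).const_mul _]
  refine Finset.sum_congr rfl fun i _ => ?_
  rw [dHol_sum _ fun j _ => (hd _ _).const_mul _]
  exact Finset.sum_congr rfl fun j _ => dHol_const_mul _ (hd _ _) _

theorem IsSesq.dAnti_family (hK : ∀ᶠ y in 𝓝 p, IsSesq (K y))
    (hd : ∀ u v, DifferentiableAt ℝ (fun y => K y u v) p) (a : A) :
    IsSesq (fun u v => dAnti (fun y => K y u v) p a) := by
  let b := Module.finBasis ℂ S
  refine IsSesq.of_eq_sum b (fun i j => dAnti (fun y => K y (b i) (b j)) p a) fun u v => ?_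
  have : (fun y => K y u v) =ᶠ[𝓝 p]
      fun y => ∑ i, ∑ j, b.repr u i * conj (b.repr v j) * K y (b i) (b j) := by
    filter_upwards [hK] with y hy using hy.eq_sum b u v
  rw [dAnti_congr this, dAnti_sum _ fun i _ => DifferentiableAt.fun_sum fun j _ =>
    (hd _ _).const_mul _]
  refine Finset.sum_congr rfl fun i _ => ?_
  rw [dAnti_sum _ fun j _ => (hd _ _).const_mul _]
  exact Finset.sum_congr rfl fun j _ => dAnti_const_mul _ (hd _ _) _

end Sesq

/-! ### Leibniz rules for a varying form evaluated at varying vectors. -/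

section SesqCalculus

variable {S : Type*} [NormedAddCommGroup S] [NormedSpace ℂ S] [FiniteDimensional ℂ S]
  {K : A → S → S → ℂ} {p : A} {x y : A → S}

/-- The coordinates with respect to a basis as continuous linear forms. -/
def coordCLM {ι : Type*} (b : Module.Basis ι ℂ S) (i : ι) : S →L[ℂ] ℂ :=
  (b.coord i).toContinuousLinearMap

@[simp] theorem coordCLM_apply {ι : Type*} (b : Module.Basis ι ℂ S) (i : ι) (u : S) :
    coordCLM b i u = b.repr u i := rfl

theorem differentiableAt_repr {ι : Type*} (b : Module.Basis ι ℂ S) (i : ι)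
    (hx : DifferentiableAt ℝ x p) : DifferentiableAt ℝ (fun ζ => b.repr (x ζ) i) p :=
  (((coordCLM b i).restrictScalars ℝ).differentiableAt (x := x p)).comp p hx

theorem contDiffAt_repr {ι : Type*} (b : Module.Basis ι ℂ S) (i : ι) {n : WithTop ℕ∞}
    (hx : ContDiffAt ℝ n x p) : ContDiffAt ℝ n (fun ζ => b.repr (x ζ) i) p :=
  (((coordCLM b i).restrictScalars ℝ).contDiff.contDiffAt (x := x p)).comp p hx

theorem sesq_expand (hK : ∀ᶠ ζ in 𝓝 p, IsSesq (K ζ)) :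
    (fun ζ => K ζ (x ζ) (y ζ)) =ᶠ[𝓝 p] fun ζ => ∑ i, ∑ j,
      (Module.finBasis ℂ S).repr (x ζ) i * conj ((Module.finBasis ℂ S).repr (y ζ) j)
        * K ζ (Module.finBasis ℂ S i) (Module.finBasis ℂ S j) := by
  filter_upwards [hK] with ζ hζ using hζ.eq_sum _ _ _

theorem ContDiffAt.sesq {n : WithTop ℕ∞} (hK : ∀ᶠ ζ in 𝓝 p, IsSesq (K ζ))
    (hd : ∀ u v, ContDiffAt ℝ n (fun ζ => K ζ u v) p) (hx : ContDiffAt ℝ n x p)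
    (hy : ContDiffAt ℝ n y p) : ContDiffAt ℝ n (fun ζ => K ζ (x ζ) (y ζ)) p := by
  refine ContDiffAt.congr_of_eventuallyEq ?_ (sesq_expand hK)
  exact ContDiffAt.sum fun i _ => ContDiffAt.sum fun j _ =>
    ((contDiffAt_repr _ i hx).mul (contDiffAt_repr _ j hy).conj').mul (hd _ _)

theorem DifferentiableAt.sesq (hK : ∀ᶠ ζ in 𝓝 p, IsSesq (K ζ))
    (hd : ∀ u v, DifferentiableAt ℝ (fun ζ => K ζ u v) p) (hx : DifferentiableAt ℝ x p)
    (hy : DifferentiableAt ℝ y p) : DifferentiableAt ℝ (fun ζ => K ζ (x ζ) (y ζ)) p := by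
  refine DifferentiableAt.congr_of_eventuallyEq ?_ (sesq_expand hK)
  exact DifferentiableAt.fun_sum fun i _ => DifferentiableAt.fun_sum fun j _ =>
    ((differentiableAt_repr _ i hx).mul (differentiableAt_repr _ j hy).conj').mul (hd _ _)

/-- In a fixed basis this is the product rule for scalars. The second argument enters through
conjugated coordinates, so `∂` reaches `y` as `∂̄ y`. -/
theorem dHol_sesq (hK : ∀ᶠ ζ in 𝓝 p, IsSesq (K ζ))
    (hd : ∀ u v, DifferentiableAt ℝ (fun ζ => K ζ u v) p) (hx : DifferentiableAt ℝ x p)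
    (hy : DifferentiableAt ℝ y p) (a : A) :
    dHol (fun ζ => K ζ (x ζ) (y ζ)) p a = dHol (fun ζ => K ζ (x p) (y p)) p a
      + K p (dHol x p a) (y p) + K p (x p) (dAnti y p a) := by
  have hX := fun i => differentiableAt_repr (Module.finBasis ℂ S) i hx
  have hY := fun i => differentiableAt_repr (Module.finBasis ℂ S) i hy
  rw [dHol_congr (sesq_expand hK), (IsSesq.dHol_family hK hd a).eq_sum (Module.finBasis ℂ S),
    hK.self_of_nhds.eq_sum (Module.finBasis ℂ S) (dHol x p a),
    hK.self_of_nhds.eq_sum (Module.finBasis ℂ S) (x p),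
    dHol_sum _ fun i _ => DifferentiableAt.fun_sum fun j _ =>
      ((hX i).fun_mul (hY j).conj').fun_mul (hd _ _)]
  simp only [← Finset.sum_add_distrib]
  refine Finset.sum_congr rfl fun i _ => ?_
  rw [dHol_sum _ fun j _ => ((hX i).fun_mul (hY j).conj').fun_mul (hd _ _)]
  refine Finset.sum_congr rfl fun j _ => ?_
  rw [dHol_mul ((hX i).fun_mul (hY j).conj') (hd _ _), dHol_mul (hX i) (hY j).conj',
    dHol_conj (hY j)]
  have e1 := dHol_clm (coordCLM (Module.finBasis ℂ S) i) hx a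
  have e2 := dAnti_clm (coordCLM (Module.finBasis ℂ S) j) hy a
  simp only [coordCLM_apply] at e1 e2
  rw [e1, e2]
  ring

theorem dAnti_sesq (hK : ∀ᶠ ζ in 𝓝 p, IsSesq (K ζ))
    (hd : ∀ u v, DifferentiableAt ℝ (fun ζ => K ζ u v) p) (hx : DifferentiableAt ℝ x p)
    (hy : DifferentiableAt ℝ y p) (a : A) :
    dAnti (fun ζ => K ζ (x ζ) (y ζ)) p a = dAnti (fun ζ => K ζ (x p) (y p)) p a
      + K p (dAnti x p a) (y p) + K p (x p) (dHol y p a) := by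
  have hX := fun i => differentiableAt_repr (Module.finBasis ℂ S) i hx
  have hY := fun i => differentiableAt_repr (Module.finBasis ℂ S) i hy
  rw [dAnti_congr (sesq_expand hK), (IsSesq.dAnti_family hK hd a).eq_sum (Module.finBasis ℂ S),
    hK.self_of_nhds.eq_sum (Module.finBasis ℂ S) (dAnti x p a),
    hK.self_of_nhds.eq_sum (Module.finBasis ℂ S) (x p),
    dAnti_sum _ fun i _ => DifferentiableAt.fun_sum fun j _ =>
      ((hX i).fun_mul (hY j).conj').fun_mul (hd _ _)]
  simp only [← Finset.sum_add_distrib]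
  refine Finset.sum_congr rfl fun i _ => ?_
  rw [dAnti_sum _ fun j _ => ((hX i).fun_mul (hY j).conj').fun_mul (hd _ _)]
  refine Finset.sum_congr rfl fun j _ => ?_
  rw [dAnti_mul ((hX i).fun_mul (hY j).conj') (hd _ _), dAnti_mul (hX i) (hY j).conj',
    dAnti_conj (hY j)]
  have e1 := dAnti_clm (coordCLM (Module.finBasis ℂ S) i) hx a
  have e2 := dHol_clm (coordCLM (Module.finBasis ℂ S) j) hy a
  simp only [coordCLM_apply] at e1 e2
  rw [e1, e2]
  ring

end SesqCalculus

end Wirtinger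

end

/-! ### Dual norms of smooth families -/

noncomputable section

open Filter Topology

section Curvature

/-- The function of two vectors is a Hermitian inner product. -/
def IsMetric {S : Type*} [AddCommGroup S] [Module ℂ S] (k : S → S → ℂ) : Prop :=
  ∃ h : HermitianMetric S, ∀ u v, k u v = h.form u v

section

variable {S : Type*} [AddCommGroup S] [Module ℂ S] {k : S → S → ℂ}

theorem IsMetric.isSesq (hk : IsMetric k) : IsSesq k := by
  obtain ⟨h, hh⟩ := hk; exact ⟨h.form, hh⟩

theorem IsMetric.conj_symm (hk : IsMetric k) (u v : S) : conj (k u v) = k v u := by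
  obtain ⟨h, hh⟩ := hk; simp only [hh, h.conj_symm]

end

variable {A S : Type*} [NormedAddCommGroup A] [NormedSpace ℂ A] [NormedAddCommGroup S]
  [NormedSpace ℂ S] [FiniteDimensional ℂ S]

theorem ContDiffAt.matrix_det {m : ℕ} {M : A → Matrix (Fin m) (Fin m) ℂ} {p : A}
    {n : WithTop ℕ∞} (hM : ∀ i j, ContDiffAt ℝ n (fun ζ => M ζ i j) p) :
    ContDiffAt ℝ n (fun ζ => (M ζ).det) p := by
  simp only [Matrix.det_apply']
  exact ContDiffAt.sum fun σ _ => contDiffAt_const.mul (contDiffAt_prod fun i _ => hM _ _)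

theorem ContDiffAt.matrix_inv {m : ℕ} {M : A → Matrix (Fin m) (Fin m) ℂ} {p : A}
    {n : WithTop ℕ∞} (hM : ∀ i j, ContDiffAt ℝ n (fun ζ => M ζ i j) p) (h0 : (M p).det ≠ 0)
    (i j : Fin m) : ContDiffAt ℝ n (fun ζ => (M ζ)⁻¹ i j) p := by
  simp only [Matrix.inv_def, Matrix.smul_apply, Ring.inverse_eq_inv', smul_eq_mul,
    Matrix.adjugate_apply]
  refine ((ContDiffAt.matrix_det hM).inv h0).mul (ContDiffAt.matrix_det fun i' j' => ?_)
  simp only [Matrix.updateRow_apply]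
  split_ifs
  · exact contDiffAt_const
  · exact hM _ _

omit [FiniteDimensional ℂ S] in
-- A kernel vector of the Gram matrix gives, after conjugating its entries, a vector orthogonal to
-- everything.
theorem IsMetric.gram_det_ne_zero {k : S → S → ℂ} (hk : IsMetric k) {m : ℕ}
    (b : Module.Basis (Fin m) ℂ S) : (Matrix.of fun i j => k (b i) (b j)).det ≠ 0 := by
  intro h0
  obtain ⟨x, hx, hM⟩ := Matrix.exists_mulVec_eq_zero_iff.2 h0
  obtain ⟨h, hh⟩ := hk
  have hw : ∀ v, h.form v (∑ j, conj (x j) • b j) = 0 := by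
    intro v
    have : h.form.flip (∑ j, conj (x j) • b j) = 0 := by
      refine b.ext fun i => ?_
      have := congrFun hM i
      simp only [Matrix.mulVec, dotProduct, Matrix.of_apply, hh, Pi.zero_apply] at this
      rw [LinearMap.flip_apply, map_sum, LinearMap.zero_apply, ← this]
      refine Finset.sum_congr rfl fun j _ => ?_
      rw [LinearMap.map_smulₛₗ, Complex.conj_conj, smul_eq_mul, mul_comm]
    simpa using congrArg (fun f => f v) this
  have hz : ∑ j, conj (x j) • b j = 0 := h.ext_right fun v => by rw [hw, map_zero]
  refine hx (funext fun j => ?_)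
  have := Fintype.linearIndependent_iff.1 b.linearIndependent _ hz j
  simpa using this

/-- The Riesz vectors of a smooth family of linear forms form a smooth family. -/
theorem exists_contDiffAt_riesz {K : A → S → S → ℂ} {Φ : A → S → ℂ} {p : A} {n : WithTop ℕ∞}
    (hK : ∀ᶠ ζ in 𝓝 p, IsMetric (K ζ)) (hd : ∀ u v, ContDiffAt ℝ n (fun ζ => K ζ u v) p)
    (hΦ : ∀ᶠ ζ in 𝓝 p, ∃ φ : S →ₗ[ℂ] ℂ, ∀ v, Φ ζ v = φ v)
    (hΦd : ∀ v, ContDiffAt ℝ n (fun ζ => Φ ζ v) p) :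
    ∃ u : A → S, ContDiffAt ℝ n u p ∧ ∀ᶠ ζ in 𝓝 p, ∀ v, K ζ v (u ζ) = Φ ζ v := by
  let b := Module.finBasis ℂ S
  let M : A → Matrix _ _ ℂ := fun ζ => Matrix.of fun i j => K ζ (b i) (b j)
  refine ⟨fun ζ => ∑ j, conj (∑ i, (M ζ)⁻¹ j i * Φ ζ (b i)) • b j, ?_, ?_⟩
  · refine ContDiffAt.sum fun j _ => ContDiffAt.smul (ContDiffAt.conj' ?_) contDiffAt_const
    exact ContDiffAt.sum fun i _ =>
      (ContDiffAt.matrix_inv (fun _ _ => hd _ _) (hK.self_of_nhds.gram_det_ne_zero b) _ _).mul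
        (hΦd _)
  · filter_upwards [hK, hΦ] with ζ hζ hφ v
    obtain ⟨φ, hφ⟩ := hφ
    have hdet := hζ.gram_det_ne_zero b
    obtain ⟨h, hh⟩ := hζ
    rw [hφ, hh]
    rw [← LinearMap.flip_apply]
    congr 1
    refine b.ext fun i => ?_
    have hinv : M ζ * (M ζ)⁻¹ = 1 := Matrix.mul_nonsing_inv _ (isUnit_iff_ne_zero.2 hdet)
    have e : ∀ x : Fin _ → ℂ, (M ζ).mulVec ((M ζ)⁻¹.mulVec x) = x := by
      intro x; rw [Matrix.mulVec_mulVec, hinv, Matrix.one_mulVec]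
    have := congrFun (e fun i => φ (b i)) i
    rw [← this, LinearMap.flip_apply, map_sum]
    simp only [Matrix.mulVec, dotProduct, LinearMap.map_smulₛₗ, Complex.conj_conj, smul_eq_mul, hφ]
    refine Finset.sum_congr rfl fun j _ => ?_
    rw [mul_comm]
    congr 1
    exact (hh _ _).symm

/-- The mixed second derivative of the squared norm of a family of vectors which is dual to a
holomorphic family of linear forms. -/
theorem mixed_hessian_norm {K : A → S → S → ℂ} {p a : A} {u : A → S}
    (hK : ∀ᶠ ζ in 𝓝 p, IsMetric (K ζ)) (hd : ∀ u v, ContDiffAt ℝ 2 (fun ζ => K ζ u v) p)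
    (hu : ContDiffAt ℝ 2 u p)
    (h1 : ∀ᶠ ζ in 𝓝 p, ∀ v, dAnti (fun η => K η v (u η)) ζ a = 0)
    (h2 : ∀ v, dAnti (fun ζ => dHol (fun η => K η v (u η)) ζ a) p a = 0) :
    (∀ v, K p v (dHol u p a) = -dAnti (fun ζ => K ζ v (u p)) p a) ∧
    dAnti (fun ζ => K ζ (u ζ) (u ζ)) p a = K p (dAnti u p a) (u p) ∧
    dHol (fun y => dAnti (fun x => K x (u x) (u x)) y a) p a
      = K p (dAnti u p a) (dAnti u p a) + K p (dHol u p a) (dHol u p a)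
        - dHol (fun y => dAnti (fun x => K x (u p) (u p)) y a) p a := by
  have hS : ∀ᶠ ζ in 𝓝 p, IsSesq (K ζ) := hK.mono fun _ h => h.isSesq
  have hev : ∀ᶠ ζ in 𝓝 p, (∀ u v, ContDiffAt ℝ 2 (fun ζ => K ζ u v) ζ) := by
    let b := Module.finBasis ℂ S
    have : ∀ᶠ ζ in 𝓝 p, ∀ i j, ContDiffAt ℝ 2 (fun ζ => K ζ (b i) (b j)) ζ :=
      eventually_all.2 fun i => eventually_all.2 fun j => (hd _ _).eventually (by simp)
    filter_upwards [this, hS.eventually_nhds] with ζ hζ hζS x y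
    refine ContDiffAt.congr_of_eventuallyEq (f := fun η => ∑ i, ∑ j,
      b.repr x i * conj (b.repr y j) * K η (b i) (b j)) ?_ ?_
    · exact ContDiffAt.sum fun i _ => ContDiffAt.sum fun j _ => contDiffAt_const.mul (hζ i j)
    · filter_upwards [hζS] with η hη using hη.eq_sum b x y
  have huev : ∀ᶠ ζ in 𝓝 p, ContDiffAt ℝ 2 u ζ := hu.eventually (by simp)
  have hdd : ∀ u v, DifferentiableAt ℝ (fun ζ => K ζ u v) p := fun u v =>
    (hd u v).differentiableAt (by simp)
  -- Leibniz applied to `∂̄ (K(v, u)) = 0`: the derivative `∂u` is determined by `∂̄K`.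
  have hKdu : ∀ᶠ ζ in 𝓝 p, ∀ v, K ζ v (dHol u ζ a) = -dAnti (fun η => K η v (u ζ)) ζ a := by
    filter_upwards [hS.eventually_nhds, hev, huev, h1] with ζ hζS hζ hζu h1 v
    have := dAnti_sesq (x := fun _ => v) hζS (fun u v => (hζ u v).differentiableAt (by simp))
      (differentiableAt_const v) (hζu.differentiableAt (by simp)) a
    rw [h1, dAnti_const, (hζS.self_of_nhds).zero_left] at this
    linear_combination -this
  -- Of the three Leibniz terms of `∂̄ (K(u, u))`, the ones with `∂̄K` and `∂u` cancel by the
  -- previous identity.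
  have hQ : (fun ζ => dAnti (fun x => K x (u x) (u x)) ζ a)
      =ᶠ[𝓝 p] fun ζ => K ζ (dAnti u ζ a) (u ζ) := by
    filter_upwards [hS.eventually_nhds, hev, huev, hKdu] with ζ hζS hζ hζu hζdu
    have := dAnti_sesq hζS (fun u v => (hζ u v).differentiableAt (by simp))
      (hζu.differentiableAt (by simp)) (hζu.differentiableAt (by simp)) a
    rw [this, hζdu]
    ring
  refine ⟨hKdu.self_of_nhds, hQ.self_of_nhds, ?_⟩
  have hdu : DifferentiableAt ℝ u p := hu.differentiableAt (by simp)
  have hddu : DifferentiableAt ℝ (fun ζ => dAnti u ζ a) p :=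
    (hu.dAnti (n := 1) (by norm_num) a).differentiableAt (by simp)
  rw [dHol_congr hQ, dHol_sesq hS hdd hddu hdu]
  have e1 : (fun ζ => dHol (fun η => K η (u p) (u η)) ζ a) =ᶠ[𝓝 p]
      fun ζ => dHol (fun η => K η (u p) (u ζ)) ζ a + K ζ (u p) (dAnti u ζ a) := by
    filter_upwards [hS.eventually_nhds, hev, huev] with ζ hζS hζ hζu
    have := dHol_sesq (x := fun _ => u p) hζS (fun u v => (hζ u v).differentiableAt (by simp))
      (differentiableAt_const _) (hζu.differentiableAt (by simp)) a
    rw [dHol_const, (hζS.self_of_nhds).zero_left, add_zero] at this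
    exact this
  have hS1 : ∀ᶠ ζ in 𝓝 p, IsSesq fun x y => dHol (fun η => K η x y) ζ a := by
    filter_upwards [hS.eventually_nhds, hev] with ζ hζS hζ
    exact IsSesq.dHol_family hζS (fun u v => (hζ u v).differentiableAt (by simp)) a
  have hd1 : ∀ x y, DifferentiableAt ℝ (fun ζ => dHol (fun η => K η x y) ζ a) p := fun x y =>
    ((hd x y).dHol (n := 1) (by norm_num) a).differentiableAt (by simp)
  -- Another derivative of `K(∂̄u, u)` produces the unknown `∂∂̄u`. The second-order holomorphy
  -- condition, with `v` frozen at `u p`, expresses it through the other terms.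
  have e2 := h2 (u p)
  rw [dAnti_congr e1, dAnti_add
    (DifferentiableAt.sesq (K := fun ζ x y => dHol (fun η => K η x y) ζ a)
      hS1 hd1 (differentiableAt_const _) hdu)
    (DifferentiableAt.sesq hS hdd (differentiableAt_const _) hddu),
    dAnti_sesq (K := fun ζ x y => dHol (fun η => K η x y) ζ a) hS1 hd1
      (differentiableAt_const _) hdu,
    dAnti_sesq hS hdd (differentiableAt_const _) hddu] at e2
  simp only [dAnti_const] at e2
  rw [hS1.self_of_nhds.zero_left, hS.self_of_nhds.zero_left] at e2
  have e3 := congrArg conj e2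
  simp only [map_add, map_zero] at e3
  have c1 : ∀ x y, conj (dHol (fun ζ => K ζ x y) p a) = dAnti (fun ζ => K ζ y x) p a := by
    intro x y
    rw [← dAnti_conj (hdd _ _)]
    exact dAnti_congr (hK.mono fun ζ h => h.conj_symm _ _) _
  have c1' : ∀ x y, conj (dAnti (fun ζ => K ζ x y) p a) = dHol (fun ζ => K ζ y x) p a := by
    intro x y
    rw [← dHol_conj (hdd _ _)]
    exact dHol_congr (hK.mono fun ζ h => h.conj_symm _ _) _
  have c2 : conj (dAnti (fun ζ => dHol (fun η => K η (u p) (u p)) ζ a) p a)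
      = dHol (fun ζ => dAnti (fun η => K η (u p) (u p)) ζ a) p a := by
    rw [← dHol_conj (hd1 _ _)]
    refine dHol_congr ?_ _
    filter_upwards [hev, hK.eventually_nhds] with ζ hζ hζK
    rw [← dAnti_conj ((hζ _ _).differentiableAt (by simp))]
    exact dAnti_congr (hζK.mono fun ζ h => h.conj_symm _ _) _
  rw [c1, c1', c2, hK.self_of_nhds.conj_symm] at e3
  rw [hKdu.self_of_nhds]
  linear_combination e3

end Curvature

end

/-! ### The curvature of a dual norm in terms of the Chern connection -/

noncomputable section

open Filter Topology

section ChernFormula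

variable {S : Type*} [AddCommGroup S] [Module ℂ S]

/-- The Chern form is characterised by its defining identity. -/
theorem chernForm_eq {G : ℂ → S → S → ℂ} {z : ℂ} (hG : IsMetric (G z)) {u w : S}
    (h : ∀ v, G z w v = dHol (fun y => G y u v) z 1) : chernForm G z u = w := by
  have hinj : Function.Injective (G z) := by
    obtain ⟨g, hg⟩ := hG
    intro x y hxy
    exact g.ext_left fun v => by rw [← hg, ← hg, hxy]
  have : (fun v => dHol (fun y => G y u v) z 1) = G z w := funext fun v => (h v).symm
  rw [chernForm, this, Function.leftInverse_invFun hinj]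

variable {A : Type*} [NormedAddCommGroup A] [NormedSpace ℂ A] {S : Type*} [NormedAddCommGroup S]
  [NormedSpace ℂ S] [FiniteDimensional ℂ S]

/-- Finitely many pairs of basis vectors control all pairs, so one neighbourhood serves for every
`u` and `v`. -/
theorem eventually_contDiffAt_sesq {K : A → S → S → ℂ} {p : A}
    (hS : ∀ᶠ ζ in 𝓝 p, IsSesq (K ζ)) (hd : ∀ u v, ContDiffAt ℝ 2 (fun ζ => K ζ u v) p) :
    ∀ᶠ ζ in 𝓝 p, ∀ u v, ContDiffAt ℝ 2 (fun ζ => K ζ u v) ζ := by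
  let b := Module.finBasis ℂ S
  have : ∀ᶠ ζ in 𝓝 p, ∀ i j, ContDiffAt ℝ 2 (fun ζ => K ζ (b i) (b j)) ζ :=
    eventually_all.2 fun i => eventually_all.2 fun j => (hd _ _).eventually (by simp)
  filter_upwards [this, hS.eventually_nhds] with ζ hζ hζS x y
  refine ContDiffAt.congr_of_eventuallyEq (f := fun η => ∑ i, ∑ j,
    b.repr x i * conj (b.repr y j) * K η (b i) (b j)) ?_ ?_
  · exact ContDiffAt.sum fun i _ => ContDiffAt.sum fun j _ => contDiffAt_const.mul (hζ i j)
  · filter_upwards [hζS] with η hη using hη.eq_sum b x y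

theorem eventually_contDiffAt_linear {Φ : A → S → ℂ} {p : A}
    (hΦ : ∀ ζ, ∃ φ : S →ₗ[ℂ] ℂ, ∀ v, Φ ζ v = φ v)
    (hΦd : ∀ v, ContDiffAt ℂ 2 (fun ζ => Φ ζ v) p) :
    ∀ᶠ ζ in 𝓝 p, ∀ v, ContDiffAt ℂ 2 (fun ζ => Φ ζ v) ζ := by
  let b := Module.finBasis ℂ S
  have : ∀ᶠ ζ in 𝓝 p, ∀ i, ContDiffAt ℂ 2 (fun ζ => Φ ζ (b i)) ζ :=
    eventually_all.2 fun i => (hΦd _).eventually (by simp)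
  filter_upwards [this] with ζ hζ v
  have e : (fun η => Φ η v) = fun η => ∑ i, b.repr v i * Φ η (b i) := by
    funext η
    obtain ⟨φ, hφ⟩ := hΦ η
    simp only [hφ]
    exact dual_eq_sum φ b v
  rw [e]
  exact ContDiffAt.sum fun i _ => contDiffAt_const.mul (hζ i)

omit [FiniteDimensional ℂ S] in
theorem IsSesq.sub {k k' : S → S → ℂ} (hk : IsSesq k) (hk' : IsSesq k') :
    IsSesq fun u v => k u v - k' u v := by
  obtain ⟨F, hF⟩ := hk
  obtain ⟨F', hF'⟩ := hk'
  exact ⟨F - F', fun u v => by simp [hF, hF']⟩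

omit [FiniteDimensional ℂ S] in
theorem isSesq_of_add {k k' : S → S → ℂ} (hk : IsSesq k) (hk' : IsSesq fun u v => k u v + k' u v) :
    IsSesq k' := by
  have := hk'.sub hk
  simpa using this

/-- The curvature of the metric `log |Φ|²` for the dual of the metric `G + B`, in terms of the Chern
connection of `G`, whose curvature is a scalar. -/
theorem mixed_hessian_log {G B : ℂ → S → S → ℂ} {pr : A →L[ℂ] ℂ} {p a : A} {κ : ℝ}
    {Φ : A → S → ℂ} {q : A → ℝ}
    (hG : ∀ᶠ z in 𝓝 (pr p), IsMetric (G z))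
    (hK : ∀ᶠ z in 𝓝 (pr p), IsMetric fun u v => G z u v + B z u v)
    (hGd : ∀ u v, ContDiffAt ℝ 2 (fun z => G z u v) (pr p))
    (hBd : ∀ u v, ContDiffAt ℝ 2 (fun z => B z u v) (pr p))
    (hθd : ∀ u, DifferentiableAt ℝ (fun z => chernForm G z u) (pr p))
    (hθ : ∀ᶠ z in 𝓝 (pr p), ∀ u v, G z (chernForm G z u) v = dHol (fun y => G y u v) z 1)
    (hκ : ∀ u, dAnti (fun z => chernForm G z u) (pr p) 1 = -(κ : ℂ) • u)
    (hΦ : ∀ ζ, ∃ φ : S →ₗ[ℂ] ℂ, ∀ v, Φ ζ v = φ v)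
    (hΦd : ∀ v, ContDiffAt ℂ 2 (fun ζ => Φ ζ v) p)
    (hq : ∀ᶠ ζ in 𝓝 p, ∀ u, (∀ v, G (pr ζ) v u + B (pr ζ) v u = Φ ζ v) →
      (G (pr ζ) u u + B (pr ζ) u u) = q ζ)
    (hq0 : 0 < q p) :
    ∃ u w₁ w₂ : S, (∀ v, G (pr p) v u + B (pr p) v u = Φ p v) ∧
      (∀ v, G (pr p) v w₁ + B (pr p) v w₁ = dHol (fun ζ => Φ ζ v) p a
        - pr a * Φ p (chernForm G (pr p) v) - pr a * covHol G B (pr p) v u) ∧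
      (∀ v, G (pr p) v w₂ + B (pr p) v w₂ = conj (pr a) * covAnti G B (pr p) v u) ∧
      ContDiffAt ℝ 2 q p ∧
      dHol (fun y => dAnti (fun x => (Real.log (q x) : ℂ)) y a) p a
        = κ * ‖pr a‖ ^ 2 + (G (pr p) w₁ w₁ + B (pr p) w₁ w₁ + (G (pr p) w₂ w₂ + B (pr p) w₂ w₂)
          - ‖pr a‖ ^ 2 * covHol G (covAnti G B) (pr p) u u) / q p
          - ‖G (pr p) u w₁ + B (pr p) u w₁‖ ^ 2 / (q p : ℂ) ^ 2 := by
  set z₀ := pr p with hz₀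
  set a₀ := pr a with ha₀
  set θ : S → S := chernForm G z₀ with hθ₀
  set K : ℂ → S → S → ℂ := fun z u v => G z u v + B z u v with hKdef
  have hKd : ∀ u v, ContDiffAt ℝ 2 (fun z => K z u v) z₀ := fun u v => (hGd u v).add (hBd u v)
  have hpr : Tendsto pr (𝓝 p) (𝓝 z₀) := pr.continuous.continuousAt
  have hGS : ∀ᶠ z in 𝓝 z₀, IsSesq (G z) := hG.mono fun _ h => h.isSesq
  have hKS : ∀ᶠ z in 𝓝 z₀, IsSesq (K z) := hK.mono fun _ h => h.isSesq
  have hBS : ∀ᶠ z in 𝓝 z₀, IsSesq (B z) := by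
    filter_upwards [hGS, hKS] with z h1 h2 using isSesq_of_add h1 h2
  have hBC : ∀ᶠ z in 𝓝 z₀, ∀ u v, conj (B z u v) = B z v u := by
    filter_upwards [hG, hK] with z h1 h2 u v
    have := h2.conj_symm u v
    rw [map_add, h1.conj_symm] at this
    exact add_left_cancel this
  have hGev := eventually_contDiffAt_sesq hGS hGd
  have hBev := eventually_contDiffAt_sesq hBS hBd
  have hKev := eventually_contDiffAt_sesq hKS hKd
  -- derivatives of the metric along the base
  have dK : ∀ u v, dHol (fun z => K z u v) z₀ 1 = K z₀ (θ u) v + covHol G B z₀ u v := by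
    intro u v
    rw [hKdef, dHol_add ((hGd _ _).differentiableAt (by simp)) ((hBd _ _).differentiableAt (by simp)),
      ← hθ.self_of_nhds, covHol]
    ring
  have dKbar : ∀ᶠ z in 𝓝 z₀, ∀ u v, dAnti (fun y => K y u v) z 1
      = K z u (chernForm G z v) + covAnti G B z u v := by
    filter_upwards [hG.eventually_nhds, hGev, hBev, hθ] with z hGz hGz' hBz' hθz u v
    have e : dAnti (fun y => G y u v) z 1 = G z u (chernForm G z v) := by
      rw [← hGz.self_of_nhds.conj_symm, hθz, ← dAnti_conj ((hGz' _ _).differentiableAt (by simp))]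
      exact dAnti_congr (hGz.mono fun y hy => (hy.conj_symm _ _).symm) _
    rw [hKdef, dAnti_add ((hGz' _ _).differentiableAt (by simp))
      ((hBz' _ _).differentiableAt (by simp)), e, covAnti]
    ring
  -- the pulled back metric
  set M : A → S → S → ℂ := fun ζ => K (pr ζ) with hM
  have hMm : ∀ᶠ ζ in 𝓝 p, IsMetric (M ζ) := hpr.eventually hK
  have hMd : ∀ u v, ContDiffAt ℝ 2 (fun ζ => M ζ u v) p := fun u v =>
    (hKd u v).comp p (pr.restrictScalars ℝ).contDiff.contDiffAt
  have pullH : ∀ {F : ℂ → ℂ}, ∀ {ζ : A}, DifferentiableAt ℝ F (pr ζ) →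
      dHol (fun x => F (pr x)) ζ a = a₀ * dHol F (pr ζ) 1 := by
    intro F ζ hF
    have := dHol_comp_affine pr 0 (F := F) (p := ζ) (by simpa using hF) a
    simp only [add_zero] at this
    rw [this, ← smul_eq_mul, ← dHol_smul_dir, smul_eq_mul, mul_one]
  have pullA : ∀ {F : ℂ → ℂ}, ∀ {ζ : A}, DifferentiableAt ℝ F (pr ζ) →
      dAnti (fun x => F (pr x)) ζ a = conj a₀ * dAnti F (pr ζ) 1 := by
    intro F ζ hF
    have := dAnti_comp_affine pr 0 (F := F) (p := ζ) (by simpa using hF) a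
    simp only [add_zero] at this
    rw [this, ← smul_eq_mul, ← dAnti_smul_dir, smul_eq_mul, mul_one]
  -- the Riesz vectors
  obtain ⟨u, hu, hΦu⟩ := exists_contDiffAt_riesz hMm hMd (Eventually.of_forall hΦ)
    fun v => (hΦd v).restrict_scalars ℝ
  have hΦev := eventually_contDiffAt_linear hΦ hΦd
  have h1 : ∀ᶠ ζ in 𝓝 p, ∀ v, dAnti (fun η => M η v (u η)) ζ a = 0 := by
    filter_upwards [hΦu.eventually_nhds, hΦev] with ζ hζ hζd v
    rw [dAnti_congr (g := fun η => Φ η v) (hζ.mono fun η h => h v)]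
    exact dAnti_of_complex ((hζd v).differentiableAt (by simp)) a
  have h2 : ∀ v, dAnti (fun ζ => dHol (fun η => M η v (u η)) ζ a) p a = 0 := by
    intro v
    have e : (fun ζ => dHol (fun η => M η v (u η)) ζ a) =ᶠ[𝓝 p]
        fun ζ => fderiv ℂ (fun η => Φ η v) ζ a := by
      filter_upwards [hΦu.eventually_nhds, hΦev] with ζ hζ hζd
      rw [dHol_congr (g := fun η => Φ η v) (hζ.mono fun η h => h v)]
      exact dHol_of_complex ((hζd v).differentiableAt (by simp)) a
    rw [dAnti_congr e]
    refine dAnti_of_complex ?_ a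
    have : ContDiffAt ℂ 1 (fderiv ℂ fun η => Φ η v) p := (hΦd v).fderiv_right (by norm_num)
    exact (this.clm_apply contDiffAt_const).differentiableAt (by simp)
  obtain ⟨f1, f2, f3⟩ := mixed_hessian_norm hMm hMd hu h1 h2
  have hqe : (fun ζ => (q ζ : ℂ)) =ᶠ[𝓝 p] fun ζ => M ζ (u ζ) (u ζ) := by
    filter_upwards [hΦu, hq] with ζ h1 h2 using (h2 _ h1).symm
  have hqd : ContDiffAt ℝ 2 q p := by
    have : ContDiffAt ℝ 2 (fun ζ => (q ζ : ℂ)) p :=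
      (ContDiffAt.sesq (hMm.mono fun _ h => h.isSesq) hMd hu hu).congr_of_eventuallyEq hqe
    exact (Complex.reCLM.contDiff.contDiffAt.comp p this : _)
  have hKm : IsMetric (K z₀) := hK.self_of_nhds
  have hKp : IsSesq (K z₀) := hKm.isSesq
  have hMp : IsSesq (M p) := hKp
  have hΦup := hΦu.self_of_nhds
  -- `w₁ = ∂̄_a u` represents the covariant derivative of `Φ`, corrected by `∇B`. `w₂` is minus the
  -- `(1,0)` covariant derivative of `u` for the Chern connection of `G`; it would vanish if `B`
  -- did.
  refine ⟨u p, dAnti u p a, -(dHol u p a + a₀ • θ (u p)), hΦup, ?_, ?_, hqd, ?_⟩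
  · intro v
    have e := dHol_sesq (x := fun _ => v) (hMm.mono fun _ h => h.isSesq)
      (fun u v => (hMd u v).differentiableAt (by simp)) (differentiableAt_const v)
      (hu.differentiableAt (by simp)) a
    rw [dHol_congr (g := fun η => Φ η v) (hΦu.mono fun η h => h v), dHol_const, hMp.zero_left,
      pullH (F := fun z => K z v (u p)) ((hKd _ _).differentiableAt (by simp)), dK] at e
    have e' : K z₀ (θ v) (u p) = Φ p (θ v) := hΦup _
    rw [e'] at e
    show K z₀ v _ = _
    linear_combination -e
  · intro v
    show K z₀ v _ = _
    have e := f1 v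
    rw [pullA (F := fun z => K z v (u p)) ((hKd _ _).differentiableAt (by simp)),
      dKbar.self_of_nhds] at e
    rw [hKp.neg_right, hKp.add_right, hKp.smul_right]
    linear_combination -e
  · rw [dHol_dAnti_log hqd hq0]
    have e1 : dAnti (fun x => (q x : ℂ)) p a = K z₀ (dAnti u p a) (u p) := by
      rw [dAnti_congr hqe, f2]
    have e2 : dHol (fun y => dAnti (fun x => (q x : ℂ)) y a) p a
        = dHol (fun y => dAnti (fun x => M x (u x) (u x)) y a) p a := by
      refine dHol_congr ?_ a
      filter_upwards [hqe.eventually_nhds] with y hy using dAnti_congr hy a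
    have e3 : dHol (fun y => dAnti (fun x => M x (u p) (u p)) y a) p a
        = a₀ * conj a₀ * dHol (fun z => dAnti (fun y => K y (u p) (u p)) z 1) z₀ 1 := by
      have : (fun y => dAnti (fun x => M x (u p) (u p)) y a)
          =ᶠ[𝓝 p] fun y => conj a₀ * dAnti (fun y => K y (u p) (u p)) (pr y) 1 := by
        filter_upwards [hpr.eventually hKev] with y hy
        exact pullA (F := fun z => K z (u p) (u p)) ((hy _ _).differentiableAt (by simp))
      have hdd : DifferentiableAt ℝ (fun z => dAnti (fun y => K y (u p) (u p)) z 1) z₀ :=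
        ((hKd _ _).dAnti (n := 1) (by norm_num) 1).differentiableAt (by simp)
      rw [dHol_congr this, dHol_const_mul, pullH hdd]
      · ring
      · exact hdd.comp p (pr.restrictScalars ℝ).differentiableAt
    have hdθ : DifferentiableAt ℝ (fun z => chernForm G z (u p)) z₀ := hθd _
    -- With `u` frozen, the base derivative `∂̄K` is `K(·, θ ·)` plus `∇_z̄ B`. Differentiating
    -- again brings in `∂̄θ = -κ`, the origin of the curvature term.
    have e4 : dHol (fun z => dAnti (fun y => K y (u p) (u p)) z 1) z₀ 1
        = K z₀ (θ (u p)) (θ (u p)) + covHol G B z₀ (u p) (θ (u p)) - κ * q p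
          + covHol G (covAnti G B) z₀ (u p) (u p) + covAnti G B z₀ (θ (u p)) (u p) := by
      have hc : (fun z => dAnti (fun y => K y (u p) (u p)) z 1) =ᶠ[𝓝 z₀]
          fun z => K z (u p) (chernForm G z (u p)) + covAnti G B z (u p) (u p) :=
        dKbar.mono fun z hz => hz _ _
      have hd1 := DifferentiableAt.sesq (x := fun _ => u p) hKS
        (fun u v => (hKd u v).differentiableAt (by simp)) (differentiableAt_const _) hdθ
      have hd2 : DifferentiableAt ℝ (fun z => covAnti G B z (u p) (u p)) z₀ := by
        unfold covAnti
        exact (((hBd _ _).dAnti (n := 1) (by norm_num) 1).differentiableAt (by simp)).sub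
          (DifferentiableAt.sesq (x := fun _ => u p) hBS
            (fun u v => (hBd u v).differentiableAt (by simp)) (differentiableAt_const _) hdθ)
      rw [dHol_congr hc, dHol_add hd1 hd2, dHol_sesq (x := fun _ => u p) hKS
        (fun u v => (hKd u v).differentiableAt (by simp)) (differentiableAt_const _) hdθ, dHol_const,
        hKp.zero_left, dK, hκ, hKp.smul_right]
      have : covHol G (covAnti G B) z₀ (u p) (u p)
        = dHol (fun y => covAnti G B y (u p) (u p)) z₀ 1 - covAnti G B z₀ (θ (u p)) (u p) := rfl
      rw [this]
      have hqp : K z₀ (u p) (u p) = q p := hqe.self_of_nhds.symm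
      rw [hqp]
      simp only [map_neg, Complex.conj_ofReal]
      ring
    have e5 : conj (covAnti G B z₀ (θ (u p)) (u p)) = covHol G B z₀ (u p) (θ (u p)) := by
      rw [covAnti, covHol, map_sub, hBC.self_of_nhds,
        ← dHol_conj ((hBd _ _).differentiableAt (by simp))]
      congr 1
      exact dHol_congr (hBC.mono fun y hy => hy _ _) _
    -- Completing the square: the terms containing `θ` are exactly absorbed into `K(w₂, w₂)`, which
    -- leaves an expression in covariant derivatives only.
    have e6 : K z₀ (dHol u p a + a₀ • θ (u p)) (dHol u p a + a₀ • θ (u p))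
        = K z₀ (dHol u p a) (dHol u p a)
        - a₀ * conj a₀ * (K z₀ (θ (u p)) (θ (u p)) + covHol G B z₀ (u p) (θ (u p))
          + covAnti G B z₀ (θ (u p)) (u p)) := by
      have g1 : ∀ v, K z₀ v (dHol u p a)
          = -(conj a₀ * (K z₀ v (θ (u p)) + covAnti G B z₀ v (u p))) := by
        intro v
        have e := f1 v
        rw [pullA (F := fun z => K z v (u p)) ((hKd _ _).differentiableAt (by simp)),
          dKbar.self_of_nhds] at e
        exact e
      have g2 : K z₀ (dHol u p a) (θ (u p))
          = -(a₀ * (K z₀ (θ (u p)) (θ (u p)) + covHol G B z₀ (u p) (θ (u p)))) := by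
        rw [← hKm.conj_symm, g1, map_neg, map_mul, map_add, e5, Complex.conj_conj,
          hKm.conj_symm]
      rw [hKp.add_left, hKp.add_right, hKp.add_right, hKp.smul_right, hKp.smul_left, hKp.smul_left,
        hKp.smul_right, g2, g1 (θ (u p))]
      ring
    have hn : (‖a₀‖ ^ 2 : ℂ) = a₀ * conj a₀ := (Complex.mul_conj' _).symm
    have hcj : ‖K z₀ (dAnti u p a) (u p)‖ = ‖K z₀ (u p) (dAnti u p a)‖ := by
      rw [← hKm.conj_symm, Complex.norm_conj]
    have hq0' : (q p : ℂ) ≠ 0 := by exact_mod_cast hq0.ne'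
    show _ = κ * ‖a₀‖ ^ 2 + (K z₀ (dAnti u p a) (dAnti u p a)
      + K z₀ (-(dHol u p a + a₀ • θ (u p))) (-(dHol u p a + a₀ • θ (u p)))
      - ‖a₀‖ ^ 2 * covHol G (covAnti G B) z₀ (u p) (u p)) / q p
      - ‖K z₀ (u p) (dAnti u p a)‖ ^ 2 / (q p : ℂ) ^ 2
    rw [e1, e2, f3, e3, e4, hcj, hKp.neg_left, hKp.neg_right, neg_neg, e6, hn]
    field_simp
    ring

end ChernFormula

end

/-! ### Perturbation of the Riesz vectors -/

noncomputable section

section Perturbation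

variable {E : Type*} [NormedAddCommGroup E] [InnerProductSpace ℂ E]

local notation "⟪" x ", " y "⟫" => inner ℂ x y

theorem norm_le_of_inner_le {x : E} {M : ℝ} (hM : 0 ≤ M) (h : ‖(⟪x, x⟫ : ℂ)‖ ≤ M * ‖x‖) :
    ‖x‖ ≤ M := by
  rw [inner_self_eq_norm_sq_to_K] at h
  norm_cast at h
  rw [abs_of_nonneg (by positivity)] at h
  by_contra hc
  push Not at hc
  nlinarith [norm_nonneg x]

section

variable {K B : SesqForm E} {e s : ℝ} {u₀ u : E}
  (hK : ∀ x y, K x y = ⟪y, x⟫ + B x y) (he : 0 ≤ e) (he2 : e ≤ 1 / 2)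
  (hB : ∀ x y, ‖B x y‖ ≤ e * ‖x‖ * ‖y‖)
include hK he2 hB

/-- For `e ≤ 1/2` the perturbation removes at most half of the squared norm. -/
theorem half_norm_sq_le (x : E) : ‖x‖ ^ 2 ≤ 2 * ‖K x x‖ := by
  have h1 : (⟪x, x⟫ : ℂ) = K x x - B x x := by rw [hK]; ring
  have h2 := congrArg norm h1
  rw [inner_self_eq_norm_sq_to_K] at h2
  have h3 : ‖((‖x‖ : ℝ) : ℂ) ^ 2‖ = ‖x‖ ^ 2 := by simp
  have h4 := norm_sub_le (K x x) (B x x)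
  have h5 := hB x x
  have : ‖x‖ ^ 2 = ‖K x x - B x x‖ := by rw [← h2]; exact h3.symm
  nlinarith [mul_nonneg (norm_nonneg x) (norm_nonneg x)]

variable (hu : ∀ v, K v u = ⟪u₀, v⟫)
include he hu

theorem riesz_norm_le : ‖u‖ ≤ 2 * ‖u₀‖ := by
  have h1 := half_norm_sq_le hK he2 hB u
  rw [hu] at h1
  have h2 := norm_inner_le_norm (𝕜 := ℂ) u₀ u
  by_contra hc
  push Not at hc
  nlinarith [norm_nonneg u₀, norm_nonneg u]

/-- Subtracting the two Riesz equations gives `⟪u - u₀, v⟫ = -B(v, u)`; take `v = u - u₀`. -/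
theorem riesz_sub_le : ‖u - u₀‖ ≤ 2 * e * ‖u₀‖ := by
  have h1 : (⟪u - u₀, u - u₀⟫ : ℂ) = -B (u - u₀) u := by
    rw [inner_sub_left, ← hu, hK]; ring
  have h2 : ‖u - u₀‖ ≤ e * ‖u‖ := by
    refine norm_le_of_inner_le (by positivity) ?_
    rw [h1, norm_neg]
    calc _ ≤ _ := hB _ _
      _ = _ := by ring
  have := riesz_norm_le hK he he2 hB hu
  nlinarith

theorem riesz_sq_sub_le : ‖K u u - ‖u₀‖ ^ 2‖ ≤ 2 * e * ‖u₀‖ ^ 2 := by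
  have h1 : K u u - ‖u₀‖ ^ 2 = ⟪u₀, u - u₀⟫ := by
    rw [hu, inner_sub_right, inner_self_eq_norm_sq_to_K]; rfl
  rw [h1]
  have := riesz_sub_le hK he he2 hB hu
  calc _ ≤ ‖u₀‖ * ‖u - u₀‖ := norm_inner_le_norm _ _
    _ ≤ ‖u₀‖ * (2 * e * ‖u₀‖) := by gcongr
    _ = _ := by ring

/-- Here `‖u₀‖ ≤ (1 + e) ‖u‖ ≤ 3/2 ‖u‖` and `‖u‖² ≤ 2 |K(u, u)|`, which gives `9/2`, rounded up to
`5`. -/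
theorem riesz_sq_ge : ‖u₀‖ ^ 2 ≤ 5 * ‖K u u‖ := by
  have h1 := half_norm_sq_le hK he2 hB u
  have h2 : ‖u - u₀‖ ≤ e * ‖u‖ := by
    refine norm_le_of_inner_le (by positivity) ?_
    have h1 : (⟪u - u₀, u - u₀⟫ : ℂ) = -B (u - u₀) u := by
      rw [inner_sub_left, ← hu, hK]; ring
    rw [h1, norm_neg]
    calc _ ≤ _ := hB _ _
      _ = _ := by ring
  have h3 : ‖u₀‖ ≤ ‖u‖ + ‖u - u₀‖ := by
    have := norm_sub_le u (u - u₀)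
    simpa using this
  have h4 : ‖u₀‖ ≤ 3 / 2 * ‖u‖ := by nlinarith [norm_nonneg u]
  have h5 : ‖u₀‖ ^ 2 ≤ (3 / 2 * ‖u‖) ^ 2 := by gcongr
  nlinarith

end

set_option maxHeartbeats 1600000 in
/-- The change of the curvature under a perturbation `B` of the inner product. -/
theorem curvature_perturbation {K B : SesqForm E} {e σ Q : ℝ} {u₀ u w₀ w₁ w₂ : E} {β₁ β₂ : E → ℂ}
    {β : ℂ} (hK : ∀ x y, K x y = ⟪y, x⟫ + B x y) (hKc : ∀ x y, conj (K x y) = K y x)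
    (he : 0 ≤ e) (he2 : e ≤ 1 / 2) (hσ : 0 ≤ σ)
    (hB : ∀ x y, ‖B x y‖ ≤ e * ‖x‖ * ‖y‖) (hu : ∀ v, K v u = ⟪u₀, v⟫) (hu₀ : u₀ ≠ 0)
    (hQ : K u u = Q)
    (hw₁ : ∀ v, K v w₁ = ⟪w₀, v⟫ - β₁ v) (hβ₁ : ∀ v, ‖β₁ v‖ ≤ e * σ * ‖v‖ * ‖u‖)
    (hw₂ : ∀ v, K v w₂ = β₂ v) (hβ₂ : ∀ v, ‖β₂ v‖ ≤ e * σ * ‖v‖ * ‖u‖)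
    (hβ : ‖β‖ ≤ e * σ ^ 2 * ‖u‖ ^ 2) (hQ0 : 0 < Q) :
    let q₀ : ℝ := ‖w₀‖ ^ 2 / ‖u₀‖ ^ 2 - ‖(⟪u₀, w₀⟫ : ℂ)‖ ^ 2 / (‖u₀‖ ^ 2) ^ 2
    0 ≤ q₀ ∧ ‖(K w₁ w₁ + K w₂ w₂ - β) / Q - ‖K u w₁‖ ^ 2 / (Q : ℂ) ^ 2 - q₀‖
      ≤ 480 * e * (q₀ + σ ^ 2) := by
  intro q₀
  set s := ‖u₀‖ with hs
  have hs0 : 0 < s := norm_pos_iff.2 hu₀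
  have hun : ‖u‖ ≤ 2 * s := riesz_norm_le hK he he2 hB hu
  have hus : ‖u - u₀‖ ≤ 2 * e * s := riesz_sub_le hK he he2 hB hu
  have hQs : ‖((Q - s ^ 2 : ℝ) : ℂ)‖ ≤ 2 * e * s ^ 2 := by
    have := riesz_sq_sub_le hK he he2 hB hu
    rw [hQ] at this
    push_cast
    exact this
  rw [Complex.norm_real, Real.norm_eq_abs] at hQs
  have hQ5 : s ^ 2 ≤ 5 * Q := by
    have := riesz_sq_ge hK he he2 hB hu
    rwa [hQ, Complex.norm_real, Real.norm_of_nonneg hQ0.le] at this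
  -- remove the component along the Riesz vector
  have hs0' : ((s : ℝ) : ℂ) ≠ 0 := by exact_mod_cast hs0.ne'
  -- The quantity to be compared ignores multiples of the Riesz vectors. With this `t` the vector
  -- `w` is orthogonal to `u₀`, so that `q₀` is simply `‖w‖² / s²`; the same multiple of `u` is
  -- removed from `w₁`.
  set t : ℂ := ⟪u₀, w₀⟫ / (s : ℂ) ^ 2 with ht
  set w := w₀ - t • u₀ with hw
  set x := w₁ - t • u with hx
  have hus2 : (⟪u₀, u₀⟫ : ℂ) = (s : ℂ) ^ 2 := inner_self_eq_norm_sq_to_K u₀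
  have hort : (⟪u₀, w⟫ : ℂ) = 0 := by
    rw [hw, inner_sub_right, inner_smul_right, hus2, ht]
    field_simp
    simp
  have hort' : (⟪w, u₀⟫ : ℂ) = 0 := by rw [← inner_conj_symm, hort, map_zero]
  have hq₀ : q₀ = ‖w‖ ^ 2 / s ^ 2 := by
    have e1 : ‖w₀‖ ^ 2 = ‖w‖ ^ 2 + ‖t • u₀‖ ^ 2 := by
      have : w₀ = w + t • u₀ := by rw [hw]; abel
      have h2 := norm_add_sq_eq_norm_sq_add_norm_sq_of_inner_eq_zero (𝕜 := ℂ) w (t • u₀)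
        (by rw [inner_smul_right, hort', mul_zero])
      rw [← this] at h2
      nlinarith
    have e2 : ‖t • u₀‖ ^ 2 = ‖(⟪u₀, w₀⟫ : ℂ)‖ ^ 2 / s ^ 2 := by
      rw [norm_smul, ht, norm_div, norm_pow, Complex.norm_real, Real.norm_of_nonneg hs0.le, ← hs]
      field_simp
    show ‖w₀‖ ^ 2 / s ^ 2 - _ / (s ^ 2) ^ 2 = _
    rw [e1, e2]
    field_simp
    ring
  set A := ‖w‖ with hA
  have hA0 : 0 ≤ A := norm_nonneg w
  have hKx : ∀ v, K v x = ⟪w, v⟫ - β₁ v := by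
    intro v
    rw [hx, hw, map_sub, LinearMap.map_smulₛₗ, hw₁, hu, inner_sub_left, inner_smul_left, smul_eq_mul]
    ring
  -- The Riesz equation for `x` tested on `x - w`: the form representing the difference consists of
  -- `β₁` and `B`, both of size `e`.
  have hD : ‖x - w‖ ≤ 2 * e * σ * s + e * ‖x‖ := by
    refine norm_le_of_inner_le (by positivity) ?_
    have : (⟪x - w, x - w⟫ : ℂ) = -(β₁ (x - w) + B (x - w) x) := by
      have h1 := hKx (x - w)
      rw [hK] at h1
      rw [inner_sub_left]
      linear_combination h1
    rw [this, norm_neg]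
    calc ‖β₁ (x - w) + B (x - w) x‖ ≤ e * σ * ‖x - w‖ * ‖u‖ + e * ‖x - w‖ * ‖x‖ :=
          (norm_add_le _ _).trans (add_le_add (hβ₁ _) (hB _ _))
      _ ≤ e * σ * ‖x - w‖ * (2 * s) + e * ‖x - w‖ * ‖x‖ := by gcongr
      _ = _ := by ring
  have hxn : ‖x‖ ≤ 2 * A + 2 * σ * s := by
    have h1 : ‖x‖ ≤ ‖w‖ + ‖x - w‖ := by
      have := norm_add_le w (x - w); simpa using this
    nlinarith [norm_nonneg x, mul_nonneg hσ hs0.le]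
  have hD' : ‖x - w‖ ≤ e * (2 * A + 4 * σ * s) := by nlinarith
  have hb1 : ∀ v, ‖β₁ v‖ ≤ 2 * e * σ * s * ‖v‖ := by
    intro v
    calc _ ≤ _ := hβ₁ v
      _ ≤ e * σ * ‖v‖ * (2 * s) := by gcongr
      _ = _ := by ring
  have hσs : 0 ≤ σ * s := mul_nonneg hσ hs0.le
  have hxx : ‖K x x - (A : ℂ) ^ 2‖ ≤ e * (6 * A ^ 2 + 8 * (σ * s) ^ 2) := by
    have h1 : K x x - (A : ℂ) ^ 2 = ⟪w, x - w⟫ - β₁ x := by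
      have : (⟪w, w⟫ : ℂ) = (A : ℂ) ^ 2 := inner_self_eq_norm_sq_to_K w
      rw [hKx, inner_sub_right w x w, this]; ring
    rw [h1]
    calc ‖(⟪w, x - w⟫ : ℂ) - β₁ x‖ ≤ A * ‖x - w‖ + 2 * e * σ * s * ‖x‖ :=
          (norm_sub_le _ _).trans (add_le_add (norm_inner_le_norm _ _) (hb1 x))
      _ ≤ A * (e * (2 * A + 4 * σ * s)) + 2 * e * σ * s * (2 * A + 2 * σ * s) := by gcongr
      _ = e * (6 * A ^ 2 + 8 * (σ * s) ^ 2 - 4 * (A - σ * s) ^ 2) := by ring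
      _ ≤ _ := by gcongr; nlinarith [sq_nonneg (A - σ * s)]
  -- Orthogonality of `w` and `u₀` leaves only `u - u₀` and `β₁`, so the cross term is of order `e`.
  -- In its square one factor `e` is then spent as `1/2`.
  have hux : ‖K u x‖ ≤ e * s * (2 * A + 4 * (σ * s)) := by
    have h1 : K u x = ⟪w, u - u₀⟫ - β₁ u := by rw [hKx, inner_sub_right, hort']; ring
    rw [h1]
    calc ‖(⟪w, u - u₀⟫ : ℂ) - β₁ u‖ ≤ A * ‖u - u₀‖ + 2 * e * σ * s * ‖u‖ :=
          (norm_sub_le _ _).trans (add_le_add (norm_inner_le_norm _ _) (hb1 u))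
      _ ≤ A * (2 * e * s) + 2 * e * σ * s * (2 * s) := by gcongr
      _ = _ := by ring
  have hux2 : ‖K u x‖ ^ 2 ≤ e * s ^ 2 * (4 * A ^ 2 + 16 * (σ * s) ^ 2) := by
    have h1 : ‖K u x‖ ^ 2 ≤ (e * s * (2 * A + 4 * (σ * s))) ^ 2 := by gcongr
    have h2 : (2 * A + 4 * (σ * s)) ^ 2 ≤ 8 * A ^ 2 + 32 * (σ * s) ^ 2 := by
      nlinarith [sq_nonneg (A - 2 * (σ * s))]
    calc _ ≤ _ := h1
      _ = e * s ^ 2 * (e * (2 * A + 4 * (σ * s)) ^ 2) := by ring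
      _ ≤ e * s ^ 2 * (1 / 2 * (8 * A ^ 2 + 32 * (σ * s) ^ 2)) := by gcongr
      _ = _ := by ring
  have hb2 : ‖K w₂ w₂‖ ≤ 2 * e * σ * s * ‖w₂‖ := by
    rw [hw₂]
    calc _ ≤ _ := hβ₂ w₂
      _ ≤ e * σ * ‖w₂‖ * (2 * s) := by gcongr
      _ = _ := by ring
  have hw2n : ‖w₂‖ ≤ 2 * (σ * s) := by
    have h1 := half_norm_sq_le hK he2 hB w₂
    by_contra hc
    push Not at hc
    have h2 : ‖w₂‖ ^ 2 ≤ 2 * (σ * s) * ‖w₂‖ := by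
      calc _ ≤ _ := h1
        _ ≤ 2 * (2 * e * σ * s * ‖w₂‖) := by gcongr
        _ = 4 * e * ((σ * s) * ‖w₂‖) := by ring
        _ ≤ 2 * ((σ * s) * ‖w₂‖) := by gcongr; linarith
        _ = _ := by ring
    nlinarith
  have hww : ‖K w₂ w₂‖ ≤ e * (4 * (σ * s) ^ 2) := by
    calc _ ≤ _ := hb2
      _ ≤ 2 * e * σ * s * (2 * (σ * s)) := by gcongr
      _ = _ := by ring
  have hβ' : ‖β‖ ≤ e * (4 * (σ * s) ^ 2) := by
    calc _ ≤ _ := hβ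
      _ ≤ e * σ ^ 2 * (2 * s) ^ 2 := by gcongr
      _ = _ := by ring
  have hQ0' : (Q : ℂ) ≠ 0 := by exact_mod_cast hQ0.ne'
  -- The Gram determinant of `u` and `w₁` for `K` does not change when a multiple of `u` is added to
  -- `w₁`.
  have hid : K w₁ w₁ * Q - ‖K u w₁‖ ^ 2 = K x x * Q - ‖K u x‖ ^ 2 := by
    have h1 : w₁ = x + t • u := by rw [hx]; abel
    have n1 : ∀ z : ℂ, (‖z‖ : ℂ) ^ 2 = z * conj z := fun z => (Complex.mul_conj' z).symm
    have h2 : K w₁ w₁ = K x x + conj t * K x u + t * K u x + t * conj t * Q := by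
      rw [h1, map_add K, LinearMap.add_apply, map_add, map_add, LinearMap.map_smul,
        LinearMap.smul_apply, LinearMap.smul_apply, LinearMap.map_smulₛₗ, LinearMap.map_smulₛₗ, hQ]
      simp only [smul_eq_mul]
      ring
    have h3 : K u w₁ = K u x + conj t * Q := by
      rw [h1, map_add, LinearMap.map_smulₛₗ, hQ, smul_eq_mul]
    rw [h2, n1, n1, h3, map_add, map_mul, hKc, Complex.conj_conj, Complex.conj_ofReal]
    ring
  have hfin : (K w₁ w₁ + K w₂ w₂ - β) / Q - ‖K u w₁‖ ^ 2 / (Q : ℂ) ^ 2 - q₀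
      = ((K x x - (A : ℂ) ^ 2) + K w₂ w₂ - β) / Q - ((‖K u x‖ ^ 2 / Q ^ 2 : ℝ) : ℂ)
        + ((A ^ 2 * (s ^ 2 - Q) / (Q * s ^ 2) : ℝ) : ℂ) := by
    have h1 : (K w₁ w₁ + K w₂ w₂ - β) / Q - ‖K u w₁‖ ^ 2 / (Q : ℂ) ^ 2
        = (K w₁ w₁ * Q - ‖K u w₁‖ ^ 2) / (Q : ℂ) ^ 2 + (K w₂ w₂ - β) / Q := by
      field_simp
      ring
    rw [h1, hid, hq₀]
    push_cast
    field_simp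
    ring
  refine ⟨by rw [hq₀]; positivity, ?_⟩
  rw [hfin]
  have b1 : ‖((K x x - (A : ℂ) ^ 2) + K w₂ w₂ - β) / Q‖
      ≤ e * (6 * A ^ 2 + 16 * (σ * s) ^ 2) / Q := by
    rw [norm_div, Complex.norm_real, Real.norm_of_nonneg hQ0.le]
    gcongr
    calc _ ≤ _ := norm_sub_le _ _
      _ ≤ _ := add_le_add_left (norm_add_le _ _) _
      _ ≤ e * (6 * A ^ 2 + 8 * (σ * s) ^ 2) + e * (4 * (σ * s) ^ 2) + e * (4 * (σ * s) ^ 2) := by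
        gcongr
      _ = _ := by ring
  have hQi : 1 / Q ≤ 5 / s ^ 2 := by
    rw [div_le_div_iff₀ hQ0 (by positivity)]; linarith
  have b1' : e * (6 * A ^ 2 + 16 * (σ * s) ^ 2) / Q ≤ e * (30 * q₀ + 80 * σ ^ 2) := by
    calc _ = e * (6 * A ^ 2 + 16 * (σ * s) ^ 2) * (1 / Q) := by ring
      _ ≤ e * (6 * A ^ 2 + 16 * (σ * s) ^ 2) * (5 / s ^ 2) := by gcongr
      _ = _ := by rw [hq₀]; field_simp; ring
  have b2 : ‖((‖K u x‖ ^ 2 / Q ^ 2 : ℝ) : ℂ)‖ ≤ e * (100 * q₀ + 400 * σ ^ 2) := by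
    rw [Complex.norm_real, Real.norm_of_nonneg (by positivity)]
    calc _ = ‖K u x‖ ^ 2 * (1 / Q) ^ 2 := by field_simp
      _ ≤ e * s ^ 2 * (4 * A ^ 2 + 16 * (σ * s) ^ 2) * (5 / s ^ 2) ^ 2 := by gcongr
      _ = _ := by rw [hq₀]; field_simp; ring
  have b3 : ‖((A ^ 2 * (s ^ 2 - Q) / (Q * s ^ 2) : ℝ) : ℂ)‖ ≤ e * (10 * q₀) := by
    rw [Complex.norm_real, Real.norm_eq_abs, abs_div, abs_mul, abs_of_nonneg (sq_nonneg A),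
      abs_sub_comm, abs_of_pos (by positivity : 0 < Q * s ^ 2)]
    calc _ = A ^ 2 * |Q - s ^ 2| / s ^ 2 * (1 / Q) := by field_simp
      _ ≤ A ^ 2 * (2 * e * s ^ 2) / s ^ 2 * (5 / s ^ 2) := by gcongr
      _ = _ := by rw [hq₀]; field_simp; ring
  have hq0 : 0 ≤ q₀ := by rw [hq₀]; positivity
  calc _ ≤ _ := norm_add_le _ _
    _ ≤ _ := add_le_add_left (norm_sub_le _ _) _
    _ ≤ e * (30 * q₀ + 80 * σ ^ 2) + e * (100 * q₀ + 400 * σ ^ 2) + e * (10 * q₀) :=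
      add_le_add (add_le_add (b1.trans b1') b2) b3
    -- The coefficients add up to `140` for `q₀` and `480` for `σ²`; the larger one is kept.
    _ ≤ _ := by nlinarith [mul_nonneg he hq0, mul_nonneg he (sq_nonneg σ)]

end Perturbation

end

/-! ### The Chern connection of a symmetric power -/

noncomputable section

open Filter Topology

section ChernSym

/-- `chernForm` is defined through an arbitrary inverse and carries no regularity of its own. Riesz
vectors of the derivatives on a basis give a linear `C¹` family solving the same equation, and
nondegeneracy identifies the two. -/
theorem exists_chernForm {S : Type*} [NormedAddCommGroup S] [NormedSpace ℂ S]
    [FiniteDimensional ℂ S] {G : ℂ → S → S → ℂ} {p : ℂ}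
    (hG : ∀ᶠ z in 𝓝 p, IsMetric (G z)) (hd : ∀ u v, ContDiffAt ℝ 2 (fun z => G z u v) p) :
    ∃ T : ℂ → S →ₗ[ℂ] S, (∀ u, ContDiffAt ℝ 1 (fun z => T z u) p) ∧
      ∀ᶠ z in 𝓝 p, ∀ u, chernForm G z u = T z u ∧
        ∀ v, G z (T z u) v = dHol (fun y => G y u v) z 1 := by
  let b := Module.finBasis ℂ S
  have hS : ∀ᶠ z in 𝓝 p, IsSesq (G z) := hG.mono fun _ h => h.isSesq
  have hev := eventually_contDiffAt_sesq hS hd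
  have hDS : ∀ᶠ z in 𝓝 p, IsSesq fun u v => dHol (fun y => G y u v) z 1 := by
    filter_upwards [hS.eventually_nhds, hev] with z h1 h2
    exact IsSesq.dHol_family h1 (fun u v => (h2 u v).differentiableAt (by simp)) 1
  have hw : ∀ i, ∃ w : ℂ → S, ContDiffAt ℝ 1 w p ∧ ∀ᶠ z in 𝓝 p, ∀ v,
      G z v (w z) = conj (dHol (fun y => G y (b i) v) z 1) := by
    intro i
    refine exists_contDiffAt_riesz hG (fun u v => (hd u v).of_le (by norm_num)) ?_ ?_
    · filter_upwards [hDS] with z hz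
      obtain ⟨F, hF⟩ := hz
      refine ⟨{ toFun := fun v => conj (F (b i) v), map_add' := ?_, map_smul' := ?_ }, fun v => ?_⟩
      · intro x y; simp
      · intro c x; simp
      · simp [hF]
    · exact fun v => ((hd _ _).dHol (by norm_num) 1).conj'
  choose w hwd hw using hw
  refine ⟨fun z => b.constr ℂ fun i => w i z, fun u => ?_, ?_⟩
  · simp only [Module.Basis.constr_apply_fintype]
    exact ContDiffAt.sum fun i _ => contDiffAt_const.smul (hwd i)
  · filter_upwards [eventually_all.2 hw, hG, hDS] with z hz hGz hDz u
    have key : ∀ v, G z (b.constr ℂ (fun i => w i z) u) v = dHol (fun y => G y u v) z 1 := by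
      intro v
      obtain ⟨h, hh⟩ := hGz
      obtain ⟨F, hF⟩ := hDz
      replace hF : ∀ u v, dHol (fun y => G y u v) z 1 = F u v := hF
      rw [hF, hh]
      have : h.form ∘ₗ b.constr ℂ (fun i => w i z) = F := by
        refine b.ext fun i => LinearMap.ext fun v => ?_
        rw [LinearMap.comp_apply, Module.Basis.constr_basis, ← hF, ← h.conj_symm, ← hh, hz,
          Complex.conj_conj]
      rw [← this]; rfl
    exact ⟨chernForm_eq hGz key, key⟩

/-! ### Derivations of the symmetric power and the derivative of `Sym^d` of a metric. -/

section Deriv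

variable {V : Type*} [AddCommGroup V] [Module ℂ V]

/-- The derivation of `Sym^d V` induced by an endomorphism of `V`:
`v₁ ⋯ v_d ↦ ∑ v₁ ⋯ T v_i ⋯ v_d`. -/
def symDeriv (d : ℕ) (T : V →ₗ[ℂ] V) : Sym[ℂ]^d V →ₗ[ℂ] Sym[ℂ]^d V :=
  symLift d (∑ i, (SymmetricPower.tprod ℂ).compLinearMap
      fun j => if j = i then T else LinearMap.id)
    (fun σ v => by
      simp only [sum_apply, MultilinearMap.compLinearMap_apply]
      refine Fintype.sum_equiv σ _ _ fun i => ?_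
      have := SymmetricPower.tprod_equiv (R := ℂ) σ
        (fun j => (if j = σ i then T else LinearMap.id : V →ₗ[ℂ] V) (v j))
      simpa only [EmbeddingLike.apply_eq_iff_eq] using this)

theorem symDeriv_tprod (d : ℕ) (T : V →ₗ[ℂ] V) (v : Fin d → V) :
    symDeriv d T (SymmetricPower.tprod ℂ v)
      = ∑ i, SymmetricPower.tprod ℂ (Function.update v i (T (v i))) := by
  simp only [symDeriv, symLift_tprod, sum_apply, MultilinearMap.compLinearMap_apply]
  refine Finset.sum_congr rfl fun i _ => congrArg _ (funext fun j => ?_)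
  by_cases h : j = i
  · subst h; simp
  · simp [h]

variable {A : Type*} [NormedAddCommGroup A] [NormedSpace ℂ A] {p : A}

theorem symForm_contDiffAt (d : ℕ) {G : A → SesqForm V} {n : WithTop ℕ∞}
    (hG : ∀ u v, ContDiffAt ℝ n (fun z => G z u v) p) (s t : Sym[ℂ]^d V) :
    ContDiffAt ℝ n (fun z => symForm d (G z) s t) p := by
  induction s using sym_induction with
  | ht v =>
    induction t using sym_induction with
    | ht w =>
      simp only [symForm_tprod]
      exact contDiffAt_const.mul (ContDiffAt.sum fun σ _ => contDiffAt_prod fun i _ => hG _ _)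
    | h0 => simpa using contDiffAt_const
    | ha x y hx hy => simpa using hx.add hy
    | hs c x hx => simpa using contDiffAt_const.mul hx
  | h0 => simpa using contDiffAt_const
  | ha x y hx hy => simpa using hx.add hy
  | hs c x hx => simpa using contDiffAt_const.mul hx

/-- Leibniz in each product `∏ G(v_i, w_{σ i})` replaces one `v_i` by `T v_i`. Consequently the
Chern form of `Sym^d h` is the derivation induced by that of `h`. -/
theorem dHol_symForm (d : ℕ) {G : A → SesqForm V} (hG : ∀ u v, ContDiffAt ℝ 1 (fun z => G z u v) p)
    {T : V →ₗ[ℂ] V} {a : A} (hT : ∀ u v, dHol (fun y => G y u v) p a = G p (T u) v)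
    (s t : Sym[ℂ]^d V) :
    dHol (fun z => symForm d (G z) s t) p a = symForm d (G p) (symDeriv d T s) t := by
  have hdf : ∀ s t, DifferentiableAt ℝ (fun z => symForm d (G z) s t) p := fun s t =>
    (symForm_contDiffAt d hG s t).differentiableAt (by simp)
  have hd : ∀ u v, DifferentiableAt ℝ (fun z => G z u v) p := fun u v =>
    (hG u v).differentiableAt (by simp)
  induction s using sym_induction with
  | ht v =>
    induction t using sym_induction with
    | ht w =>
      have hp : ∀ σ : Equiv.Perm (Fin d),
          DifferentiableAt ℝ (fun z => ∏ i, G z (v i) (w (σ i))) p := fun σ =>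
        (contDiffAt_prod (n := 1) fun i _ => hG _ _).differentiableAt (by simp)
      simp only [symForm_tprod, symDeriv_tprod, map_sum, LinearMap.sum_apply]
      rw [dHol_const_mul _ (DifferentiableAt.fun_sum fun σ _ =>
hp σ), dHol_sum _ fun σ _ => hp σ,
        ← Finset.mul_sum, Finset.sum_comm]
      congr 1
      refine Finset.sum_congr rfl fun σ _ => ?_
      rw [dHol_prod _ fun i _ => hd _ _]
      refine Finset.sum_congr rfl fun i _ => ?_
      rw [hT, ← Finset.mul_prod_erase Finset.univ _ (Finset.mem_univ i)]
      simp only [Function.update_self]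
      congr 1
      refine Finset.prod_congr rfl fun j hj => ?_
      rw [Function.update_of_ne (Finset.ne_of_mem_erase hj)]
    | h0 => simp
    | ha x y hx hy => simp only [map_add]; rw [dHol_add (hdf _ _) (hdf _ _), hx, hy]
    | hs c x hx =>
      simp only [LinearMap.map_smulₛₗ, smul_eq_mul]
      rw [dHol_const_mul _ (hdf _ _), hx]
  | h0 => simp
  | ha x y hx hy =>
    simp only [map_add, LinearMap.add_apply]; rw [dHol_add (hdf _ _) (hdf _ _), hx, hy]
  | hs c x hx =>
    simp only [LinearMap.map_smul, LinearMap.smul_apply, smul_eq_mul]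
    rw [dHol_const_mul _ (hdf _ _), hx]

end Deriv

variable {V : Type*} [NormedAddCommGroup V] [NormedSpace ℂ V] [FiniteDimensional ℂ V]
  {A : Type*} [NormedAddCommGroup A] [NormedSpace ℂ A] {p : A}

/-- Each of the `d` factors contributes the same scalar `c`, so the curvature of the symmetric power
is `d` times that of the bundle. Testing against functionals `φ` avoids choosing a norm on `Sym^d
V`. -/
theorem symDeriv_family (d : ℕ) {T : A → V →ₗ[ℂ] V}
    (hT : ∀ u, DifferentiableAt ℝ (fun z => T z u) p) {a : A} {c : ℂ}
    (hc : ∀ u, dAnti (fun z => T z u) p a = c • u) (φ : Sym[ℂ]^d V →ₗ[ℂ] ℂ) (s : Sym[ℂ]^d V) :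
    DifferentiableAt ℝ (fun z => φ (symDeriv d (T z) s)) p ∧
      dAnti (fun z => φ (symDeriv d (T z) s)) p a = d * c * φ s := by
  induction s using sym_induction with
  | ht v =>
    let L : Fin d → V →L[ℂ] ℂ := fun i =>
      (φ ∘ₗ (SymmetricPower.tprod ℂ).toLinearMap v i).toContinuousLinearMap
    have hL : ∀ i w, L i w = φ (SymmetricPower.tprod ℂ (Function.update v i w)) := fun i w => rfl
    have hD : ∀ i, DifferentiableAt ℝ (fun z => L i (T z (v i))) p := fun i =>
      (((L i).restrictScalars ℝ).differentiableAt (x := T p (v i))).comp p (hT (v i))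
    simp only [symDeriv_tprod, map_sum, ← hL]
    refine ⟨DifferentiableAt.fun_sum fun i _ => hD i, ?_⟩
    rw [dAnti_sum _ fun i _ => hD i]
    have : ∀ i, dAnti (fun z => L i (T z (v i))) p a = c * φ (SymmetricPower.tprod ℂ v) := by
      intro i
      rw [dAnti_clm (L i) (hT _), hc, map_smul, hL, Function.update_eq_self, smul_eq_mul]
    simp only [this, Finset.sum_const, Finset.card_univ, Fintype.card_fin, nsmul_eq_mul]
    ring
  | h0 => simp
  | ha x y hx hy =>
    simp only [map_add]
    exact ⟨hx.1.add hy.1, by rw [dAnti_add hx.1 hy.1, hx.2, hy.2]; ring⟩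
  | hs b x hx =>
    simp only [map_smul, smul_eq_mul]
    exact ⟨hx.1.const_mul _, by rw [dAnti_const_mul _ hx.1, hx.2]; ring⟩

end ChernSym

section NormFree

variable {A S : Type*} [NormedAddCommGroup A] [NormedSpace ℂ A] [AddCommGroup S]
  [Module ℂ S] [FiniteDimensional ℂ S]

/-- `mixed_hessian_log` on a finite-dimensional space without a chosen norm. -/
theorem mixed_hessian_log_of_finiteDimensional {G B : ℂ → S → S → ℂ} {pr : A →L[ℂ] ℂ} {p a : A}
    {κ : ℝ} {Φ : A → S → ℂ} {q : A → ℝ}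
    (hG : ∀ᶠ z in 𝓝 (pr p), IsMetric (G z))
    (hK : ∀ᶠ z in 𝓝 (pr p), IsMetric fun u v => G z u v + B z u v)
    (hGd : ∀ u v, ContDiffAt ℝ 2 (fun z => G z u v) (pr p))
    (hBd : ∀ u v, ContDiffAt ℝ 2 (fun z => B z u v) (pr p))
    (hθd : ∀ (φ : S →ₗ[ℂ] ℂ) u, DifferentiableAt ℝ (fun z => φ (chernForm G z u)) (pr p))
    (hθ : ∀ᶠ z in 𝓝 (pr p), ∀ u v, G z (chernForm G z u) v = dHol (fun y => G y u v) z 1)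
    (hκ : ∀ (φ : S →ₗ[ℂ] ℂ) u,
      dAnti (fun z => φ (chernForm G z u)) (pr p) 1 = -(κ : ℂ) * φ u)
    (hΦ : ∀ ζ, ∃ φ : S →ₗ[ℂ] ℂ, ∀ v, Φ ζ v = φ v)
    (hΦd : ∀ v, ContDiffAt ℂ 2 (fun ζ => Φ ζ v) p)
    (hq : ∀ᶠ ζ in 𝓝 p, ∀ u, (∀ v, G (pr ζ) v u + B (pr ζ) v u = Φ ζ v) →
      (G (pr ζ) u u + B (pr ζ) u u) = q ζ)
    (hq0 : 0 < q p) :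
    ∃ u w₁ w₂ : S, (∀ v, G (pr p) v u + B (pr p) v u = Φ p v) ∧
      (∀ v, G (pr p) v w₁ + B (pr p) v w₁ = dHol (fun ζ => Φ ζ v) p a
        - pr a * Φ p (chernForm G (pr p) v) - pr a * covHol G B (pr p) v u) ∧
      (∀ v, G (pr p) v w₂ + B (pr p) v w₂ = conj (pr a) * covAnti G B (pr p) v u) ∧
      ContDiffAt ℝ 2 q p ∧
      dHol (fun y => dAnti (fun x => (Real.log (q x) : ℂ)) y a) p a
        = κ * ‖pr a‖ ^ 2 + (G (pr p) w₁ w₁ + B (pr p) w₁ w₁ + (G (pr p) w₂ w₂ + B (pr p) w₂ w₂)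
          - ‖pr a‖ ^ 2 * covHol G (covAnti G B) (pr p) u u) / q p
          - ‖G (pr p) u w₁ + B (pr p) u w₁‖ ^ 2 / (q p : ℂ) ^ 2 := by
  let b := Module.finBasis ℂ S
  -- Any norm will do, because the hypotheses and the conclusion involve only scalar functions; here
  -- it is transported from coordinates.
  let _ : NormedAddCommGroup S := NormedAddCommGroup.induced S _ b.equivFun b.equivFun.injective
  let _ : NormedSpace ℂ S := NormedSpace.induced ℂ S _ b.equivFun
  have hsum : ∀ u, (fun z => chernForm G z u)
      = fun z => ∑ i, b.coord i (chernForm G z u) • b i := by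
    intro u; funext z; exact (b.sum_repr _).symm
  have hd : ∀ u, DifferentiableAt ℝ (fun z => chernForm G z u) (pr p) := by
    intro u
    rw [hsum u]
    exact DifferentiableAt.fun_sum fun i _ => (hθd _ _).smul_const _
  refine mixed_hessian_log hG hK hGd hBd hd hθ (fun u => ?_) hΦ hΦd hq hq0
  refine b.ext_elem fun i => ?_
  have e := dAnti_clm (coordCLM b i) (hd u) 1
  rw [coordCLM_apply] at e
  rw [← e, map_smul, Finsupp.smul_apply, smul_eq_mul]
  exact hκ (b.coord i) u

end NormFree

end

/-! ### Quadratic forms and perturbation of determinants -/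

noncomputable section

section QuadraticForms

variable {V : Type*} [AddCommGroup V] [Module ℂ V]

/-- A complex sesquilinear form is determined by its diagonal, so curvature matrices are computed
and compared through `∂_a ∂̄_a` alone. -/
theorem SesqForm.polarization (A : SesqForm V) (x y : V) :
    4 * A x y = A (x + y) (x + y) - A (x - y) (x - y)
      + Complex.I * A (x + Complex.I • y) (x + Complex.I • y)
      - Complex.I * A (x - Complex.I • y) (x - Complex.I • y) := by
  have e : ∀ (u v w z : V), A (u + v) (w + z) = A u w + A u z + (A v w + A v z) := by
    intro u v w z
    rw [map_add A, LinearMap.add_apply, map_add, map_add]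
  have n : ∀ u v : V, A u (-v) = -A u v := fun u v => map_neg _ _
  have n' : ∀ u v : V, A (-u) v = -A u v := fun u v => by rw [map_neg A, LinearMap.neg_apply]
  have s : ∀ u v : V, A u (Complex.I • v) = -Complex.I * A u v := fun u v => by
    rw [LinearMap.map_smulₛₗ, Complex.conj_I, smul_eq_mul]
  have s' : ∀ u v : V, A (Complex.I • u) v = Complex.I * A u v := fun u v => by
    rw [LinearMap.map_smul, LinearMap.smul_apply, smul_eq_mul]
  simp only [sub_eq_add_neg, e, n, n', s, s']
  linear_combination (A x y * 2 - A y x * 2) * Complex.I_mul_I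

theorem SesqForm.ext_diag {A B : SesqForm V} (h : ∀ x, A x x = B x x) : A = B := by
  refine LinearMap.ext fun x => LinearMap.ext fun y => ?_
  have h1 := A.polarization x y
  rw [h, h, h, h, ← B.polarization x y] at h1
  exact mul_left_cancel₀ (by norm_num) h1

theorem SesqForm.conj_symm_of_real {A : SesqForm V} (h : ∀ x, (A x x).im = 0) (x y : V) :
    conj (A x y) = A y x := by
  have e : ∀ (u v : V), A (u + v) (u + v) = A u u + A u v + (A v u + A v v) := by
    intro u v
    rw [map_add A, LinearMap.add_apply, map_add, map_add]
  have h1 := h (x + y)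
  have h2 := h (x + Complex.I • y)
  rw [e] at h1 h2
  rw [LinearMap.map_smulₛₗ, Complex.conj_I, LinearMap.map_smul, LinearMap.smul_apply] at h2
  have h3 := h (Complex.I • y)
  rw [LinearMap.map_smul A] at h3
  simp only [Complex.add_im, h, smul_eq_mul] at h1 h2 h3
  rw [h3] at h2
  simp at h2
  apply Complex.ext
  · rw [Complex.conj_re]; linarith
  · rw [Complex.conj_im]; linarith

/-- A sesquilinear form which is real and positive on the diagonal. -/
def HermitianMetric.ofDiag (A : SesqForm V) (h : ∀ x, (A x x).im = 0)
    (hp : ∀ x, x ≠ 0 → 0 < (A x x).re) : HermitianMetric V where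
  form := A
  conj_symm := SesqForm.conj_symm_of_real h
  pos := hp

/-- Cauchy-Schwarz for a semidefinite form: isotropic vectors lie in the kernel. -/
theorem SesqForm.eq_zero_of_self_eq_zero {A : SesqForm V} (h : ∀ x, (A x x).im = 0)
    (hp : ∀ x, 0 ≤ (A x x).re) {x : V} (hx : A x x = 0) (y : V) : A x y = 0 := by
  let c : PreInnerProductSpace.Core ℂ V :=
    { inner := fun u v => A v u
      conj_inner_symm := fun u v => SesqForm.conj_symm_of_real h u v
      re_inner_nonneg := fun u => hp u
      add_left := fun u v w => by simp
      smul_left := fun u v c => by simp }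
  have h1 := InnerProductSpace.Core.norm_inner_le_norm (𝕜 := ℂ) y x
  have h2 : ‖A x y‖ ≤ √(A y y).re * √(A x x).re := h1
  rw [hx] at h2
  simpa using h2

/-- The form `∑ x_a conj (y_b) M_{ab}`. -/
def matForm {m : ℕ} (M : Matrix (Fin m) (Fin m) ℂ) : SesqForm (Fin m → ℂ) :=
  LinearMap.mk₂'ₛₗ (RingHom.id ℂ) (starRingEnd ℂ)
    (fun x y => ∑ a, ∑ b, x a * conj (y b) * M a b)
    (by intro x x' y; simp only [Pi.add_apply, add_mul, Finset.sum_add_distrib])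
    (by
      intro c x y
      simp only [Pi.smul_apply, smul_eq_mul, Finset.mul_sum, RingHom.id_apply, mul_assoc])
    (by
      intro x y y'
      simp only [Pi.add_apply, map_add, add_mul, mul_add, Finset.sum_add_distrib])
    (by
      intro c x y
      simp only [Pi.smul_apply, smul_eq_mul, Finset.mul_sum, map_mul]
      exact Finset.sum_congr rfl fun i _ => Finset.sum_congr rfl fun j _ => by ring)

theorem matForm_apply {m : ℕ} (M : Matrix (Fin m) (Fin m) ℂ) (x y : Fin m → ℂ) :
    matForm M x y = ∑ a, ∑ b, x a * conj (y b) * M a b := rfl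

theorem matForm_single {m : ℕ} (M : Matrix (Fin m) (Fin m) ℂ) (a b : Fin m) :
    matForm M (Pi.single a 1) (Pi.single b 1) = M a b := by
  rw [matForm_apply, Finset.sum_eq_single a, Finset.sum_eq_single b]
  · simp
  · intro c _ hc; simp [hc]
  · simp
  · intro c _ hc; simp [hc]
  · simp

theorem matForm_sub {m : ℕ} (M N : Matrix (Fin m) (Fin m) ℂ) (x y : Fin m → ℂ) :
    matForm (M - N) x y = matForm M x y - matForm N x y := by
  simp only [matForm_apply, Matrix.sub_apply, mul_sub, Finset.sum_sub_distrib]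

theorem matForm_mul_gram {m : ℕ} (M P : Matrix (Fin m) (Fin m) ℂ) (i j : Fin m) :
    (P * M * P.conjTranspose) i j = matForm M (P i) (P j) := by
  simp only [Matrix.mul_apply, matForm_apply, Matrix.conjTranspose_apply, Finset.sum_mul]
  rw [Finset.sum_comm]
  refine Finset.sum_congr rfl fun a _ => Finset.sum_congr rfl fun b _ => ?_
  rw [show star (P j b) = conj (P j b) from rfl]
  ring

/-- Telescoping: change one factor at a time, each change costing `η` times a power of `M`. -/
theorem norm_prod_sub_prod_le {ι : Type*} (s : Finset ι) {f g : ι → ℂ} {M η : ℝ} (hM : 1 ≤ M)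
    (hη : 0 ≤ η) (hf : ∀ i ∈ s, ‖f i‖ ≤ M) (hg : ∀ i ∈ s, ‖g i‖ ≤ M)
    (hfg : ∀ i ∈ s, ‖f i - g i‖ ≤ η) :
    ‖∏ i ∈ s, f i - ∏ i ∈ s, g i‖ ≤ s.card * M ^ s.card * η := by
  classical
  induction s using Finset.induction_on with
  | empty => simp
  | insert i s hi ih =>
    rw [Finset.prod_insert hi, Finset.prod_insert hi, Finset.card_insert_of_notMem hi]
    have h1 := ih (fun j hj => hf j (Finset.mem_insert_of_mem hj))
      (fun j hj => hg j (Finset.mem_insert_of_mem hj))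
      (fun j hj => hfg j (Finset.mem_insert_of_mem hj))
    have h2 : ‖∏ j ∈ s, g j‖ ≤ M ^ s.card := by
      rw [norm_prod, ← Finset.prod_const]
      exact Finset.prod_le_prod (fun _ _ => norm_nonneg _)
        fun j hj => hg j (Finset.mem_insert_of_mem hj)
    have h3 : f i * ∏ j ∈ s, f j - g i * ∏ j ∈ s, g j
        = f i * (∏ j ∈ s, f j - ∏ j ∈ s, g j) + (f i - g i) * ∏ j ∈ s, g j := by ring
    have hp : M ^ s.card ≤ M ^ (s.card + 1) := pow_le_pow_right₀ hM (Nat.le_succ _)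
    rw [h3]
    calc _ ≤ ‖f i‖ * ‖∏ j ∈ s, f j - ∏ j ∈ s, g j‖ + ‖f i - g i‖ * ‖∏ j ∈ s, g j‖ := by
          refine (norm_add_le _ _).trans ?_
          rw [norm_mul, norm_mul]
      _ ≤ M * (s.card * M ^ s.card * η) + η * M ^ s.card := by
          gcongr
          · exact hf i (Finset.mem_insert_self _ _)
          · exact hfg i (Finset.mem_insert_self _ _)
      _ ≤ M * (s.card * M ^ s.card * η) + η * M ^ (s.card + 1) := by gcongr
      _ = _ := by push_cast; ring

/-- Compare the `m!` terms of the Leibniz expansions, each a product of `m` entries bounded by `1 +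
D`. -/
theorem norm_det_one_add_sub_one_le {m : ℕ} {X : Matrix (Fin m) (Fin m) ℂ} {η D : ℝ}
    (hη : 0 ≤ η) (hD : η ≤ D) (hX : ∀ i j, ‖X i j‖ ≤ η) :
    ‖(1 + X).det - 1‖ ≤ m.factorial * (m * (1 + D) ^ m) * η := by
  have h1 : ((1 : Matrix (Fin m) (Fin m) ℂ)).det = 1 := Matrix.det_one
  have hone : ∀ i j, ‖(1 : Matrix (Fin m) (Fin m) ℂ) i j‖ ≤ 1 := by
    intro i j
    rw [Matrix.one_apply]
    split_ifs <;> simp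
  rw [← h1, Matrix.det_apply', Matrix.det_apply', ← Finset.sum_sub_distrib]
  calc _ ≤ ∑ σ : Equiv.Perm (Fin m), (m * (1 + D) ^ m * η) := by
        refine norm_sum_le_of_le _ fun σ _ => ?_
        rw [← mul_sub, norm_mul]
        have hs : ‖((Equiv.Perm.sign σ : ℤ) : ℂ)‖ = 1 := by
          rcases Int.units_eq_one_or (Equiv.Perm.sign σ) with h | h <;> simp [h]
        rw [hs, one_mul]
        have := norm_prod_sub_prod_le (Finset.univ : Finset (Fin m))
          (f := fun i => (1 + X) (σ i) i) (g := fun i => (1 : Matrix (Fin m) (Fin m) ℂ) (σ i) i)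
          (M := 1 + D) (η := η) (by linarith) hη ?_ ?_ ?_
        · simpa using this
        · intro i _
          exact (norm_add_le _ _).trans (add_le_add (hone _ _) ((hX _ _).trans hD))
        · intro i _
          exact (hone _ _).trans (by linarith)
        · intro i _
          simpa using hX (σ i) i
    _ = _ := by
        rw [Finset.sum_const, Finset.card_univ, Fintype.card_perm, Fintype.card_fin, nsmul_eq_mul]
        ring

/-- A perturbation of a positive definite matrix which is small relative to it changes the
determinant by a small factor. -/
theorem norm_det_add_sub_le {m : ℕ} {M R : Matrix (Fin m) (Fin m) ℂ} {δ D : ℝ} (hδ : 0 ≤ δ)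
    (hD : 4 * δ ≤ D) (hM : ∀ x, (matForm M x x).im = 0)
    (hMp : ∀ x, x ≠ 0 → 0 < (matForm M x x).re)
    (hR : ∀ x, ‖matForm R x x‖ ≤ δ * (matForm M x x).re) :
    ‖(M + R).det - M.det‖ ≤ m.factorial * (m * (1 + D) ^ m) * (4 * δ) * ‖M.det‖ := by
  let h := HermitianMetric.ofDiag (matForm M) hM hMp
  obtain ⟨b, hb⟩ := h.exists_orthonormal_basis
  have hm : Module.finrank ℂ (Fin m → ℂ) = m := by simp
  let c : Module.Basis (Fin m) ℂ (Fin m → ℂ) := b.reindex (finCongr hm)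
  have hc : ∀ i j, matForm M (c i) (c j) = if i = j then 1 else 0 := by
    intro i j
    have := hb ((finCongr hm).symm i) ((finCongr hm).symm j)
    simp only [EmbeddingLike.apply_eq_iff_eq] at this
    simp only [c, Module.Basis.reindex_apply]
    exact this
  -- Passing to a basis orthonormal for `M` turns `M` into the identity and `R` into a matrix with
  -- small entries. Both determinants are multiplied by the same factor, so the relative error is
  -- unchanged.
  let P : Matrix (Fin m) (Fin m) ℂ := Matrix.of fun i => c i
  have hP : P * M * P.conjTranspose = 1 := by
    ext i j
    rw [matForm_mul_gram, Matrix.one_apply]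
    exact hc i j
  -- The hypothesis bounds `R` only on the diagonal. Polarization writes `4 R(c_i, c_j)` with four
  -- diagonal values at `c_i + a c_j`, `|a| = 1`, where `M` is at most `4`.
  have hX : ∀ i j, ‖(P * R * P.conjTranspose) i j‖ ≤ 4 * δ := by
    intro i j
    rw [matForm_mul_gram]
    have e : ∀ (a : ℂ), ‖a‖ = 1 → (matForm M (c i + a • c j) (c i + a • c j)).re ≤ 4 := by
      intro a ha
      have hx : matForm M (c i + a • c j) (c i + a • c j)
          = matForm M (c i) (c i) + conj a * matForm M (c i) (c j)
            + (a * matForm M (c j) (c i) + a * conj a * matForm M (c j) (c j)) := by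
        rw [map_add (matForm M), LinearMap.add_apply, map_add, map_add, LinearMap.map_smulₛₗ,
          LinearMap.map_smul, LinearMap.smul_apply, LinearMap.smul_apply, LinearMap.map_smulₛₗ]
        simp only [smul_eq_mul]
        ring
      rw [hx, hc, hc, hc, hc, Complex.mul_conj', ha]
      have h1 := Complex.re_le_norm a
      rw [ha] at h1
      by_cases hij : i = j
      · subst hij
        simp
        linarith
      · simp [hij, Ne.symm hij]
        norm_num
    have e' : ∀ (a : ℂ), ‖a‖ = 1 → ‖matForm R (c i + a • c j) (c i + a • c j)‖ ≤ δ * 4 := by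
      intro a ha
      exact (hR _).trans (mul_le_mul_of_nonneg_left (e a ha) hδ)
    have h1 := e' 1 (by simp)
    have h2 := e' (-1) (by simp)
    have h3 := e' Complex.I (by simp)
    have h4 := e' (-Complex.I) (by simp)
    simp only [one_smul, neg_smul, ← sub_eq_add_neg] at h1 h2 h3 h4
    have h5 := (matForm R).polarization (c i) (c j)
    have h6 : ‖4 * matForm R (c i) (c j)‖ ≤ δ * 4 + δ * 4 + δ * 4 + δ * 4 := by
      rw [h5]
      refine (norm_sub_le _ _).trans (add_le_add ((norm_add_le _ _).trans (add_le_add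
        ((norm_sub_le _ _).trans (add_le_add h1 h2)) ?_)) ?_)
      · rwa [norm_mul, Complex.norm_I, one_mul]
      · rwa [norm_mul, Complex.norm_I, one_mul]
    rw [norm_mul, show ‖(4 : ℂ)‖ = 4 by norm_num] at h6
    change ‖matForm R (c i) (c j)‖ ≤ 4 * δ
    linarith
  have h1 := norm_det_one_add_sub_one_le (by positivity) hD hX
  have e1 : P.det * P.conjTranspose.det * M.det = 1 := by
    have := congrArg Matrix.det hP
    rw [Matrix.det_mul, Matrix.det_mul, Matrix.det_one] at this
    rw [← this]; ring
  have e2 : P.det * P.conjTranspose.det * ((M + R).det - M.det)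
      = (1 + P * R * P.conjTranspose).det - 1 := by
    rw [mul_sub, e1, ← hP, ← Matrix.add_mul, ← Matrix.mul_add, Matrix.det_mul, Matrix.det_mul]
    ring
  rw [← e2, norm_mul] at h1
  have e3 : ‖P.det * P.conjTranspose.det‖ * ‖M.det‖ = 1 := by rw [← norm_mul, e1, norm_one]
  calc ‖(M + R).det - M.det‖
      = ‖P.det * P.conjTranspose.det‖ * ‖(M + R).det - M.det‖ * ‖M.det‖ := by
        rw [mul_right_comm, e3, one_mul]
    _ ≤ _ := by gcongr

/-- Expand along the first row: the corner entry does not occur in any of the minors. -/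
theorem det_add_corner {m : ℕ} (S : Matrix (Fin (m + 1)) (Fin (m + 1)) ℂ) (c : ℂ) :
    (S + Matrix.single 0 0 c).det = S.det + c * (S.submatrix Fin.succ Fin.succ).det := by
  have hsub : ∀ j : Fin (m + 1), (S + Matrix.single 0 0 c).submatrix Fin.succ j.succAbove
      = S.submatrix Fin.succ j.succAbove := by
    intro j
    ext a b
    simp [(Fin.succ_ne_zero a).symm]
  rw [Matrix.det_succ_row_zero, Matrix.det_succ_row_zero S]
  simp only [hsub, Matrix.add_apply]
  rw [Fin.sum_univ_succ, Fin.sum_univ_succ]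
  have h0 : ∀ x : Fin m, (0 : Fin (m + 1)) ≠ x.succ := fun x => (Fin.succ_ne_zero x).symm
  simp [Fin.succAbove_zero, h0]
  ring

/-- An isotropic vector of a semidefinite form lies in its kernel, hence is a null vector of the
matrix. -/
theorem det_eq_zero_of_matForm_eq_zero {m : ℕ} {S : Matrix (Fin m) (Fin m) ℂ}
    (h : ∀ x, (matForm S x x).im = 0) (hp : ∀ x, 0 ≤ (matForm S x x).re) {x : Fin m → ℂ}
    (hx0 : x ≠ 0) (hx : matForm S x x = 0) : S.det = 0 := by
  rw [← Matrix.exists_vecMul_eq_zero_iff]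
  refine ⟨x, hx0, funext fun b => ?_⟩
  have := SesqForm.eq_zero_of_self_eq_zero h hp hx (Pi.single b 1)
  rw [matForm_apply] at this
  simp only [Matrix.vecMul, dotProduct, Pi.zero_apply]
  rw [← this]
  refine Finset.sum_congr rfl fun a _ => ?_
  rw [Finset.sum_eq_single b]
  · simp
  · intro c _ hc; simp [hc]
  · simp

/-- The determinant of the curvature matrix of the Fubini-Study metric. -/
theorem det_fubiniStudy {n : ℕ} (P : Matrix (Fin (n + 1)) (Fin (n + 1)) ℂ) (y : Fin n → ℂ)
    {F : Fin (n + 1) → ℂ} (hF : ∀ k, F k = ∑ i, (Fin.cons 1 y : Fin (n + 1) → ℂ) i * P k i)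
    {Q : ℂ} (hQ : ∑ k, F k * conj (F k) = Q) (hQ0 : Q ≠ 0) :
    (Matrix.of fun i j : Fin n => (∑ k, P k i.succ * conj (P k j.succ)) / Q
      - (∑ k, P k i.succ * conj (F k)) * (∑ k, F k * conj (P k j.succ)) / Q ^ 2).det
      = P.det * conj P.det / Q ^ (n + 1) := by
  -- `U` is unimodular with first row `(1, y)`. The Gram matrix of the rows of `U Pᵀ` therefore has
  -- determinant `|det P|²` and corner entry `Q`.
  let U : Matrix (Fin (n + 1)) (Fin (n + 1)) ℂ :=
    Matrix.of (Fin.cons (Fin.cons 1 y) fun i => Pi.single i.succ 1)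
  have hU : U.det = 1 := by
    rw [Matrix.det_succ_column_zero, Fin.sum_univ_succ]
    have h1 : U.submatrix (Fin.succAbove 0) Fin.succ = 1 := by
      ext i j
      simp [U, Matrix.one_apply, Pi.single_apply, eq_comm]
    have h2 : U 0 0 = 1 := by simp [U]
    have h3 : ∀ i : Fin n, U i.succ 0 = 0 := by
      intro i
      simp [U, (Fin.succ_ne_zero i).symm]
    rw [h1, h2]
    simp [h3]
  let N := U * P.transpose
  have hN0 : ∀ k, N 0 k = F k := by
    intro k
    rw [hF]
    simp [N, U, Matrix.mul_apply]
  have hNs : ∀ (i : Fin n) k, N i.succ k = P k i.succ := by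
    intro i k
    simp [N, U, Matrix.mul_apply, Pi.single_apply]
  let Gm := N * N.conjTranspose
  have hG : ∀ i j, Gm i j = ∑ k, N i k * conj (N j k) := by
    intro i j
    rfl
  have hdet : Gm.det = P.det * conj P.det := by
    rw [Matrix.det_mul, Matrix.det_conjTranspose, Matrix.det_mul, hU, Matrix.det_transpose]
    simp
  have hG00 : Gm 0 0 = Q := by rw [hG, ← hQ]; simp only [hN0]
  -- Row elimination below the corner. The remaining block, the Schur complement, is `Q` times the
  -- matrix in question, whence the power `Q^{n+1}`.
  let B : Matrix (Fin (n + 1)) (Fin (n + 1)) ℂ :=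
    Matrix.of fun i j => if i = 0 then Gm i j else Gm i j - Gm i 0 / Q * Gm 0 j
  have hB : Gm.det = B.det := by
    refine Matrix.det_eq_of_forall_row_eq_smul_add_const
      (fun i => if i = 0 then 0 else Gm i 0 / Q) 0 (by simp) fun i j => ?_
    by_cases hi : i = 0
    · subst hi; simp [B]
    · simp [B, hi]
  have hBs : B.det = Q * (B.submatrix Fin.succ Fin.succ).det := by
    rw [Matrix.det_succ_column_zero, Fin.sum_univ_succ]
    have h0 : B 0 0 = Q := by simp [B, hG00]
    have h1 : ∀ i : Fin n, B i.succ 0 = 0 := by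
      intro i
      simp only [B, Matrix.of_apply, Fin.succ_ne_zero, if_false, hG00]
      field_simp
      ring
    simp [h0, h1, Fin.succAbove_zero]
  have hC : (Matrix.of fun i j : Fin n => (∑ k, P k i.succ * conj (P k j.succ)) / Q
      - (∑ k, P k i.succ * conj (F k)) * (∑ k, F k * conj (P k j.succ)) / Q ^ 2)
      = Q⁻¹ • B.submatrix Fin.succ Fin.succ := by
    ext i j
    simp only [B, Matrix.smul_apply, Matrix.submatrix_apply, Matrix.of_apply, Fin.succ_ne_zero,
      if_false, hG, hN0, hNs, smul_eq_mul]
    field_simp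
  rw [hC, Matrix.det_smul, Fintype.card_fin, ← hdet, hB, hBs, inv_pow, pow_succ]
  field_simp

end QuadraticForms

end

/-! ### Complex changes of variables and Gaussian integrals -/

noncomputable section

section ComplexChangeOfVariables

variable {m : ℕ} {B : Type*} [NormedAddCommGroup B] {T : (Fin m → ℂ) →ₗ[ℂ] (Fin m → ℂ)}

/-- The real determinant of a complex linear map is the squared modulus of its complex determinant.
-/
theorem map_complexLinear (hT : LinearMap.det T ≠ 0) :
    Measure.map T volume = ENNReal.ofReal ((‖LinearMap.det T‖ ^ 2)⁻¹) • volume := by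
  have hdet : LinearMap.det (T.restrictScalars ℝ) = ‖LinearMap.det T‖ ^ 2 := by
    rw [LinearMap.det_restrictScalars, Algebra.norm_complex_eq, ← Complex.normSq_eq_norm_sq]
    rfl
  have h := Measure.map_linearMap_addHaar_eq_smul_addHaar (volume : Measure (Fin m → ℂ))
    (f := T.restrictScalars ℝ) (by rw [hdet]; positivity)
  rw [hdet, abs_of_nonneg (by positivity)] at h
  exact h

theorem measurableEmbedding_complexLinear (hT : LinearMap.det T ≠ 0) : MeasurableEmbedding T := by
  let e : (Fin m → ℂ) ≃ₗ[ℂ] (Fin m → ℂ) := LinearMap.equivOfDetNeZero T hT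
  exact e.toContinuousLinearEquiv.toHomeomorph.measurableEmbedding

theorem integral_comp_complexLinear [NormedSpace ℝ B] (hT : LinearMap.det T ≠ 0)
    (f : (Fin m → ℂ) → B) :
    ∫ x, f (T x) = (‖LinearMap.det T‖ ^ 2)⁻¹ • ∫ x, f x := by
  rw [← (measurableEmbedding_complexLinear hT).integral_map, map_complexLinear hT,
    integral_smul_measure, ENNReal.toReal_ofReal (by positivity)]

theorem integrable_comp_complexLinear (hT : LinearMap.det T ≠ 0) {f : (Fin m → ℂ) → B}
    (hf : Integrable f) : Integrable fun x => f (T x) := by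
  have := (measurableEmbedding_complexLinear hT).integrable_map_iff (g := f) (μ := volume)
  rw [map_complexLinear hT] at this
  exact this.1 (hf.smul_measure ENNReal.ofReal_ne_top)

end ComplexChangeOfVariables

/-! ### Gaussian moments of monomials. -/

section Gaussian

theorem integral_norm_pow_mul_gaussian (m : ℕ) {b : ℝ} (hb : 0 < b) :
    ∫ z : ℂ, ‖z‖ ^ (2 * m) * Real.exp (-(b * ‖z‖ ^ 2)) = Real.pi * m.factorial / b ^ (m + 1) := by
  have h := Complex.integral_rpow_mul_exp_neg_mul_rpow (p := 2) (q := ((2 * m : ℕ) : ℝ)) (b := b)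
    (by norm_num) (by have : (0 : ℝ) ≤ ((2 * m : ℕ) : ℝ) := by positivity
                      linarith) hb
  have e1 : (((2 * m : ℕ) : ℝ) + 2) / 2 = m + 1 := by push_cast; ring
  have e2 : -(((2 * m : ℕ) : ℝ) + 2) / 2 = -((m + 1 : ℕ) : ℝ) := by push_cast; ring
  rw [e1, e2, Real.Gamma_nat_eq_factorial, Real.rpow_neg hb.le, Real.rpow_natCast] at h
  have e3 : ∀ z : ℂ, ‖z‖ ^ (2 * m) * Real.exp (-(b * ‖z‖ ^ 2))
      = ‖z‖ ^ ((2 * m : ℕ) : ℝ) * Real.exp (-b * ‖z‖ ^ (2 : ℝ)) := by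
    intro z
    rw [Real.rpow_natCast, Real.rpow_two, neg_mul]
  simp only [e3]
  rw [h]
  field_simp

theorem integrable_gaussian_monomial (p q : ℕ) :
    Integrable fun z : ℂ => z ^ p * conj z ^ q * (Real.exp (-‖z‖ ^ 2) : ℂ) := by
  have h : Integrable fun z : ℂ => ‖z‖ ^ ((p + q : ℕ) : ℝ) * Real.exp (-‖z‖ ^ (2 : ℝ)) := by
    refine .of_integral_ne_zero ?_
    rw [Complex.integral_rpow_mul_exp_neg_rpow (by norm_num)
      (by have : (0 : ℝ) ≤ ((p + q : ℕ) : ℝ) := by positivity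
          linarith)]
    have := Real.Gamma_pos_of_pos (s := (((p + q : ℕ) : ℝ) + 2) / 2) (by positivity)
    positivity
  refine h.mono' (by fun_prop) (Filter.Eventually.of_forall fun z => ?_)
  rw [Real.rpow_natCast, Real.rpow_two, norm_mul, norm_mul, norm_pow, norm_pow, RCLike.norm_conj,
    pow_add, Complex.norm_real, Real.norm_of_nonneg (Real.exp_pos _).le]

theorem integral_gaussian_monomial (p q : ℕ) :
    ∫ z : ℂ, z ^ p * conj z ^ q * (Real.exp (-‖z‖ ^ 2) : ℂ)
      = if p = q then (Real.pi * p.factorial : ℂ) else 0 := by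
  split_ifs with hpq
  · subst hpq
    have h := integral_norm_pow_mul_gaussian p one_pos
    have e : ∀ z : ℂ, z ^ p * conj z ^ p * (Real.exp (-‖z‖ ^ 2) : ℂ)
        = ((‖z‖ ^ (2 * p) * Real.exp (-(1 * ‖z‖ ^ 2)) : ℝ) : ℂ) := by
      intro z
      rw [← mul_pow, Complex.mul_conj', one_mul, ← pow_mul]
      push_cast
      rfl
    simp only [e]
    rw [integral_complex_ofReal, h]
    simp
  · have hne : ((p : ℝ) - q) ≠ 0 := sub_ne_zero.2 (by exact_mod_cast hpq)
    -- Rotation by the angle `π / (p - q)` preserves the measure and multiplies the integrand by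
    -- `-1`, so the integral vanishes.
    let c : Circle := Circle.exp (Real.pi / ((p : ℝ) - q))
    have hc : (c : ℂ) ^ p * conj (c : ℂ) ^ q = -1 := by
      rw [Circle.coe_exp, ← Complex.exp_conj, ← Complex.exp_nat_mul, ← Complex.exp_nat_mul,
        ← Complex.exp_add, ← Complex.exp_pi_mul_I]
      congr 1
      have hne' : ((p : ℂ) - q) ≠ 0 := by exact_mod_cast hne
      simp only [map_mul, Complex.conj_ofReal, Complex.conj_I]
      push_cast
      field_simp
      ring
    have h := (rotation c).measurePreserving.integral_comp
      (rotation c).toHomeomorph.measurableEmbedding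
      (fun z : ℂ => z ^ p * conj z ^ q * (Real.exp (-‖z‖ ^ 2) : ℂ))
    have e : ∀ z : ℂ, (rotation c z) ^ p * conj (rotation c z) ^ q
        * (Real.exp (-‖rotation c z‖ ^ 2) : ℂ)
        = -1 * (z ^ p * conj z ^ q * (Real.exp (-‖z‖ ^ 2) : ℂ)) := by
      intro z
      rw [LinearIsometryEquiv.norm_map, rotation_apply, map_mul, mul_pow, mul_pow, ← hc]
      ring
    simp only [e] at h
    rw [integral_const_mul] at h
    linear_combination (-1 / 2 : ℂ) * h

/-- If all fibres of `k` and `l` have equal sizes, these permutations form a coset of the stabilizer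
of `k`, a product of the symmetric groups of its fibres; otherwise there are none. This matches
Gaussian moments `∏ p_a!` with the permutation sum in `Sym^d h`. -/
theorem card_perm_comp_eq {d m : ℕ} (k l : Fin d → Fin m) :
    Fintype.card {σ : Equiv.Perm (Fin d) // k = l ∘ σ}
      = if ∀ a, Fintype.card {i // k i = a} = Fintype.card {i // l i = a}
        then ∏ a, (Fintype.card {i // k i = a}).factorial else 0 := by
  split_ifs with h
  · let τ : Equiv.Perm (Fin d) := Equiv.ofFiberEquiv fun c => Fintype.equivOfCardEq (h c)
    have hτ : k = l ∘ τ := funext fun i => (Equiv.ofFiberEquiv_map _ i).symm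
    rw [← DomMulAct.stabilizer_card]
    refine Fintype.card_congr (Equiv.subtypeEquiv (Equiv.mulLeft τ⁻¹) fun σ => ?_)
    constructor
    · intro hσ
      rw [hτ] at hσ ⊢
      funext i
      change l (τ (τ.symm (σ i))) = l (τ i)
      rw [Equiv.apply_symm_apply]
      exact (congrFun hσ i).symm
    · intro hσ
      conv_lhs => rw [← hσ, hτ]
      ext i
      simp
  · rw [Fintype.card_eq_zero_iff]
    refine ⟨fun ⟨σ, hσ⟩ => h fun a => ?_⟩
    refine Fintype.card_congr (Equiv.subtypeEquiv σ fun i => ?_)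
    rw [hσ, Function.comp_apply]

/-- Gaussian orthogonality of monomials. -/
theorem integral_monomial_gaussian {d m : ℕ} (k l : Fin d → Fin m) :
    Integrable (fun x : Fin m → ℂ => (∏ i, x (k i)) * conj (∏ i, x (l i))
      * (Real.exp (-∑ a, ‖x a‖ ^ 2) : ℂ)) ∧
    ∫ x : Fin m → ℂ, (∏ i, x (k i)) * conj (∏ i, x (l i)) * (Real.exp (-∑ a, ‖x a‖ ^ 2) : ℂ)
      = Real.pi ^ m * ∑ σ : Equiv.Perm (Fin d), ∏ i, if k i = l (σ i) then (1 : ℂ) else 0 := by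
  have hp : ∀ (k : Fin d → Fin m) (x : Fin m → ℂ),
      ∏ i, x (k i) = ∏ a, x a ^ Fintype.card {i // k i = a} := by
    intro k x
    rw [← Finset.prod_fiberwise Finset.univ k]
    refine Finset.prod_congr rfl fun a _ => ?_
    rw [Fintype.card_subtype, ← Finset.prod_const]
    refine Finset.prod_congr rfl fun i hi => ?_
    rw [(Finset.mem_filter.1 hi).2]
  have e : ∀ x : Fin m → ℂ, (∏ i, x (k i)) * conj (∏ i, x (l i))
      * (Real.exp (-∑ a, ‖x a‖ ^ 2) : ℂ)
      = ∏ a, (x a ^ Fintype.card {i // k i = a} * conj (x a) ^ Fintype.card {i // l i = a}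
        * (Real.exp (-‖x a‖ ^ 2) : ℂ)) := by
    intro x
    rw [Finset.prod_mul_distrib, Finset.prod_mul_distrib, hp, hp, map_prod,
      ← Complex.ofReal_prod, ← Real.exp_sum, Finset.sum_neg_distrib]
    simp only [map_pow]
  simp only [e]
  refine ⟨Integrable.fintype_prod fun a => integrable_gaussian_monomial _ _, ?_⟩
  rw [integral_fintype_prod_volume_eq_prod (f := fun a (z : ℂ) =>
    z ^ Fintype.card {i // k i = a} * conj z ^ Fintype.card {i // l i = a}
      * (Real.exp (-‖z‖ ^ 2) : ℂ))]
  simp only [integral_gaussian_monomial]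
  have h1 : ∀ σ : Equiv.Perm (Fin d), (∏ i, if k i = l (σ i) then (1 : ℂ) else 0)
      = if k = l ∘ σ then 1 else 0 := by
    intro σ
    rw [Finset.prod_ite_zero]
    simp [funext_iff]
  simp only [h1]
  rw [Finset.sum_boole, ← Fintype.card_subtype, card_perm_comp_eq, Finset.prod_ite_zero]
  split_ifs with h2 h3 h3
  · simp [Finset.prod_mul_distrib]
  · exact absurd (fun a => h2 a (Finset.mem_univ a)) h3
  · exact absurd (fun a _ => h3 a) h2
  · simp

end Gaussian

end

/-! ### Integrals over the fibres in affine coordinates -/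

noncomputable section

open Filter Topology

section FibreIntegral

variable {n d : ℕ}

/-- The covector with coordinates `x`. -/
def coordCovector {m : ℕ} (x : Fin m → ℂ) : Module.Dual ℂ (Fin m → ℂ) :=
  ∑ j, x j • LinearMap.proj j

theorem coordCovector_apply {m : ℕ} (x v : Fin m → ℂ) : coordCovector x v = ∑ j, x j * v j := by
  simp [coordCovector]

theorem coordCovector_smul {m : ℕ} (c : ℂ) (x : Fin m → ℂ) :
    coordCovector (c • x) = c • coordCovector x := by
  simp [coordCovector, Finset.smul_sum, mul_smul]

theorem affineCovector_eq (y : Fin n → ℂ) : affineCovector y = coordCovector (Fin.cons 1 y) := rfl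

theorem affineCovector_ne_zero (y : Fin n → ℂ) : affineCovector y ≠ 0 := by
  intro h
  have := LinearMap.congr_fun h (Pi.single 0 1)
  rw [affineCovector_eq, coordCovector_apply, Fin.sum_univ_succ] at this
  simp at this

theorem continuous_coordCovector_apply {m : ℕ} (v : Fin m → ℂ) :
    Continuous fun x : Fin m → ℂ => coordCovector x v := by
  simp only [coordCovector_apply]
  fun_prop

theorem continuous_covecPow_coordCovector {m : ℕ} (s : Sym[ℂ]^d (Fin m → ℂ)) :
    Continuous fun x : Fin m → ℂ => covecPow d (coordCovector x) s := by
  induction s using sym_induction with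
  | ht v =>
    simp only [covecPow_tprod]
    exact continuous_finsetProd _ fun i _ => continuous_coordCovector_apply _
  | h0 => simpa using continuous_const
  | ha s t hs ht =>
    simp only [map_add]
    exact hs.add ht
  | hs c s hs =>
    simp only [map_smul, smul_eq_mul]
    exact continuous_const.mul hs

variable (h : HermitianMetric (Fin (n + 1) → ℂ))

theorem HermitianMetric.exists_orthonormal_basis_fin :
    ∃ b : Module.Basis (Fin (n + 1)) ℂ (Fin (n + 1) → ℂ),
      ∀ i j, h.form (b i) (b j) = if i = j then 1 else 0 := by
  obtain ⟨b, hb⟩ := h.exists_orthonormal_basis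
  refine ⟨b.reindex (finCongr (by simp)), fun i j => ?_⟩
  have := hb ((finCongr (by simp)).symm i) ((finCongr (by simp)).symm j)
  simp only [EmbeddingLike.apply_eq_iff_eq] at this
  simp only [Module.Basis.reindex_apply]
  exact this

variable {h} {b : Module.Basis (Fin (n + 1)) ℂ (Fin (n + 1) → ℂ)}
  (hb : ∀ i j, h.form (b i) (b j) = if i = j then 1 else 0)

theorem basisMatrix_det_ne_zero (b : Module.Basis (Fin (n + 1)) ℂ (Fin (n + 1) → ℂ)) :
    (Matrix.of fun k => b k : Matrix (Fin (n + 1)) (Fin (n + 1)) ℂ).det ≠ 0 := by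
  have h1 : (Matrix.of fun k => b k : Matrix (Fin (n + 1)) (Fin (n + 1)) ℂ)
      = ((Pi.basisFun ℂ (Fin (n + 1))).toMatrix b).transpose := by
    ext k i
    simp [Module.Basis.toMatrix_apply]
  rw [h1, Matrix.det_transpose]
  exact ((Pi.basisFun ℂ (Fin (n + 1))).isUnit_det b).ne_zero

include hb in
-- Both sides are sesquilinear in `v` and `w`, so products of orthonormal basis vectors suffice. For
-- these the linear substitution by `P` turns the integrand into a Gaussian monomial, and the
-- permutation sum is `d!` times the symmetric pairing.
theorem integral_covecPow_gaussian (v w : Sym[ℂ]^d (Fin (n + 1) → ℂ)) :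
    Integrable (fun x : Fin (n + 1) → ℂ => covecPow d (coordCovector x) v
      * conj (covecPow d (coordCovector x) w)
      * (Real.exp (-dualNormSq h.form (coordCovector x)) : ℂ)) ∧
    ∫ x : Fin (n + 1) → ℂ, covecPow d (coordCovector x) v
      * conj (covecPow d (coordCovector x) w)
      * (Real.exp (-dualNormSq h.form (coordCovector x)) : ℂ)
      = ((‖(Matrix.of fun k => b k : Matrix (Fin (n + 1)) (Fin (n + 1)) ℂ).det‖ ^ 2)⁻¹ : ℝ)
        * (Real.pi ^ (n + 1) * d.factorial) * symForm d h.form v w := by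
  set P : Matrix (Fin (n + 1)) (Fin (n + 1)) ℂ := Matrix.of fun k => b k with hP
  induction v using sym_basis_induction b with
  | ht k =>
    induction w using sym_basis_induction b with
    | ht l =>
      have hdet : LinearMap.det (Matrix.toLin' P) ≠ 0 := by
        rw [LinearMap.det_toLin']
        exact basisMatrix_det_ne_zero b
      obtain ⟨h1, h2⟩ := integral_monomial_gaussian k l
      have e : ∀ (x : Fin (n + 1) → ℂ) k, coordCovector x (b k) = Matrix.toLin' P x k := by
        intro x k
        rw [coordCovector_apply, Matrix.toLin'_apply, Matrix.mulVec, dotProduct]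
        exact Finset.sum_congr rfl fun i _ => mul_comm _ _
      simp only [covecPow_tprod, h.dualNormSq_eq_sum b hb, e]
      refine ⟨integrable_comp_complexLinear hdet h1, ?_⟩
      refine (integral_comp_complexLinear hdet (fun x : Fin (n + 1) → ℂ => (∏ i, x (k i))
        * conj (∏ i, x (l i)) * (Real.exp (-∑ a, ‖x a‖ ^ 2) : ℂ))).trans ?_
      rw [h2, symForm_tprod, LinearMap.det_toLin']
      simp only [hb]
      have : (d.factorial : ℂ) ≠ 0 := by exact_mod_cast d.factorial_ne_zero
      rw [Complex.real_smul]
      field_simp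
    | h0 => simp
    | ha s t hs ht =>
      simp only [map_add, mul_add, add_mul]
      exact ⟨hs.1.add ht.1, by rw [integral_add hs.1 ht.1, hs.2, ht.2]⟩
    | hs c s hs =>
      simp only [map_smul, LinearMap.map_smulₛₗ, smul_eq_mul, map_mul]
      have e : ∀ a b c d : ℂ, a * (b * c) * d = b * (a * c * d) := fun _ _ _ _ => by ring
      simp only [e]
      exact ⟨hs.1.const_mul _, by rw [integral_const_mul, hs.2]; ring⟩
  | h0 => simp
  | ha s t hs ht =>
    simp only [map_add, add_mul, mul_add, LinearMap.add_apply]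
    exact ⟨hs.1.add ht.1, by rw [integral_add hs.1 ht.1, hs.2, ht.2]⟩
  | hs c s hs =>
    simp only [map_smul, LinearMap.smul_apply, smul_eq_mul]
    have e : ∀ b c a d : ℂ, b * a * c * d = b * (a * c * d) := fun _ _ _ _ => by ring
    simp only [e]
    exact ⟨hs.1.const_mul _, by rw [integral_const_mul, hs.2]; ring⟩

/-- The integral of a function over `ℂ^{n+1}` in the coordinates `(x₀, x₀ y)`. -/
theorem integral_homogeneous_coordinates {G : (Fin (n + 1) → ℂ) → ℂ} (hG : Integrable G)
    (hc : Continuous G) :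
    Integrable (fun p : ℂ × (Fin n → ℂ) =>
      (‖p.1‖ ^ (2 * n) : ℝ) • G (p.1 • (Fin.cons 1 p.2 : Fin (n + 1) → ℂ)))
      (volume.prod volume) ∧
    ∫ x, G x = ∫ y : Fin n → ℂ, ∫ t : ℂ,
      (‖t‖ ^ (2 * n) : ℝ) • G (t • (Fin.cons 1 y : Fin (n + 1) → ℂ)) := by
  have hmp := (volume_preserving_piFinSuccAbove (fun _ : Fin (n + 1) => ℂ) 0).symm
  have hcons : ∀ p : ℂ × (Fin n → ℂ),
      (MeasurableEquiv.piFinSuccAbove (fun _ : Fin (n + 1) => ℂ) 0).symm p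
        = (Fin.cons p.1 p.2 : Fin (n + 1) → ℂ) := by
    intro p
    simp [MeasurableEquiv.piFinSuccAbove, Fin.insertNthEquiv]
  have hI : Integrable (fun p : ℂ × (Fin n → ℂ) => G (Fin.cons p.1 p.2))
      (volume.prod volume) := by
    have := (hmp.integrable_comp_emb (MeasurableEquiv.measurableEmbedding _) (g := G)).2 hG
    refine this.congr (Eventually.of_forall fun p => ?_)
    simp only [Function.comp_apply, hcons]
  have hsm : ∀ (t : ℂ) (y : Fin n → ℂ),
      t • (Fin.cons 1 y : Fin (n + 1) → ℂ) = Fin.cons t (t • y) := by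
    intro t y
    funext j
    refine Fin.cases ?_ (fun i => ?_) j <;> simp
  have hdet : ∀ t : ℂ, LinearMap.det (t • LinearMap.id : (Fin n → ℂ) →ₗ[ℂ] (Fin n → ℂ)) = t ^ n := by
    intro t
    simp
  -- The substitution `y ↦ t y` on `ℂ^n` has real Jacobian `|t|^{2n}`, the weight in the statement.
  -- It fails only at `t = 0`, a null set.
  have hscale : ∀ {C : Type} [NormedAddCommGroup C] [NormedSpace ℝ C] (t : ℂ), t ≠ 0 →
      ∀ F : (Fin n → ℂ) → C, ∫ y, F (t • y) = (‖t‖ ^ (2 * n))⁻¹ • ∫ y, F y := by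
    intro C _ _ t ht F
    have := integral_comp_complexLinear (T := t • LinearMap.id) (by rw [hdet]; exact pow_ne_zero _ ht) F
    rw [hdet, norm_pow, ← pow_mul, mul_comm n] at this
    exact this
  have hne : ∀ᵐ t : ℂ, t ≠ 0 := by
    simp [ae_iff]
  have hint : ∀ t : ℂ, t ≠ 0 → ∫ y : Fin n → ℂ, (‖t‖ ^ (2 * n) : ℝ) •
      G (t • (Fin.cons 1 y : Fin (n + 1) → ℂ)) = ∫ y : Fin n → ℂ, G (Fin.cons t y) := by
    intro t ht
    simp only [hsm]
    rw [integral_smul, hscale t ht (fun y => G (Fin.cons t y)), smul_inv_smul₀ (by positivity)]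
  -- Joint integrability must be known before the order of integration is exchanged: on almost every
  -- slice it is a rescaling of the original function, and the slice norms are unchanged.
  have hJ : Integrable (fun p : ℂ × (Fin n → ℂ) =>
      (‖p.1‖ ^ (2 * n) : ℝ) • G (p.1 • (Fin.cons 1 p.2 : Fin (n + 1) → ℂ)))
      (volume.prod volume) := by
    rw [integrable_prod_iff]
    · constructor
      · filter_upwards [hne, hI.prod_right_ae] with t ht hIt
        simp only [hsm]
        refine Integrable.smul (‖t‖ ^ (2 * n)) ?_
        exact integrable_comp_complexLinear (T := t • LinearMap.id)
          (by rw [hdet]; exact pow_ne_zero _ ht) hIt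
      · refine hI.integral_norm_prod_left.congr ?_
        filter_upwards [hne] with t ht
        simp only [hsm, norm_smul]
        rw [integral_const_mul, hscale t ht (fun y => ‖G (Fin.cons t y)‖), Real.norm_of_nonneg
          (by positivity), smul_eq_mul, mul_inv_cancel_left₀ (by positivity)]
    · refine Continuous.aestronglyMeasurable ?_
      refine Continuous.smul (continuous_fst.norm.pow _) (hc.comp ?_)
      refine continuous_fst.smul (continuous_pi fun j => ?_)
      refine Fin.cases ?_ (fun i => ?_) j
      · simpa using continuous_const
      · simp only [Fin.cons_succ]; fun_prop
  refine ⟨hJ, ?_⟩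
  rw [← integral_integral_swap (f := fun (t : ℂ) (y : Fin n → ℂ) =>
    (‖t‖ ^ (2 * n) : ℝ) • G (t • (Fin.cons 1 y : Fin (n + 1) → ℂ))) hJ]
  rw [← hmp.integral_comp' G]
  simp only [hcons]
  rw [Measure.volume_eq_prod, integral_prod _ hI]
  refine integral_congr_ae ?_
  filter_upwards [hne] with t ht
  exact (hint t ht).symm

include hb in
/-- The integral over an affine chart of the dual projective space of a product of two sections of
`𝒪(d)`, with respect to the measure induced by a Hermitian inner product. -/
theorem integral_covecPow_affine (v w : Sym[ℂ]^d (Fin (n + 1) → ℂ)) :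
    Integrable (fun y : Fin n → ℂ => covecPow d (affineCovector y) v
      * conj (covecPow d (affineCovector y) w)
      / (dualNormSq h.form (affineCovector y) : ℂ) ^ (n + d + 1)) ∧
    ∫ y : Fin n → ℂ, covecPow d (affineCovector y) v
      * conj (covecPow d (affineCovector y) w)
      / (dualNormSq h.form (affineCovector y) : ℂ) ^ (n + d + 1)
      = ((‖(Matrix.of fun k => b k : Matrix (Fin (n + 1)) (Fin (n + 1)) ℂ).det‖ ^ 2)⁻¹ : ℝ)
        * (Real.pi ^ n * d.factorial / (n + d).factorial) * symForm d h.form v w := by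
  obtain ⟨h1, h2⟩ := integral_covecPow_gaussian (d := d) hb v w
  have hQc : Continuous fun x : Fin (n + 1) → ℂ => dualNormSq h.form (coordCovector x) := by
    simp only [h.dualNormSq_eq_sum b hb]
    exact continuous_finsetSum _ fun i _ => ((continuous_coordCovector_apply _).norm).pow 2
  obtain ⟨h3, h4⟩ := integral_homogeneous_coordinates h1 (by
    have := continuous_covecPow_coordCovector v
    have := continuous_covecPow_coordCovector w
    fun_prop)
  -- By homogeneity the `t`-dependence is `|t|^{2(n+d)} exp(-Q |t|²)`, with `2d` from the two
  -- sections and `2n` from the Jacobian. Its integral is `π (n+d)! / Q^{n+d+1}`.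
  have key : ∀ y : Fin n → ℂ, ∫ t : ℂ, (‖t‖ ^ (2 * n) : ℝ) •
      (covecPow d (coordCovector (t • (Fin.cons 1 y : Fin (n + 1) → ℂ))) v
      * conj (covecPow d (coordCovector (t • (Fin.cons 1 y : Fin (n + 1) → ℂ))) w)
      * (Real.exp (-dualNormSq h.form (coordCovector (t • (Fin.cons 1 y : Fin (n + 1) → ℂ)))) : ℂ))
      = (Real.pi * (n + d).factorial : ℝ) * (covecPow d (affineCovector y) v
      * conj (covecPow d (affineCovector y) w)
      / (dualNormSq h.form (affineCovector y) : ℂ) ^ (n + d + 1)) := by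
    intro y
    have hpos := h.dualNormSq_pos (affineCovector_ne_zero y)
    have e : ∀ t : ℂ, (‖t‖ ^ (2 * n) : ℝ) •
      (covecPow d (coordCovector (t • (Fin.cons 1 y : Fin (n + 1) → ℂ))) v
      * conj (covecPow d (coordCovector (t • (Fin.cons 1 y : Fin (n + 1) → ℂ))) w)
      * (Real.exp (-dualNormSq h.form (coordCovector (t • (Fin.cons 1 y : Fin (n + 1) → ℂ)))) : ℂ))
      = covecPow d (affineCovector y) v * conj (covecPow d (affineCovector y) w) *
        ((‖t‖ ^ (2 * (n + d)) *
          Real.exp (-(dualNormSq h.form (affineCovector y) * ‖t‖ ^ 2)) : ℝ) : ℂ) := by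
      intro t
      rw [coordCovector_smul, ← affineCovector_eq, covecPow_smul, dualNormSq_smul,
        Complex.real_smul]
      have e1 : ((‖t‖ ^ (2 * (n + d)) : ℝ) : ℂ) = (‖t‖ ^ (2 * n) : ℝ) * (t ^ d * conj (t ^ d)) := by
        rw [Complex.mul_conj', norm_pow]
        push_cast
        ring
      rw [Complex.ofReal_mul, e1]
      simp only [LinearMap.smul_apply, smul_eq_mul, map_mul]
      rw [mul_comm (‖t‖ ^ 2)]
      ring
    simp only [e]
    rw [integral_const_mul, integral_complex_ofReal, integral_norm_pow_mul_gaussian _ hpos]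
    push_cast
    ring
  have hpi : ((Real.pi * (n + d).factorial : ℝ) : ℂ) ≠ 0 := by
    exact_mod_cast (mul_pos Real.pi_pos (by positivity)).ne'
  have h5 := h3.integral_prod_right
  simp only [key] at h5 h4
  constructor
  · have := h5.const_mul (((Real.pi * (n + d).factorial : ℝ) : ℂ)⁻¹)
    refine this.congr (Eventually.of_forall fun y => ?_)
    simp only
    rw [inv_mul_cancel_left₀ hpi]
  · rw [h2, integral_const_mul] at h4
    refine mul_left_cancel₀ hpi (h4.symm.trans ?_)
    push_cast
    have : ((n + d).factorial : ℂ) ≠ 0 := by exact_mod_cast (n + d).factorial_ne_zero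
    field_simp
    ring

end FibreIntegral

end

/-! ### The Fubini-Study volume form and the fibre constant -/

noncomputable section

open Filter Topology

section CurvatureMatrix

theorem dAnti_sum_dir {A B : Type*} [NormedAddCommGroup A] [NormedSpace ℂ A]
    [NormedAddCommGroup B] [NormedSpace ℂ B] (f : A → B) (p : A) {ι : Type*} (s : Finset ι)
    (c : ι → ℂ) (v : ι → A) :
    dAnti f p (∑ i ∈ s, c i • v i) = ∑ i ∈ s, conj (c i) • dAnti f p (v i) := by
  classical
  induction s using Finset.induction_on with
  | empty => simp [dAnti]
  | insert i s hi ih => rw [Finset.sum_insert hi, Finset.sum_insert hi, dAnti_add_dir,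
      dAnti_smul_dir, ih]

theorem dHol_sum_dir {A B : Type*} [NormedAddCommGroup A] [NormedSpace ℂ A]
    [NormedAddCommGroup B] [NormedSpace ℂ B] (f : A → B) (p : A) {ι : Type*} (s : Finset ι)
    (c : ι → ℂ) (v : ι → A) :
    dHol f p (∑ i ∈ s, c i • v i) = ∑ i ∈ s, c i • dHol f p (v i) := by
  classical
  induction s using Finset.induction_on with
  | empty => simp [dHol]
  | insert i s hi ih => rw [Finset.sum_insert hi, Finset.sum_insert hi, dHol_add_dir,
      dHol_smul_dir, ih]

/-- Expand the direction in the standard basis: `∂` is linear and `∂̄` conjugate-linear in it. The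
curvature matrix is thereby accessible through a single complex direction. -/
theorem matForm_curvMatrix {m : ℕ} {N : (Fin m → ℂ) → ℝ} {ζ : Fin m → ℂ}
    (hN : ContDiffAt ℝ 2 N ζ) (h0 : 0 < N ζ) (x : Fin m → ℂ) :
    matForm (curvMatrix N ζ) x x
      = -dHol (fun y => dAnti (fun x => (Real.log (N x) : ℂ)) y x) ζ x := by
  have hlog : ContDiffAt ℝ 2 (fun x => (Real.log (N x) : ℂ)) ζ :=
    Complex.ofRealCLM.contDiff.contDiffAt.comp ζ (hN.log h0.ne')
  have hx : x = ∑ a, x a • (Pi.single a 1 : Fin m → ℂ) := by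
    funext j
    simp [Pi.single_apply]
  have hd : ∀ b, DifferentiableAt ℝ (fun y => dAnti (fun x => (Real.log (N x) : ℂ)) y
      (Pi.single b 1)) ζ := fun b =>
    (hlog.dAnti (n := 1) (by norm_num) _).differentiableAt (by simp)
  have e1 : (fun y => dAnti (fun x => (Real.log (N x) : ℂ)) y x) = fun y =>
      ∑ b, conj (x b) * dAnti (fun x => (Real.log (N x) : ℂ)) y (Pi.single b 1) := by
    funext y
    conv_lhs => rw [hx, dAnti_sum_dir]
    rfl
  rw [e1, dHol_sum _ fun b _ => (hd b).const_mul _, matForm_apply, Finset.sum_comm,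
    ← Finset.sum_neg_distrib]
  refine Finset.sum_congr rfl fun b _ => ?_
  rw [dHol_const_mul _ (hd b)]
  have e2 := dHol_sum_dir (fun y => dAnti (fun x => (Real.log (N x) : ℂ)) y (Pi.single b 1)) ζ
    Finset.univ x fun a => Pi.single a 1
  rw [← hx] at e2
  rw [e2, Finset.mul_sum, ← Finset.sum_neg_distrib]
  refine Finset.sum_congr rfl fun a _ => ?_
  simp only [curvMatrix, Matrix.of_apply, smul_eq_mul]
  ring

theorem matrix_ext_matForm {m : ℕ} {M N : Matrix (Fin m) (Fin m) ℂ}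
    (h : ∀ x, matForm M x x = matForm N x x) : M = N := by
  ext a b
  rw [← matForm_single M, ← matForm_single N, SesqForm.ext_diag h]

end CurvatureMatrix

/-! ### The Fubini-Study volume form and the value of the constant. -/

section FibreConstant

variable {n d : ℕ} {h : HermitianMetric (Fin (n + 1) → ℂ)}
  {b : Module.Basis (Fin (n + 1)) ℂ (Fin (n + 1) → ℂ)}
  (hb : ∀ i j, h.form (b i) (b j) = if i = j then 1 else 0)

theorem affineCovector_apply (y : Fin n → ℂ) (v : Fin (n + 1) → ℂ) :
    affineCovector y v = v 0 + ∑ i, y i * v i.succ := by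
  rw [affineCovector_eq, coordCovector_apply, Fin.sum_univ_succ]
  simp

theorem differentiable_affineCovector (v : Fin (n + 1) → ℂ) :
    Differentiable ℂ fun y : Fin n → ℂ => affineCovector y v := by
  simp only [affineCovector_apply]
  fun_prop

theorem dHol_affineCovector (v : Fin (n + 1) → ℂ) (y x : Fin n → ℂ) :
    dHol (fun y : Fin n → ℂ => affineCovector y v) y x = ∑ i, x i * v i.succ := by
  rw [dHol_of_complex ((differentiable_affineCovector v) y)]
  let T : (Fin n → ℂ) →L[ℂ] ℂ := ∑ i, v i.succ • ContinuousLinearMap.proj i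
  have e : (fun y : Fin n → ℂ => affineCovector y v) = fun y => v 0 + T y := by
    funext y
    simp [affineCovector_apply, T, mul_comm]
  rw [e, fderiv_const_add, ContinuousLinearMap.fderiv]
  simp [T, mul_comm]

include hb in
theorem dualNormSq_affineCovector_eq :
    (fun y : Fin n → ℂ => (dualNormSq h.form (affineCovector y) : ℂ))
      = fun y => ∑ k, affineCovector y (b k) * conj (affineCovector y (b k)) := by
  funext y
  rw [h.dualNormSq_eq_sum b hb]
  simp only [Complex.mul_conj']
  push_cast
  rfl

include hb in
theorem contDiff_dualNormSq_affineCovector :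
    ContDiff ℝ ∞ fun y : Fin n → ℂ => dualNormSq h.form (affineCovector y) := by
  simp only [h.dualNormSq_eq_sum b hb, ← Complex.normSq_eq_norm_sq, Complex.normSq_apply]
  have : ∀ v : Fin (n + 1) → ℂ, ContDiff ℝ ∞ fun y : Fin n → ℂ => affineCovector y v := by
    intro v
    simp only [affineCovector_apply]
    fun_prop
  have h1 : ∀ v : Fin (n + 1) → ℂ, ContDiff ℝ ∞ fun y : Fin n → ℂ => (affineCovector y v).re :=
    fun v => Complex.reCLM.contDiff.comp (this v)
  have h2 : ∀ v : Fin (n + 1) → ℂ, ContDiff ℝ ∞ fun y : Fin n → ℂ => (affineCovector y v).im :=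
    fun v => Complex.imCLM.contDiff.comp (this v)
  exact ContDiff.sum fun i _ => ((h1 _).mul (h1 _)).add ((h2 _).mul (h2 _))

include hb in
-- In an orthonormal basis the dual norm is `∑ |F_k|²` with `F_k` affine in `y`. So only the
-- holomorphic first derivatives of the `F_k` survive in `∂∂̄ log`, and by polarization it suffices
-- to compare diagonal values.
theorem curvMatrix_fubiniStudy (y : Fin n → ℂ) :
    curvMatrix (fun y => 1 / dualNormSq h.form (affineCovector y)) y
      = Matrix.of fun i j : Fin n =>
        (∑ k, b k i.succ * conj (b k j.succ)) / (dualNormSq h.form (affineCovector y) : ℂ)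
        - (∑ k, b k i.succ * conj (affineCovector y (b k)))
          * (∑ k, affineCovector y (b k) * conj (b k j.succ))
          / (dualNormSq h.form (affineCovector y) : ℂ) ^ 2 := by
  refine matrix_ext_matForm fun x => ?_
  have hpos : ∀ y : Fin n → ℂ, 0 < dualNormSq h.form (affineCovector y) :=
    fun y => h.dualNormSq_pos (affineCovector_ne_zero y)
  have hcd : ContDiffAt ℝ 2 (fun y : Fin n → ℂ => dualNormSq h.form (affineCovector y)) y :=
    ((contDiff_dualNormSq_affineCovector hb).of_le ENat.LEInfty.out).contDiffAt
  have hlog : (fun y : Fin n → ℂ => (Real.log (1 / dualNormSq h.form (affineCovector y)) : ℂ))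
      = fun y => -1 * (Real.log (dualNormSq h.form (affineCovector y)) : ℂ) := by
    funext y
    simp [Real.log_inv]
  have hL : ∀ y : Fin n → ℂ, ContDiffAt ℝ 2 (fun y : Fin n → ℂ =>
      (Real.log (dualNormSq h.form (affineCovector y)) : ℂ)) y := fun y =>
    Complex.ofRealCLM.contDiff.contDiffAt.comp y
      (((contDiff_dualNormSq_affineCovector hb).of_le ENat.LEInfty.out).contDiffAt.log
        (hpos y).ne')
  have hinv : ContDiffAt ℝ 2 (fun y : Fin n → ℂ => 1 / dualNormSq h.form (affineCovector y)) y :=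
    contDiffAt_const.div hcd (hpos y).ne'
  rw [matForm_curvMatrix hinv (one_div_pos.2 (hpos y)), hlog]
  have e1 : (fun y : Fin n → ℂ => dAnti (fun y : Fin n → ℂ =>
      -1 * (Real.log (dualNormSq h.form (affineCovector y)) : ℂ)) y x)
      = fun y => -1 * dAnti (fun y : Fin n → ℂ =>
        (Real.log (dualNormSq h.form (affineCovector y)) : ℂ)) y x := by
    funext y
    rw [dAnti_const_mul _ ((hL y).differentiableAt (by simp))]
  rw [e1, dHol_const_mul _ (((hL y).dAnti (n := 1) (by norm_num) x).differentiableAt (by simp)),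
    neg_mul, neg_neg, one_mul, dHol_dAnti_log hcd (hpos y)]
  have hF : ∀ (k : Fin (n + 1)) (y : Fin n → ℂ),
      DifferentiableAt ℝ (fun y : Fin n → ℂ => affineCovector y (b k)) y :=
    fun k y => ((differentiable_affineCovector (b k)) y).restrictScalars ℝ
  let D : Fin (n + 1) → ℂ := fun k => ∑ i, x i * b k i.succ
  have e2 : ∀ y : Fin n → ℂ, dAnti (fun y : Fin n → ℂ =>
      (dualNormSq h.form (affineCovector y) : ℂ)) y x
      = ∑ k, affineCovector y (b k) * conj (D k) := by
    intro y
    rw [dualNormSq_affineCovector_eq hb, dAnti_sum _ fun k _ => (hF k y).fun_mul (hF k y).conj']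
    refine Finset.sum_congr rfl fun k _ => ?_
    rw [dAnti_mul (hF k y) (hF k y).conj', dAnti_conj (hF k y),
      dAnti_of_complex ((differentiable_affineCovector (b k)) y), dHol_affineCovector, zero_mul,
      zero_add]
  have e3 : dHol (fun y : Fin n → ℂ => ∑ k, affineCovector y (b k) * conj (D k)) y x
      = ∑ k, D k * conj (D k) := by
    rw [dHol_sum _ fun k _ => (hF k y).fun_mul (differentiableAt_const _)]
    refine Finset.sum_congr rfl fun k _ => ?_
    rw [dHol_mul (hF k y) (differentiableAt_const _), dHol_const, dHol_affineCovector, mul_zero,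
      add_zero]
  simp only [e2, e3]
  have e4 : matForm (Matrix.of fun i j : Fin n =>
        (∑ k, b k i.succ * conj (b k j.succ)) / (dualNormSq h.form (affineCovector y) : ℂ)
        - (∑ k, b k i.succ * conj (affineCovector y (b k)))
          * (∑ k, affineCovector y (b k) * conj (b k j.succ))
          / (dualNormSq h.form (affineCovector y) : ℂ) ^ 2) x x
      = (∑ i, ∑ j, ∑ k, (x i * b k i.succ) * conj (x j * b k j.succ))
          / (dualNormSq h.form (affineCovector y) : ℂ)
        - (∑ i, ∑ k, (x i * b k i.succ) * conj (affineCovector y (b k)))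
          * (∑ j, ∑ k, affineCovector y (b k) * conj (x j * b k j.succ))
          / (dualNormSq h.form (affineCovector y) : ℂ) ^ 2 := by
    rw [matForm_apply, Finset.sum_mul_sum, Finset.sum_div, Finset.sum_div,
      ← Finset.sum_sub_distrib]
    refine Finset.sum_congr rfl fun i _ => ?_
    rw [Finset.sum_div, Finset.sum_div, ← Finset.sum_sub_distrib]
    refine Finset.sum_congr rfl fun j _ => ?_
    have r1 : ∑ k, (x i * b k i.succ) * conj (x j * b k j.succ)
        = x i * conj (x j) * ∑ k, b k i.succ * conj (b k j.succ) := by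
      rw [Finset.mul_sum]
      exact Finset.sum_congr rfl fun k _ => by rw [map_mul]; ring
    have r2 : ∑ k, (x i * b k i.succ) * conj (affineCovector y (b k))
        = x i * ∑ k, b k i.succ * conj (affineCovector y (b k)) := by
      rw [Finset.mul_sum]
      exact Finset.sum_congr rfl fun k _ => by ring
    have r3 : ∑ k, affineCovector y (b k) * conj (x j * b k j.succ)
        = conj (x j) * ∑ k, affineCovector y (b k) * conj (b k j.succ) := by
      rw [Finset.mul_sum]
      exact Finset.sum_congr rfl fun k _ => by rw [map_mul]; ring
    rw [r1, r2, r3, Matrix.of_apply]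
    ring
  have e5 : ∑ k, D k * conj (D k)
      = ∑ i, ∑ j, ∑ k, (x i * b k i.succ) * conj (x j * b k j.succ) := by
    simp only [D, map_sum, Finset.sum_mul_sum]
    rw [Finset.sum_comm]
    exact Finset.sum_congr rfl fun i _ => Finset.sum_comm
  have e6 : ∑ k, affineCovector y (b k) * conj (D k)
      = ∑ j, ∑ k, affineCovector y (b k) * conj (x j * b k j.succ) := by
    simp only [D, map_sum, Finset.mul_sum]
    exact Finset.sum_comm
  have e7 : conj (∑ k, affineCovector y (b k) * conj (D k))
      = ∑ i, ∑ k, (x i * b k i.succ) * conj (affineCovector y (b k)) := by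
    simp only [D, map_sum, map_mul, Complex.conj_conj, Finset.mul_sum]
    rw [Finset.sum_comm]
    exact Finset.sum_congr rfl fun i _ => Finset.sum_congr rfl fun k _ => by ring
  rw [e4, ← e5, ← e6, ← e7, ← Complex.mul_conj']
  ring

include hb in
theorem volCoeff_fubiniStudy (y : Fin n → ℂ) :
    volCoeff (fun y => 1 / dualNormSq h.form (affineCovector y)) y
      = ((2 ^ n * ‖(Matrix.of fun k => b k : Matrix (Fin (n + 1)) (Fin (n + 1)) ℂ).det‖ ^ 2
        / dualNormSq h.form (affineCovector y) ^ (n + 1) : ℝ) : ℂ) := by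
  have hQ : (dualNormSq h.form (affineCovector y) : ℂ) ≠ 0 := by
    exact_mod_cast (h.dualNormSq_pos (affineCovector_ne_zero y)).ne'
  rw [volCoeff, curvMatrix_fubiniStudy hb]
  have := det_fubiniStudy (Matrix.of fun k => b k : Matrix (Fin (n + 1)) (Fin (n + 1)) ℂ) y
    (F := fun k => affineCovector y (b k)) (fun k => by
      rw [affineCovector_eq, coordCovector_apply]; rfl)
    (congrFun (dualNormSq_affineCovector_eq hb) y).symm hQ
  simp only [Matrix.of_apply] at this
  rw [this, Complex.mul_conj']
  push_cast
  ring

/-- The constant `C_{r,d}`, `r = n + 1`. -/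
def fibreConstant (n d : ℕ) : ℝ :=
  (2 * Real.pi * d) ^ n * d.factorial / (n + d).factorial

theorem fibreConstant_nonneg (n d : ℕ) : 0 ≤ fibreConstant n d := by
  unfold fibreConstant
  positivity

/-- The pairing contributes `Q^{-d}` and the volume form `Q^{-(n+1)}`, so the integrand is the one
of `integral_covecPow_affine`. The factor `‖det P‖²` in the density cancels its inverse in the
integral, and the dependence on `h` disappears from the constant. -/
theorem hatInner_mul_volCoeff_fubiniStudy (h : HermitianMetric (Fin (n + 1) → ℂ))
    (v w : Sym[ℂ]^d (Fin (n + 1) → ℂ)) :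
    Integrable (fun y : Fin n → ℂ => hatInner d (symForm d h.form) v w (affineCovector y) *
        volCoeff (fun y => 1 / dualNormSq h.form (affineCovector y)) y) ∧
    (d : ℂ) ^ n * ∫ y : Fin n → ℂ, hatInner d (symForm d h.form) v w (affineCovector y) *
        volCoeff (fun y => 1 / dualNormSq h.form (affineCovector y)) y
      = fibreConstant n d * symForm d h.form v w := by
  obtain ⟨b, hb⟩ := h.exists_orthonormal_basis_fin
  obtain ⟨h1, h2⟩ := integral_covecPow_affine (d := d) hb v w
  set P : ℂ := (Matrix.of fun k => b k : Matrix (Fin (n + 1)) (Fin (n + 1)) ℂ).det with hP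
  have hP0 : (‖P‖ : ℂ) ≠ 0 := by
    exact_mod_cast norm_ne_zero_iff.2 (basisMatrix_det_ne_zero b)
  have e : (fun y : Fin n → ℂ => hatInner d (symForm d h.form) v w (affineCovector y) *
        volCoeff (fun y => 1 / dualNormSq h.form (affineCovector y)) y)
      = fun y => (2 ^ n * ‖P‖ ^ 2 : ℂ) * (covecPow d (affineCovector y) v
      * conj (covecPow d (affineCovector y) w)
      / (dualNormSq h.form (affineCovector y) : ℂ) ^ (n + d + 1)) := by
    funext y
    have hQ : (dualNormSq h.form (affineCovector y) : ℂ) ≠ 0 := by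
      exact_mod_cast (h.dualNormSq_pos (affineCovector_ne_zero y)).ne'
    rw [volCoeff_fubiniStudy hb, hatInner, h.dualNormSq_sym]
    push_cast
    field_simp
    ring
  rw [e]
  refine ⟨h1.const_mul _, ?_⟩
  rw [integral_const_mul, h2, fibreConstant, mul_pow, mul_pow]
  push_cast
  field_simp

theorem isFibreConstant_fibreConstant (n d : ℕ) : IsFibreConstant n d (fibreConstant n d) :=
  fun h v w => (hatInner_mul_volCoeff_fubiniStudy h v w).2

end FibreConstant

end

/-! ### Mixed second derivatives and the pointwise norms -/

noncomputable section

open Filter Topology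

section SecondDerivatives

variable {A : Type*} [NormedAddCommGroup A] [NormedSpace ℂ A] {p : A}

theorem dHol_dAnti_comm {f : A → ℂ} (hf : ContDiffAt ℝ 2 f p) (v w : A) :
    dHol (fun y => dAnti f y v) p w = dAnti (fun y => dHol f y w) p v := by
  have hd : DifferentiableAt ℝ (fderiv ℝ f) p :=
    (hf.fderiv_right (m := 1) (by norm_num)).differentiableAt (by simp)
  have hs := (hf.isSymmSndFDerivAt (by simp)).eq
  have h1 : ∀ u x, fderiv ℝ (fun y => fderiv ℝ f y u) p x = fderiv ℝ (fderiv ℝ f) p x u := by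
    intro u x
    rw [fderiv_clm_apply hd (differentiableAt_const _)]
    simp
  have hdu : ∀ u, DifferentiableAt ℝ (fun y => fderiv ℝ f y u) p :=
    fun u => hd.clm_apply (differentiableAt_const _)
  have h2 : ∀ x, fderiv ℝ (fun y => dAnti f y v) p x = (1 / 2 : ℂ) •
      (fderiv ℝ (fderiv ℝ f) p x v + Complex.I • fderiv ℝ (fderiv ℝ f) p x (Complex.I • v)) := by
    intro x
    unfold dAnti
    rw [fderiv_fun_const_smul ((hdu _).fun_add ((hdu _).fun_const_smul _)),
      fderiv_fun_add (hdu _) ((hdu _).fun_const_smul _), fderiv_fun_const_smul (hdu _)]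
    simp [h1]
    ring
  have h3 : ∀ x, fderiv ℝ (fun y => dHol f y w) p x = (1 / 2 : ℂ) •
      (fderiv ℝ (fderiv ℝ f) p x w - Complex.I • fderiv ℝ (fderiv ℝ f) p x (Complex.I • w)) := by
    intro x
    unfold dHol
    rw [fderiv_fun_const_smul ((hdu _).fun_sub ((hdu _).fun_const_smul _)),
      fderiv_fun_sub (hdu _) ((hdu _).fun_const_smul _), fderiv_fun_const_smul (hdu _)]
    simp [h1]
  rw [dHol, dAnti, h2, h2, h3, h3, hs v w, hs v (Complex.I • w), hs (Complex.I • v) w,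
    hs (Complex.I • v) (Complex.I • w)]
  simp only [smul_eq_mul]
  ring

/-- Conjugation exchanges `∂` and `∂̄`, which commute by symmetry of the second derivative. Hence
taking the real part in the definition of `kahlerCoeff` loses nothing. -/
theorem dHol_dAnti_real {f : A → ℝ} (hf : ContDiffAt ℝ 2 f p) (v : A) :
    (((dHol (fun y => dAnti (fun x => (f x : ℂ)) y v) p v).re : ℝ) : ℂ)
      = dHol (fun y => dAnti (fun x => (f x : ℂ)) y v) p v := by
  have hc : ContDiffAt ℝ 2 (fun x => (f x : ℂ)) p :=
    Complex.ofRealCLM.contDiff.contDiffAt.comp p hf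
  rw [← Complex.conj_eq_iff_re]
  have hd := (hc.dAnti (n := 1) (by norm_num) v).differentiableAt (by simp)
  rw [← dAnti_conj hd, dHol_dAnti_comm hc]
  refine dAnti_congr ?_ v
  filter_upwards [hc.eventually (by simp)] with y hy
  rw [← dHol_conj (hy.differentiableAt (by simp))]
  simp

end SecondDerivatives

section Quotient

variable {n k : ℕ}

/-- The curvature form of `ν^k / Q`. -/
theorem matForm_curvMatrix_quotient {ν : ℂ → ℝ} {Q : (Fin (n + 1) → ℂ) → ℝ} {ζ : Fin (n + 1) → ℂ}
    (hν : ContDiffAt ℝ 2 ν (ζ 0)) (hν0 : 0 < ν (ζ 0)) (hQ : ContDiffAt ℝ 2 Q ζ) (hQ0 : 0 < Q ζ)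
    (a : Fin (n + 1) → ℂ) :
    matForm (curvMatrix (fun ζ => ν (ζ 0) ^ k / Q ζ) ζ) a a
      = k * (((-dHol (fun y => dAnti (fun x => (Real.log (ν x) : ℂ)) y 1) (ζ 0) 1).re : ℝ) : ℂ)
          * ‖a 0‖ ^ 2
        + dHol (fun y => dAnti (fun x => (Real.log (Q x) : ℂ)) y a) ζ a := by
  let pr : (Fin (n + 1) → ℂ) →L[ℂ] ℂ := ContinuousLinearMap.proj 0
  have hνζ : ContDiffAt ℝ 2 (fun ζ : Fin (n + 1) → ℂ => ν (ζ 0)) ζ :=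
    hν.comp ζ ((pr.restrictScalars ℝ).contDiff.contDiffAt)
  have hN : ContDiffAt ℝ 2 (fun ζ : Fin (n + 1) → ℂ => ν (ζ 0) ^ k / Q ζ) ζ :=
    (hνζ.pow k).div hQ hQ0.ne'
  rw [matForm_curvMatrix hN (by positivity)]
  have hlν : ContDiffAt ℝ 2 (fun z => Real.log (ν z)) (ζ 0) := hν.log hν0.ne'
  have hlνc : ContDiffAt ℝ 2 (fun z => (Real.log (ν z) : ℂ)) (ζ 0) :=
    Complex.ofRealCLM.contDiff.contDiffAt.comp _ hlν
  have hlQc : ContDiffAt ℝ 2 (fun z => (Real.log (Q z) : ℂ)) ζ :=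
    Complex.ofRealCLM.contDiff.contDiffAt.comp _ (hQ.log hQ0.ne')
  have hlνζ : ContDiffAt ℝ 2 (fun ζ : Fin (n + 1) → ℂ => (Real.log (ν (ζ 0)) : ℂ)) ζ :=
    hlνc.comp ζ ((pr.restrictScalars ℝ).contDiff.contDiffAt)
  have hev : ∀ᶠ x in 𝓝 ζ, (Real.log (ν (x 0) ^ k / Q x) : ℂ)
      = k * (Real.log (ν (x 0)) : ℂ) - (Real.log (Q x) : ℂ) := by
    filter_upwards [hνζ.continuousAt.eventually (lt_mem_nhds hν0),
      hQ.continuousAt.eventually (lt_mem_nhds hQ0)] with x h1 h2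
    rw [Real.log_div (pow_ne_zero _ h1.ne') h2.ne', Real.log_pow]
    push_cast
    rfl
  have h1 : (fun y => dAnti (fun x => (Real.log (ν (x 0) ^ k / Q x) : ℂ)) y a)
      =ᶠ[𝓝 ζ] fun y => k * dAnti (fun x : Fin (n + 1) → ℂ => (Real.log (ν (x 0)) : ℂ)) y a
        - dAnti (fun x => (Real.log (Q x) : ℂ)) y a := by
    filter_upwards [hev.eventually_nhds, hlνζ.eventually (by simp), hlQc.eventually (by simp)]
      with y h1 h2 h3
    rw [dAnti_congr h1, dAnti_sub ((h2.differentiableAt (by simp)).const_mul _)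
      (h3.differentiableAt (by simp)), dAnti_const_mul _ (h2.differentiableAt (by simp))]
  have hd1 := (hlνζ.dAnti (n := 1) (by norm_num) a).differentiableAt (by simp)
  have hd2 := (hlQc.dAnti (n := 1) (by norm_num) a).differentiableAt (by simp)
  rw [dHol_congr h1, dHol_sub (hd1.const_mul _) hd2, dHol_const_mul _ hd1]
  have h2 : (fun y => dAnti (fun x : Fin (n + 1) → ℂ => (Real.log (ν (x 0)) : ℂ)) y a)
      =ᶠ[𝓝 ζ] fun y => conj (a 0) * dAnti (fun x => (Real.log (ν x) : ℂ)) (pr y + 0) 1 := by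
    have : ∀ᶠ y in 𝓝 ζ, ContDiffAt ℝ 2 (fun z => (Real.log (ν z) : ℂ)) (pr y) :=
      pr.continuous.continuousAt.eventually (hlνc.eventually (by simp))
    filter_upwards [this] with y hy
    have e := dAnti_comp_affine pr 0 (F := fun x => (Real.log (ν x) : ℂ)) (p := y)
      (by simpa using hy.differentiableAt (by simp)) a
    rw [← smul_eq_mul, ← dAnti_smul_dir, smul_eq_mul, mul_one]
    simpa [pr] using e
  have hd3 := (hlνc.dAnti (n := 1) (by norm_num) 1).differentiableAt (by simp)
  have hp0 : pr ζ + 0 = ζ 0 := by simp [pr]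
  have e := dHol_comp_affine pr 0 (F := fun y => dAnti (fun x => (Real.log (ν x) : ℂ)) y 1)
    (p := ζ) (by rw [hp0]; exact hd3) a
  have hd4 : DifferentiableAt ℝ
      (fun y => dAnti (fun x => (Real.log (ν x) : ℂ)) (pr y + 0) 1) ζ := by
    have : DifferentiableAt ℝ (fun y => dAnti (fun x => (Real.log (ν x) : ℂ)) y 1) (pr ζ + 0) := by
      rw [hp0]
      exact hd3
    exact DifferentiableAt.comp ζ (f := fun y => pr y + 0)
      (g := fun y => dAnti (fun x => (Real.log (ν x) : ℂ)) y 1) this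
      (((pr.restrictScalars ℝ).differentiableAt).add_const _)
  rw [dHol_congr h2, dHol_const_mul _ hd4, e, show pr a = a 0 • (1 : ℂ) by simp [pr],
    dHol_smul_dir, Complex.neg_re, Complex.ofReal_neg, dHol_dAnti_real hlν, ← Complex.mul_conj',
    hp0, smul_eq_mul]
  ring

end Quotient

/-! ### Extracting pointwise bounds from the `C²` norm. -/

section FormNorm

variable {S : Type*} [AddCommGroup S] [Module ℂ S]

/-- The norm tests only vectors of the unit ball; sesquilinearity and normalization extend the bound
to all vectors. -/
theorem norm_le_of_formNorm_le {h : HermitianMetric S} {B : S → S → ℂ} (hB : IsSesq B) {c : ℝ}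
    (hc : 0 ≤ c) (hle : formNorm (fun u v => h.form u v) B ≤ ENNReal.ofReal c) (u v : S) :
    ‖B u v‖ ≤ c * √(h.form u u).re * √(h.form v v).re := by
  have key : ∀ u v, (h.form u u).re ≤ 1 → (h.form v v).re ≤ 1 → ‖B u v‖ ≤ c := by
    intro u v hu hv
    have h1 : ‖B u v‖ₑ ≤ ENNReal.ofReal c := by
      refine le_trans ?_ hle
      unfold formNorm
      refine le_iSup_of_le u (le_iSup_of_le v (le_iSup_of_le hu (le_iSup_of_le hv le_rfl)))
    rwa [← ofReal_norm, ENNReal.ofReal_le_ofReal_iff hc] at h1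
  by_cases hu : u = 0
  · subst hu
    rw [hB.zero_left, norm_zero]
    positivity
  by_cases hv : v = 0
  · subst hv
    have : B u 0 = 0 := by
      have := hB.smul_right 0 u 0
      simpa using this
    rw [this, norm_zero]
    positivity
  have hpu := Real.sqrt_pos.2 (h.pos u hu)
  have hpv := Real.sqrt_pos.2 (h.pos v hv)
  have hunit : ∀ w : S, w ≠ 0 → (h.form (((√(h.form w w).re)⁻¹ : ℝ) • (w : S))
      (((√(h.form w w).re)⁻¹ : ℝ) • w)).re ≤ 1 := by
    intro w hw
    have hp := h.pos w hw
    rw [← Complex.coe_smul, LinearMap.map_smul, LinearMap.smul_apply, LinearMap.map_smulₛₗ, Complex.conj_ofReal,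
      smul_eq_mul, smul_eq_mul, ← mul_assoc, ← Complex.ofReal_mul, Complex.re_ofReal_mul,
      ← mul_inv, Real.mul_self_sqrt hp.le, inv_mul_cancel₀ hp.ne']
  have := key _ _ (hunit u hu) (hunit v hv)
  rw [← Complex.coe_smul, ← Complex.coe_smul, hB.smul_left, hB.smul_right, Complex.conj_ofReal, norm_mul, norm_mul,
    Complex.norm_real, Complex.norm_real, norm_inv, norm_inv, Real.norm_of_nonneg hpu.le,
    Real.norm_of_nonneg hpv.le] at this
  calc ‖B u v‖ = √(h.form u u).re * √(h.form v v).re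
        * ((√(h.form u u).re)⁻¹ * ((√(h.form v v).re)⁻¹ * ‖B u v‖)) := by
        field_simp
    _ ≤ √(h.form u u).re * √(h.form v v).re * c := by gcongr
    _ = _ := by ring

/-- Of the seven terms of the norm, the curvature of the dual metric involves only four: `B`, its
two first covariant derivatives, and the mixed one `∇_z ∇_z̄ B`. The weights in `ρ` move to the
right-hand side. -/
theorem formNorm_le_of_C2NormAt_le {G B : ℂ → S → S → ℂ} {ρ : ℂ → ℝ} {z : ℂ} {e : ℝ}
    (hρ : 0 < ρ z) (hle : C2NormAt G ρ B z ≤ ENNReal.ofReal e) :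
    formNorm (G z) (B z) ≤ ENNReal.ofReal e ∧
    formNorm (G z) (covHol G B z) ≤ ENNReal.ofReal (e * √(ρ z)) ∧
    formNorm (G z) (covAnti G B z) ≤ ENNReal.ofReal (e * √(ρ z)) ∧
    formNorm (G z) (covHol G (covAnti G B) z) ≤ ENNReal.ofReal (e * ρ z) := by
  have hscale : ∀ {c : ℝ} {x : ENNReal}, 0 < c → ENNReal.ofReal c⁻¹ * x ≤ ENNReal.ofReal e →
      x ≤ ENNReal.ofReal (e * c) := by
    intro c x hc h
    rw [mul_comm e, ENNReal.ofReal_mul hc.le]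
    calc x = ENNReal.ofReal c * (ENNReal.ofReal c⁻¹ * x) := by
          rw [← mul_assoc, ← ENNReal.ofReal_mul hc.le, mul_inv_cancel₀ hc.ne', ENNReal.ofReal_one,
            one_mul]
      _ ≤ _ := by gcongr
  unfold C2NormAt at hle
  simp only at hle
  rw [mul_add, mul_add, mul_add, mul_add] at hle
  refine ⟨le_trans ?_ hle, hscale (Real.sqrt_pos.2 hρ) (le_trans ?_ hle),
    hscale (Real.sqrt_pos.2 hρ) (le_trans ?_ hle), hscale hρ (le_trans ?_ hle)⟩
  · rw [add_assoc]; exact le_self_add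
  · exact le_add_right (le_add_left le_self_add)
  · exact le_add_right (le_add_left le_add_self)
  · exact le_add_left (le_add_right le_add_self)

end FormNorm

section CovariantDerivative

variable {S : Type*} [AddCommGroup S] [Module ℂ S] [FiniteDimensional ℂ S]

/-- Sesquilinearity is not automatic, since `chernForm` is not linear by definition; near `p` it
agrees with the linear family `T`. It is what allows `formNorm` bounds to be applied to arbitrary
vectors. -/
theorem isSesq_covariantDerivatives {G B : ℂ → S → S → ℂ} {p : ℂ} {T : ℂ → S →ₗ[ℂ] S}
    (hB : ∀ᶠ z in 𝓝 p, IsSesq (B z)) (hBd : ∀ u v, ContDiffAt ℝ 2 (fun z => B z u v) p)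
    (hT : ∀ᶠ z in 𝓝 p, ∀ u, chernForm G z u = T z u)
    (hTd : ∀ (φ : S →ₗ[ℂ] ℂ) u, DifferentiableAt ℝ (fun z => φ (chernForm G z u)) p) :
    IsSesq (covHol G B p) ∧ IsSesq (covAnti G B p) ∧ IsSesq (covHol G (covAnti G B) p) := by
  let b := Module.finBasis ℂ S
  let _ : NormedAddCommGroup S := NormedAddCommGroup.induced S _ b.equivFun b.equivFun.injective
  let _ : NormedSpace ℂ S := NormedSpace.induced ℂ S _ b.equivFun
  have hTd' : ∀ u, DifferentiableAt ℝ (fun z => chernForm G z u) p := by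
    intro u
    have : (fun z => chernForm G z u) = fun z => ∑ i, b.coord i (chernForm G z u) • b i := by
      funext z; exact (b.sum_repr _).symm
    rw [this]
    exact DifferentiableAt.fun_sum fun i _ => (hTd _ _).smul_const _
  have hBev := eventually_contDiffAt_sesq hB hBd
  have hTl : ∀ {z : ℂ} {k : S → S → ℂ}, IsSesq k → (∀ u, chernForm G z u = T z u) →
      IsSesq (fun u v => k (chernForm G z u) v) := by
    rintro z k ⟨F, hF⟩ h
    exact ⟨F.comp (T z), fun u v => by simp only [hF, h]; rfl⟩
  have hTr : ∀ {z : ℂ} {k : S → S → ℂ}, IsSesq k → (∀ u, chernForm G z u = T z u) →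
      IsSesq (fun u v => k u (chernForm G z v)) := by
    rintro z k ⟨F, hF⟩ h
    exact ⟨F.compl₂ (T z), fun u v => by simp only [hF, h]; rfl⟩
  have hanti : ∀ᶠ z in 𝓝 p, IsSesq (covAnti G B z) := by
    filter_upwards [hB.eventually_nhds, hBev, hT] with z h1 h2 h3
    exact (IsSesq.dAnti_family h1 (fun u v => (h2 u v).differentiableAt (by simp)) 1).sub
      (hTr h1.self_of_nhds h3)
  have hd : ∀ u v, DifferentiableAt ℝ (fun z => covAnti G B z u v) p := by
    intro u v
    refine (((hBd u v).dAnti (n := 1) (by norm_num) 1).differentiableAt (by simp)).fun_sub ?_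
    exact DifferentiableAt.sesq hB (fun u v => (hBd u v).differentiableAt (by simp))
      (differentiableAt_const u) (hTd' v)
  exact ⟨(IsSesq.dHol_family hB (fun u v => (hBd u v).differentiableAt (by simp)) 1).sub
    (hTl hB.self_of_nhds hT.self_of_nhds), hanti.self_of_nhds,
    (IsSesq.dHol_family hanti hd 1).sub (hTl hanti.self_of_nhds hT.self_of_nhds)⟩

end CovariantDerivative

end

/-! ### Curvature in a chart -/

noncomputable section

open Filter Topology

section PerturbationForms

variable {S : Type*} [AddCommGroup S] [Module ℂ S] {h K : HermitianMetric S} {e : ℝ}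
  (he : 0 ≤ e) (he2 : e ≤ 1 / 2)
  (hB : ∀ x y, ‖K.form x y - h.form x y‖ ≤ e * √(h.form x x).re * √(h.form y y).re)
  {u₀ u : S} (hu : ∀ v, K.form v u = h.form v u₀)

include he he2 hB hu

/-- `riesz_sq_sub_le` and `riesz_sq_ge` for Hermitian metrics on a space without a chosen norm. -/
theorem HermitianMetric.riesz_perturbation :
    |(K.form u u).re - (h.form u₀ u₀).re| ≤ 2 * e * (h.form u₀ u₀).re ∧
      (h.form u₀ u₀).re ≤ 5 * (K.form u u).re := by
  let _ : NormedAddCommGroup S := h.core.toNormedAddCommGroup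
  let _ : InnerProductSpace ℂ S := InnerProductSpace.ofCore h.core.toCore
  have hn : ∀ x : S, ‖x‖ = √(h.form x x).re := fun _ => rfl
  have hsq : ∀ x : S, ‖x‖ ^ 2 = (h.form x x).re := fun x => by
    rw [hn, Real.sq_sqrt (h.re_self_nonneg x)]
  have hi : ∀ x y : S, inner ℂ y x = h.form x y := fun _ _ => rfl
  have hK : ∀ x y, K.form x y = inner ℂ y x + (K.form - h.form) x y := by
    intro x y
    rw [hi, LinearMap.sub_apply, LinearMap.sub_apply]
    ring
  have hB' : ∀ x y, ‖(K.form - h.form) x y‖ ≤ e * ‖x‖ * ‖y‖ := by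
    intro x y
    rw [LinearMap.sub_apply, LinearMap.sub_apply, hn, hn]
    exact hB x y
  have hu' : ∀ v, K.form v u = inner ℂ u₀ v := fun v => by rw [hi, hu]
  have h1 := riesz_sq_sub_le hK he he2 hB' hu'
  have h2 := riesz_sq_ge hK he he2 hB' hu'
  rw [K.self_eq_ofReal] at h1 h2
  rw [← Complex.ofReal_pow, ← Complex.ofReal_sub, Complex.norm_real, Real.norm_eq_abs, hsq] at h1
  rw [Complex.norm_real, Real.norm_of_nonneg (K.re_self_nonneg u), hsq] at h2
  exact ⟨h1, h2⟩

/-- `curvature_perturbation` for Hermitian metrics on a space without a chosen norm. -/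
theorem HermitianMetric.curvature_perturbation {σ : ℝ} (hσ : 0 ≤ σ) {w₀ w₁ w₂ : S}
    {β₁ β₂ : S → ℂ} {β : ℂ} (hu₀ : u₀ ≠ 0)
    (hw₁ : ∀ v, K.form v w₁ = h.form v w₀ - β₁ v)
    (hβ₁ : ∀ v, ‖β₁ v‖ ≤ e * σ * √(h.form v v).re * √(h.form u u).re)
    (hw₂ : ∀ v, K.form v w₂ = β₂ v)
    (hβ₂ : ∀ v, ‖β₂ v‖ ≤ e * σ * √(h.form v v).re * √(h.form u u).re)
    (hβ : ‖β‖ ≤ e * σ ^ 2 * (h.form u u).re) (hQ0 : 0 < (K.form u u).re) :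
    ‖(K.form w₁ w₁ + K.form w₂ w₂ - β) / ((K.form u u).re : ℂ)
        - ‖K.form u w₁‖ ^ 2 / ((K.form u u).re : ℂ) ^ 2
        - (((h.form w₀ w₀).re / (h.form u₀ u₀).re
            - ‖h.form u₀ w₀‖ ^ 2 / (h.form u₀ u₀).re ^ 2 : ℝ) : ℂ)‖
      ≤ 480 * e * ((h.form w₀ w₀).re / (h.form u₀ u₀).re
            - ‖h.form u₀ w₀‖ ^ 2 / (h.form u₀ u₀).re ^ 2 + σ ^ 2) := by
  let _ : NormedAddCommGroup S := h.core.toNormedAddCommGroup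
  let _ : InnerProductSpace ℂ S := InnerProductSpace.ofCore h.core.toCore
  have hn : ∀ x : S, ‖x‖ = √(h.form x x).re := fun _ => rfl
  have hsq : ∀ x : S, ‖x‖ ^ 2 = (h.form x x).re := fun x => by
    rw [hn, Real.sq_sqrt (h.re_self_nonneg x)]
  have hi : ∀ x y : S, inner ℂ y x = h.form x y := fun _ _ => rfl
  have hK : ∀ x y, K.form x y = inner ℂ y x + (K.form - h.form) x y := by
    intro x y
    rw [hi, LinearMap.sub_apply, LinearMap.sub_apply]
    ring
  have hB' : ∀ x y, ‖(K.form - h.form) x y‖ ≤ e * ‖x‖ * ‖y‖ := by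
    intro x y
    rw [LinearMap.sub_apply, LinearMap.sub_apply, hn, hn]
    exact hB x y
  have h1 := _root_.curvature_perturbation (u₀ := u₀) (w₀ := w₀) hK K.conj_symm he he2 hσ hB'
    (fun v => by rw [hi, hu])
    hu₀ (K.self_eq_ofReal u) (fun v => by rw [hi, hw₁]) (by simpa only [hn] using hβ₁) hw₂
    (by simpa only [hn] using hβ₂) (by rw [hsq]; exact hβ) hQ0
  have h2 := h1.2
  have hsym : ‖(inner ℂ u₀ w₀ : ℂ)‖ = ‖h.form u₀ w₀‖ := by
    rw [hi, ← h.conj_symm, RCLike.norm_conj]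
  rw [hsq, hsq, hsym] at h2
  exact h2

end PerturbationForms

/-! ### Local Hermitian-Einstein data in a chart. -/

section Chart

variable {n d k : ℕ} {μ : ℝ} {G : ℂ → SesqForm (Fin (n + 1) → ℂ)} {ν : ℂ → ℝ} {z₀ : ℂ}

/-- The coefficient of `i ∂̄∂ log ν`. -/
def logCurvature (ν : ℂ → ℝ) (z : ℂ) : ℝ :=
  (-dHol (fun y => dAnti (fun x => (Real.log (ν x) : ℂ)) y 1) z 1).re

/-- Near `z₀`, `G` is a Hermitian metric and `ν` a weight with positive curvature at `z₀`, and `G`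
satisfies the Hermitian-Einstein equation at `z₀`. -/
structure IsEinsteinChart (μ : ℝ) (G : ℂ → SesqForm (Fin (n + 1) → ℂ)) (ν : ℂ → ℝ) (z₀ : ℂ) :
    Prop where
  metric : ∀ᶠ z in 𝓝 z₀, ∃ h : HermitianMetric (Fin (n + 1) → ℂ), h.form = G z
  contDiff : ∀ u v, ContDiffAt ℝ 2 (fun z => G z u v) z₀
  weight : ContDiffAt ℝ 2 ν z₀
  weight_pos : 0 < ν z₀
  curvature_pos : 0 < logCurvature ν z₀
  einstein : ∀ u, -dAnti (fun y => chernForm (fun z u v => G z u v) y u) z₀ 1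
    = ((μ * logCurvature ν z₀ : ℝ) : ℂ) • u

/-- Near `z₀`, `K` is a Hermitian metric. -/
structure IsMetricChart {S : Type*} [AddCommGroup S] [Module ℂ S] (K : ℂ → SesqForm S) (z₀ : ℂ) :
    Prop where
  metric : ∀ᶠ z in 𝓝 z₀, ∃ h : HermitianMetric S, h.form = K z
  contDiff : ∀ u v, ContDiffAt ℝ 2 (fun z => K z u v) z₀

theorem IsEinsteinChart.isMetricChart_sym (hG : IsEinsteinChart μ G ν z₀) :
    IsMetricChart (fun z => symForm d (G z)) z₀ where
  metric := hG.metric.mono fun _ ⟨h, hh⟩ => ⟨h.sym d, by rw [← hh]; rfl⟩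
  contDiff := symForm_contDiffAt d hG.contDiff

/-- The Chern connection of `Sym^d` and its curvature. -/
theorem IsEinsteinChart.exists_chernForm_sym (hG : IsEinsteinChart μ G ν z₀) (d : ℕ) :
    ∃ T : ℂ → (Fin (n + 1) → ℂ) →ₗ[ℂ] (Fin (n + 1) → ℂ),
      (∀ᶠ z in 𝓝 z₀, ∀ s, chernForm (fun z s t => symForm d (G z) s t) z s = symDeriv d (T z) s ∧
        ∀ t, symForm d (G z) (symDeriv d (T z) s) t
          = dHol (fun y => symForm d (G y) s t) z 1) ∧
      ∀ (φ : Sym[ℂ]^d (Fin (n + 1) → ℂ) →ₗ[ℂ] ℂ) s,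
        DifferentiableAt ℝ (fun z => φ (chernForm (fun z s t => symForm d (G z) s t) z s)) z₀ ∧
        dAnti (fun z => φ (chernForm (fun z s t => symForm d (G z) s t) z s)) z₀ 1
          = -((d * μ * logCurvature ν z₀ : ℝ) : ℂ) * φ s := by
  have hm : ∀ᶠ z in 𝓝 z₀, IsMetric fun u v => G z u v :=
    hG.metric.mono fun z ⟨h, hh⟩ => ⟨h, fun u v => by rw [hh]⟩
  obtain ⟨T, hTd, hT⟩ := exists_chernForm hm hG.contDiff
  have hev := eventually_contDiffAt_sesq (hm.mono fun _ h => h.isSesq) hG.contDiff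
  have hsym : ∀ᶠ z in 𝓝 z₀, ∀ s, chernForm (fun z s t => symForm d (G z) s t) z s
      = symDeriv d (T z) s ∧ ∀ t, symForm d (G z) (symDeriv d (T z) s) t
          = dHol (fun y => symForm d (G y) s t) z 1 := by
    filter_upwards [hT, hev, (hG.isMetricChart_sym (d := d)).metric] with z h1 h2 h3 s
    have h4 : ∀ t, symForm d (G z) (symDeriv d (T z) s) t
          = dHol (fun y => symForm d (G y) s t) z 1 := by
      intro t
      rw [dHol_symForm d (fun u v => (h2 u v).of_le (by norm_num)) (T := T z)
        (fun u v => ((h1 u).2 v).symm)]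
    obtain ⟨h, hh⟩ := h3
    exact ⟨chernForm_eq ⟨h, fun u v => by rw [hh]⟩ h4, h4⟩
  refine ⟨T, hsym, fun φ s => ?_⟩
  -- In this form the Einstein equation says that `∂̄` of the connection form is the scalar `-μρ`;
  -- passing to the induced derivation multiplies it by `d`.
  have hc : ∀ u, dAnti (fun z => T z u) z₀ 1 = (-((μ * logCurvature ν z₀ : ℝ) : ℂ)) • u := by
    intro u
    rw [neg_smul, ← hG.einstein u, neg_neg]
    exact dAnti_congr (hT.mono fun z hz => ((hz u).1).symm) 1
  obtain ⟨h1, h2⟩ := symDeriv_family d (fun u => (hTd u).differentiableAt (by simp)) hc φ s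
  have hE : (fun z => φ (chernForm (fun z s t => symForm d (G z) s t) z s))
      =ᶠ[𝓝 z₀] fun z => φ (symDeriv d (T z) s) := hsym.mono fun z hz => by
        simp only [(hz s).1]
  refine ⟨h1.congr_of_eventuallyEq hE, ?_⟩
  rw [dAnti_congr hE, h2]
  push_cast
  ring

/-- The functional `f^{⊗ d}`, `f` the covector with affine coordinates `ζ 1, …, ζ n`. -/
def affinePower (d : ℕ) (ζ : Fin (n + 1) → ℂ) : Sym[ℂ]^d (Fin (n + 1) → ℂ) →ₗ[ℂ] ℂ :=
  covecPow d (affineCovector (Fin.tail ζ))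

theorem affinePower_ne_zero (ζ : Fin (n + 1) → ℂ) : affinePower d ζ ≠ 0 := by
  intro h
  have h1 := LinearMap.congr_fun h (SymmetricPower.tprod ℂ fun _ => Pi.single 0 1)
  rw [affinePower, covecPow_tprod] at h1
  simp [affineCovector_apply] at h1

theorem differentiable_affineCovector_tail (v : Fin (n + 1) → ℂ) :
    Differentiable ℂ fun ζ : Fin (n + 1) → ℂ => affineCovector (Fin.tail ζ) v := by
  simp only [affineCovector_apply, Fin.tail]
  fun_prop

theorem contDiff_affinePower {m : WithTop ℕ∞} (s : Sym[ℂ]^d (Fin (n + 1) → ℂ)) :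
    ContDiff ℂ m fun ζ : Fin (n + 1) → ℂ => affinePower d ζ s := by
  induction s using sym_induction with
  | ht v =>
    simp only [affinePower, covecPow_tprod, affineCovector_apply, Fin.tail]
    fun_prop
  | h0 => simpa using contDiff_const
  | ha s t hs ht =>
    simp only [map_add]
    exact hs.add ht
  | hs c s hs =>
    simp only [map_smul, smul_eq_mul]
    exact contDiff_const.mul hs

/-- `mixed_hessian_log` for the dual norm of `f^{⊗ d}`. -/
theorem IsEinsteinChart.mixed_hessian_log (hG : IsEinsteinChart μ G ν z₀)
    {K : ℂ → SesqForm (Sym[ℂ]^d (Fin (n + 1) → ℂ))} (hK : IsMetricChart K z₀)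
    {B : ℂ → Sym[ℂ]^d (Fin (n + 1) → ℂ) → Sym[ℂ]^d (Fin (n + 1) → ℂ) → ℂ}
    (hKB : ∀ z u v, K z u v = symForm d (G z) u v + B z u v) {ζ : Fin (n + 1) → ℂ} (hζ : ζ 0 = z₀)
    (a : Fin (n + 1) → ℂ) :
    0 < dualNormSq (K z₀) (affinePower d ζ) ∧
    ContDiffAt ℝ 2 (fun ζ => dualNormSq (K (ζ 0)) (affinePower d ζ)) ζ ∧
    ∃ u w₁ w₂, (∀ v, K z₀ v u = affinePower d ζ v) ∧
      (∀ v, K z₀ v w₁ = dHol (fun ζ => affinePower d ζ v) ζ a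
        - a 0 * affinePower d ζ (chernForm (fun z s t => symForm d (G z) s t) z₀ v)
        - a 0 * covHol (fun z s t => symForm d (G z) s t) B z₀ v u) ∧
      (∀ v, K z₀ v w₂
        = conj (a 0) * covAnti (fun z s t => symForm d (G z) s t) B z₀ v u) ∧
      dHol (fun y => dAnti (fun x =>
          (Real.log (dualNormSq (K (x 0)) (affinePower d x)) : ℂ)) y a) ζ a
        = ((d * μ * logCurvature ν z₀ : ℝ) : ℂ) * ‖a 0‖ ^ 2 + (K z₀ w₁ w₁ + K z₀ w₂ w₂
          - ‖a 0‖ ^ 2 * covHol (fun z s t => symForm d (G z) s t)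
            (covAnti (fun z s t => symForm d (G z) s t) B) z₀ u u)
              / dualNormSq (K z₀) (affinePower d ζ)
          - ‖K z₀ u w₁‖ ^ 2 / (dualNormSq (K z₀) (affinePower d ζ) : ℂ) ^ 2 := by
  subst hζ
  obtain ⟨T, hT, hTκ⟩ := hG.exists_chernForm_sym d
  have hS := hG.isMetricChart_sym (d := d)
  let pr : (Fin (n + 1) → ℂ) →L[ℂ] ℂ := ContinuousLinearMap.proj 0
  have hq0 : 0 < dualNormSq (K (ζ 0)) (affinePower d ζ) := by
    obtain ⟨h, hh⟩ := hK.metric.self_of_nhds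
    rw [← hh]
    exact h.dualNormSq_pos (affinePower_ne_zero ζ)
  obtain ⟨u, w₁, w₂, h1, h2, h3, h4, h5⟩ := mixed_hessian_log_of_finiteDimensional
    (G := fun z s t => symForm d (G z) s t) (B := B) (pr := pr) (p := ζ) (a := a)
    (κ := d * μ * logCurvature ν (ζ 0)) (Φ := fun ζ v => affinePower d ζ v)
    (q := fun ζ => dualNormSq (K (ζ 0)) (affinePower d ζ))
    (hS.metric.mono fun z ⟨h, hh⟩ => ⟨h, fun u v => by rw [hh]⟩)
    (hK.metric.mono fun z ⟨h, hh⟩ => ⟨h, fun u v => by rw [hh, hKB]⟩)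
    hS.contDiff
    (fun u v => by
      have : (fun z => B z u v) = fun z => K z u v - symForm d (G z) u v := by
        funext z; rw [hKB]; ring
      rw [this]
      exact (hK.contDiff u v).sub (hS.contDiff u v))
    (fun φ u => (hTκ φ u).1)
    (hT.mono fun z hz u v => by rw [(hz u).1]; exact (hz u).2 v)
    (fun φ u => (hTκ φ u).2)
    (fun ζ => ⟨_, fun v => rfl⟩)
    (fun v => (contDiff_affinePower v).contDiffAt)
    (by
      have : ∀ᶠ x in 𝓝 ζ, ∃ h : HermitianMetric _, h.form = K (x 0) :=
        pr.continuous.continuousAt.eventually hK.metric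
      filter_upwards [this] with x ⟨h, hh⟩ u hu
      rw [← hKB, ← hh, h.dualNormSq_eq (u := u), ← h.self_eq_ofReal]
      · exact congrArg (fun A : SesqForm _ => A u u) hh.symm
      · intro v
        rw [← hu v, ← hKB]
        exact congrArg (fun A : SesqForm _ => A v u) hh)
    hq0
  refine ⟨hq0, h4, u, w₁, w₂, fun v => (hKB _ _ _).trans (h1 v), fun v => (hKB _ _ _).trans (h2 v),
    fun v => (hKB _ _ _).trans (h3 v), ?_⟩
  rw [h5, hKB, hKB, hKB]
  rfl

end Chart

end

/-! ### The curvature matrix of the induced metric -/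

noncomputable section

open Filter Topology

section ChartVolume

variable {n d k : ℕ} {μ : ℝ} {G : ℂ → SesqForm (Fin (n + 1) → ℂ)} {ν : ℂ → ℝ} {z₀ : ℂ}

theorem HermitianMetric.norm_form_sq_le {S : Type*} [AddCommGroup S] [Module ℂ S]
    (h : HermitianMetric S) (u v : S) :
    ‖h.form u v‖ ^ 2 ≤ (h.form u u).re * (h.form v v).re := by
  have h1 := h.norm_form_le u v
  calc ‖h.form u v‖ ^ 2 ≤ (√(h.form u u).re * √(h.form v v).re) ^ 2 := by gcongr
    _ = _ := by rw [mul_pow, Real.sq_sqrt (h.re_self_nonneg u), Real.sq_sqrt (h.re_self_nonneg v)]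

/-- The squared norm of the frame of `𝒪(d) ⊗ L^k` in affine coordinates. -/
def affineNormSq (d k : ℕ) (K : ℂ → SesqForm (Sym[ℂ]^d (Fin (n + 1) → ℂ))) (ν : ℂ → ℝ)
    (ζ : Fin (n + 1) → ℂ) : ℝ :=
  ν (ζ 0) ^ k / dualNormSq (K (ζ 0)) (affinePower d ζ)

/-- The Hessian formula with `B = 0` has `w₂ = 0` and curvature `d μ ρ`, to which the weight adds `k
ρ`. The remaining term is the Fubini-Study part, nonnegative by Cauchy-Schwarz. -/
theorem IsEinsteinChart.matForm_curvMatrix (hG : IsEinsteinChart μ G ν z₀)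
    {ζ : Fin (n + 1) → ℂ} (hζ : ζ 0 = z₀) {h : HermitianMetric (Sym[ℂ]^d (Fin (n + 1) → ℂ))}
    (hh : h.form = symForm d (G z₀)) (a : Fin (n + 1) → ℂ) :
    ∃ u w, (∀ v, h.form v u = affinePower d ζ v) ∧
      (∀ v, h.form v w = dHol (fun ζ => affinePower d ζ v) ζ a
        - a 0 * affinePower d ζ (chernForm (fun z s t => symForm d (G z) s t) z₀ v)) ∧
      matForm (curvMatrix (affineNormSq d k (fun z => symForm d (G z)) ν) ζ) a a
        = (((d * μ + k) * logCurvature ν z₀ * ‖a 0‖ ^ 2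
          + ((h.form w w).re / (h.form u u).re
            - ‖h.form u w‖ ^ 2 / (h.form u u).re ^ 2) : ℝ) : ℂ) ∧
      0 ≤ (h.form w w).re / (h.form u u).re - ‖h.form u w‖ ^ 2 / (h.form u u).re ^ 2 := by
  obtain ⟨hq0, hq, u, w, w₂, h1, h2, h3, h4⟩ := hG.mixed_hessian_log (d := d)
    hG.isMetricChart_sym (B := fun _ _ _ => 0) (fun _ _ _ => (add_zero _).symm) hζ a
  have hcA : covAnti (fun z s t => symForm d (G z) s t) (fun _ _ _ => 0) = fun _ _ _ => 0 := by
    funext z u v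
    simp [covAnti]
  have hcH : covHol (fun z s t => symForm d (G z) s t) (fun _ _ _ => 0) = fun _ _ _ => 0 := by
    funext z u v
    simp [covHol]
  simp only [hcA, hcH, mul_zero, sub_zero] at h2 h3 h4
  rw [← hh] at h1 h2 h3 h4 hq0
  have hw₂ : w₂ = 0 := h.ext_right fun v => by rw [h3, map_zero]
  have hQ : dualNormSq h.form (affinePower d ζ) = (h.form u u).re := h.dualNormSq_eq h1
  rw [hw₂, map_zero, add_zero, hQ] at h4
  rw [hQ] at hq0
  refine ⟨u, w, h1, h2, ?_, ?_⟩
  · subst hζ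
    have hq0' : 0 < dualNormSq (symForm d (G (ζ 0))) (affinePower d ζ) := by
      rw [← hh, hQ]; exact hq0
    have := matForm_curvMatrix_quotient (k := k) hG.weight hG.weight_pos hq hq0' a
    rw [show affineNormSq d k (fun z => symForm d (G z)) ν = fun ζ => ν (ζ 0) ^ k /
      dualNormSq (symForm d (G (ζ 0))) (affinePower d ζ) from rfl, this, h4, h.self_eq_ofReal w]
    unfold logCurvature
    simp only [Complex.ofReal_re]
    push_cast
    ring
  · rw [sub_nonneg, div_le_div_iff₀ (by positivity) hq0]
    have := h.norm_form_sq_le u w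
    nlinarith [mul_le_mul_of_nonneg_right this hq0.le]

/-- The weight and the scalar curvature cancel in the difference, leaving what
`curvature_perturbation` bounds by `480 e (q₀ + ρ |a₀|²)`. The lower bound `1/(n+1)` on `dμ + k` is
needed precisely here, to dominate `ρ |a₀|²` by `n + 1` times the horizontal part; elsewhere
positivity suffices. -/
theorem IsEinsteinChart.matForm_curvMatrix_sub_le (hG : IsEinsteinChart μ G ν z₀)
    (hlam : 1 / ((n : ℝ) + 1) ≤ d * μ + k)
    {K : ℂ → SesqForm (Sym[ℂ]^d (Fin (n + 1) → ℂ))} (hK : IsMetricChart K z₀) {e : ℝ}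
    (he : 0 ≤ e) (he2 : e ≤ 1 / 2)
    (hC : C2NormAt (fun z s t => symForm d (G z) s t) (logCurvature ν)
      (fun z s t => (K z - symForm d (G z)) s t) z₀ ≤ ENNReal.ofReal e)
    {ζ : Fin (n + 1) → ℂ} (hζ : ζ 0 = z₀) (a : Fin (n + 1) → ℂ) :
    (matForm (curvMatrix (affineNormSq d k (fun z => symForm d (G z)) ν) ζ) a a).im = 0 ∧
    0 ≤ (matForm (curvMatrix (affineNormSq d k (fun z => symForm d (G z)) ν) ζ) a a).re ∧
    ‖matForm (curvMatrix (affineNormSq d k K ν) ζ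
        - curvMatrix (affineNormSq d k (fun z => symForm d (G z)) ν) ζ) a a‖
      ≤ 480 * (n + 1) * e
        * (matForm (curvMatrix (affineNormSq d k (fun z => symForm d (G z)) ν) ζ) a a).re := by
  have hρ := hG.curvature_pos
  obtain ⟨h, hh⟩ := (hG.isMetricChart_sym (d := d)).metric.self_of_nhds
  obtain ⟨hK', hhK⟩ := hK.metric.self_of_nhds
  obtain ⟨u₀, w₀, hu₀, hw₀, hM, hq0⟩ := hG.matForm_curvMatrix (k := k) hζ hh a
  obtain ⟨hQ, hQd, u, w₁, w₂, hu, hw₁, hw₂, hlog⟩ := hG.mixed_hessian_log (d := d) hK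
    (B := fun z s t => (K z - symForm d (G z)) s t)
    (fun _ _ _ => by rw [LinearMap.sub_apply, LinearMap.sub_apply]; ring) hζ a
  obtain ⟨T, hT, hTκ⟩ := hG.exists_chernForm_sym d
  obtain ⟨s1, s2, s3⟩ := isSesq_covariantDerivatives (G := fun z s t => symForm d (G z) s t)
    (B := fun z s t => (K z - symForm d (G z)) s t) (p := z₀) (T := fun z => symDeriv d (T z))
    (Eventually.of_forall fun z => SesqForm.isSesq _)
    (fun u v => by
      simp only [LinearMap.sub_apply]
      exact (hK.contDiff u v).sub (hG.isMetricChart_sym.contDiff u v))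
    (hT.mono fun z hz u => (hz u).1) (fun φ u => (hTκ φ u).1)
  obtain ⟨c0, c1, c2, c3⟩ := formNorm_le_of_C2NormAt_le hρ hC
  rw [← hhK] at hu hw₁ hw₂ hlog
  have hform : ∀ u v, symForm d (G z₀) u v = h.form u v := fun u v => by rw [hh]
  simp only [hform] at c0 c1 c2 c3
  have b0 := norm_le_of_formNorm_le (SesqForm.isSesq _) he c0
  have b1 := norm_le_of_formNorm_le s1 (by positivity) c1
  have b2 := norm_le_of_formNorm_le s2 (by positivity) c2
  have b3 := norm_le_of_formNorm_le s3 (by positivity) c3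
  have hQ' : dualNormSq (K z₀) (affinePower d ζ) = (hK'.form u u).re := by
    rw [← hhK]; exact hK'.dualNormSq_eq hu
  rw [hQ'] at hQ
  rw [hK'.dualNormSq_eq hu] at hlog
  have hu₀0 : u₀ ≠ 0 := by
    rintro rfl
    exact affinePower_ne_zero (d := d) ζ (LinearMap.ext fun v => by rw [← hu₀ v]; simp)
  set ρ := logCurvature ν z₀ with hρdef
  -- `σ = |a₀| √ρ` is the length of the base component of `a`, in which first covariant derivatives
  -- of `B` are of size `e σ` and the mixed second one of size `e σ²`.
  have hσ2 : (‖a 0‖ * √ρ) ^ 2 = ρ * ‖a 0‖ ^ 2 := by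
    rw [mul_pow, Real.sq_sqrt hρ.le, mul_comm]
  have hpert := HermitianMetric.curvature_perturbation (h := h) (K := hK') (e := e)
    (σ := ‖a 0‖ * √ρ) he he2
    (fun x y => by
      have := b0 x y
      rw [LinearMap.sub_apply, LinearMap.sub_apply, ← hhK, ← hh] at this
      exact this)
    (u₀ := u₀) (u := u) (fun v => by rw [hu, hu₀]) (by positivity) (w₀ := w₀) (w₁ := w₁) (w₂ := w₂)
    (β₁ := fun v => a 0 * covHol (fun z s t => symForm d (G z) s t)
      (fun z s t => (K z - symForm d (G z)) s t) z₀ v u)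
    (β₂ := fun v => conj (a 0) * covAnti (fun z s t => symForm d (G z) s t)
      (fun z s t => (K z - symForm d (G z)) s t) z₀ v u)
    (β := ‖a 0‖ ^ 2 * covHol (fun z s t => symForm d (G z) s t)
      (covAnti (fun z s t => symForm d (G z) s t)
        (fun z s t => (K z - symForm d (G z)) s t)) z₀ u u) hu₀0
    (fun v => by rw [hw₁, hw₀])
    (fun v => by
      rw [norm_mul]
      calc _ ≤ ‖a 0‖ * (e * √ρ * √(h.form v v).re * √(h.form u u).re) := by gcongr; exact b1 v u
        _ = _ := by ring)
    hw₂
    (fun v => by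
      rw [norm_mul, RCLike.norm_conj]
      calc _ ≤ ‖a 0‖ * (e * √ρ * √(h.form v v).re * √(h.form u u).re) := by gcongr; exact b2 v u
        _ = _ := by ring)
    (by
      rw [norm_mul, norm_pow, Complex.norm_real, norm_norm, hσ2]
      calc _ ≤ ‖a 0‖ ^ 2 * (e * ρ * √(h.form u u).re * √(h.form u u).re) := by
            gcongr; exact b3 u u
        _ = ‖a 0‖ ^ 2 * (e * ρ * (√(h.form u u).re * √(h.form u u).re)) := by ring
        _ = _ := by rw [Real.mul_self_sqrt (h.re_self_nonneg u)]; ring)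
    hQ
  set q₀ := (h.form w₀ w₀).re / (h.form u₀ u₀).re
    - ‖h.form u₀ w₀‖ ^ 2 / (h.form u₀ u₀).re ^ 2 with hq₀
  have hn : (0 : ℝ) < n + 1 := by positivity
  have hlam0 : 0 < d * μ + k := lt_of_lt_of_le (by positivity) hlam
  have hre : (matForm (curvMatrix (affineNormSq d k (fun z => symForm d (G z)) ν) ζ) a a).re
      = (d * μ + k) * ρ * ‖a 0‖ ^ 2 + q₀ := by rw [hM, Complex.ofReal_re]
  refine ⟨by rw [hM, Complex.ofReal_im], by rw [hre]; positivity, ?_⟩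
  rw [matForm_sub, hre, hM]
  subst hζ
  have hMK := matForm_curvMatrix_quotient (k := k) hG.weight hG.weight_pos hQd
    (by rw [hQ']; exact hQ) a
  rw [show affineNormSq d k K ν = fun ζ => ν (ζ 0) ^ k /
      dualNormSq (K (ζ 0)) (affinePower d ζ) from rfl, hMK, hlog]
  change ‖(k : ℂ) * (ρ : ℂ) * ‖a 0‖ ^ 2 + _ - _‖ ≤ _
  refine le_trans (le_of_eq ?_) (hpert.trans ?_)
  · congr 1
    push_cast
    ring
  · rw [hσ2]
    have hx : ρ * ‖a 0‖ ^ 2 ≤ (n + 1) * ((d * μ + k) * ρ * ‖a 0‖ ^ 2) := by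
      have : 1 ≤ (n + 1) * (d * μ + k) := by
        rw [div_le_iff₀ hn] at hlam
        linarith
      calc ρ * ‖a 0‖ ^ 2 = 1 * (ρ * ‖a 0‖ ^ 2) := (one_mul _).symm
        _ ≤ ((n + 1) * (d * μ + k)) * (ρ * ‖a 0‖ ^ 2) := by gcongr
        _ = _ := by ring
    have hx2 : q₀ ≤ (n + 1) * q₀ := by
      have : (0 : ℝ) ≤ n * q₀ := by positivity
      linarith
    calc 480 * e * (q₀ + ρ * ‖a 0‖ ^ 2)
        ≤ 480 * e * ((n + 1) * q₀ + (n + 1) * ((d * μ + k) * ρ * ‖a 0‖ ^ 2)) := by gcongr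
      _ = _ := by ring

end ChartVolume

end

/-! ### The volume form of the unperturbed metric -/

noncomputable section

open Filter Topology

section ChartDeterminant

variable {n d k : ℕ} {μ : ℝ} {G : ℂ → SesqForm (Fin (n + 1) → ℂ)} {ν : ℂ → ℝ} {z₀ : ℂ}

theorem dHol_affineCovector_tail (v ζ a : Fin (n + 1) → ℂ) :
    dHol (fun ζ : Fin (n + 1) → ℂ => affineCovector (Fin.tail ζ) v) ζ a
      = ∑ i : Fin n, a i.succ * v i.succ := by
  rw [dHol_of_complex ((differentiable_affineCovector_tail v) ζ)]
  let T : (Fin (n + 1) → ℂ) →L[ℂ] ℂ := ∑ i : Fin n, v i.succ • ContinuousLinearMap.proj i.succ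
  have e : (fun ζ : Fin (n + 1) → ℂ => affineCovector (Fin.tail ζ) v) = fun ζ => v 0 + T ζ := by
    funext y
    simp [affineCovector_apply, T, mul_comm, Fin.tail]
  rw [e, fderiv_const_add, ContinuousLinearMap.fderiv]
  simp [T, mul_comm]

/-- If the covariant derivative of `f` is proportional to `f`, so is that of `f^{⊗ d}`. -/
theorem dHol_affinePower_sub {T : (Fin (n + 1) → ℂ) →ₗ[ℂ] (Fin (n + 1) → ℂ)} {c t : ℂ}
    {ζ a : Fin (n + 1) → ℂ}
    (hc : ∀ v : Fin (n + 1) → ℂ, (∑ i : Fin n, a i.succ * v i.succ)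
      - t * affineCovector (Fin.tail ζ) (T v) = c * affineCovector (Fin.tail ζ) v)
    (s : Sym[ℂ]^d (Fin (n + 1) → ℂ)) :
    dHol (fun ζ => affinePower d ζ s) ζ a - t * affinePower d ζ (symDeriv d T s)
      = d * c * affinePower d ζ s := by
  have hd : ∀ s, DifferentiableAt ℝ (fun ζ : Fin (n + 1) → ℂ => affinePower d ζ s) ζ := fun s =>
    (((contDiff_affinePower (m := 1) s).differentiable (by simp)) ζ).restrictScalars ℝ
  induction s using sym_induction with
  | ht v =>
    have e1 : dHol (fun ζ : Fin (n + 1) → ℂ => affinePower d ζ (SymmetricPower.tprod ℂ v)) ζ a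
        = ∑ i, (∑ j : Fin n, a j.succ * v i j.succ)
          * ∏ j ∈ Finset.univ.erase i, affineCovector (Fin.tail ζ) (v j) := by
      simp only [affinePower, covecPow_tprod]
      rw [dHol_prod _ fun i _ =>
        ((differentiable_affineCovector_tail (v i)) ζ).restrictScalars ℝ]
      simp only [dHol_affineCovector_tail]
    have e2 : affinePower d ζ (symDeriv d T (SymmetricPower.tprod ℂ v))
        = ∑ i, affineCovector (Fin.tail ζ) (T (v i))
          * ∏ j ∈ Finset.univ.erase i, affineCovector (Fin.tail ζ) (v j) := by
      rw [symDeriv_tprod, map_sum]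
      refine Finset.sum_congr rfl fun i _ => ?_
      rw [affinePower, covecPow_tprod, ← Finset.mul_prod_erase _ _ (Finset.mem_univ i),
        Function.update_self]
      congr 1
      refine Finset.prod_congr rfl fun j hj => ?_
      rw [Function.update_of_ne (Finset.ne_of_mem_erase hj)]
    rw [e1, e2, Finset.mul_sum, ← Finset.sum_sub_distrib]
    have e3 : ∀ i : Fin d, (∑ j : Fin n, a j.succ * v i j.succ)
          * ∏ j ∈ Finset.univ.erase i, affineCovector (Fin.tail ζ) (v j)
        - t * (affineCovector (Fin.tail ζ) (T (v i))
          * ∏ j ∈ Finset.univ.erase i, affineCovector (Fin.tail ζ) (v j))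
        = c * affinePower d ζ (SymmetricPower.tprod ℂ v) := by
      intro i
      rw [← mul_assoc, ← sub_mul, hc, mul_assoc, Finset.mul_prod_erase _ (fun j =>
        affineCovector (Fin.tail ζ) (v j)) (Finset.mem_univ i), affinePower, covecPow_tprod]
    simp only [e3, Finset.sum_const, Finset.card_univ, Fintype.card_fin, nsmul_eq_mul]
    ring
  | h0 => simp
  | ha x y hx hy =>
    simp only [map_add]
    rw [dHol_add (hd x) (hd y)]
    linear_combination hx + hy
  | hs b x hx =>
    simp only [map_smul, smul_eq_mul]
    rw [dHol_const_mul _ (hd x)]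
    linear_combination b * hx

/-- The horizontal direction over `∂_z`. -/
theorem exists_horizontal (T : (Fin (n + 1) → ℂ) →ₗ[ℂ] (Fin (n + 1) → ℂ)) (y : Fin n → ℂ) :
    ∃ (a : Fin (n + 1) → ℂ) (c : ℂ), a 0 = 1 ∧ ∀ v : Fin (n + 1) → ℂ,
      (∑ i : Fin n, a i.succ * v i.succ) - affineCovector y (T v) = c * affineCovector y v := by
  -- Testing on the first basis vector, where the covector is `1` and no component of `a` enters,
  -- forces `c`; the other basis vectors then determine the remaining components of `a`.
  let c := -affineCovector y (T (Pi.single 0 1))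
  let a : Fin (n + 1) → ℂ := Fin.cons 1 fun i =>
    affineCovector y (T (Pi.single i.succ 1)) + c * affineCovector y (Pi.single i.succ 1)
  refine ⟨a, c, rfl, fun v => ?_⟩
  have hv : v = ∑ j, v j • (Pi.single j 1 : Fin (n + 1) → ℂ) := by
    funext j
    simp [Pi.single_apply]
  have h1 : ∀ φ : (Fin (n + 1) → ℂ) →ₗ[ℂ] ℂ,
      φ v = v 0 * φ (Pi.single 0 1) + ∑ i : Fin n, v i.succ * φ (Pi.single i.succ 1) := by
    intro φ
    conv_lhs => rw [hv]
    rw [map_sum, Fin.sum_univ_succ]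
    simp
  have h2 : affineCovector y (Pi.single 0 1 : Fin (n + 1) → ℂ) = 1 := by
    simp [affineCovector_apply]
  rw [show affineCovector y (T v) = (affineCovector y ∘ₗ T) v from rfl, h1 (affineCovector y ∘ₗ T),
    h1 (affineCovector y), h2]
  have h3 : ∑ i : Fin n, a i.succ * v i.succ
      = ∑ i : Fin n, v i.succ * affineCovector y (T (Pi.single i.succ 1))
        + c * ∑ i : Fin n, v i.succ * affineCovector y (Pi.single i.succ 1) := by
    rw [Finset.mul_sum, ← Finset.sum_add_distrib]
    refine Finset.sum_congr rfl fun i _ => ?_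
    simp only [a, Fin.cons_succ]
    ring
  rw [h3]
  simp only [LinearMap.comp_apply]
  simp only [c]
  ring

/-- Along the horizontal direction the covariant derivative of `f^{⊗ d}` is a multiple of `f^{⊗ d}`.
Then `w` is a multiple of `u`, equality holds in Cauchy-Schwarz, and only the horizontal part of the
curvature is left. -/
theorem IsEinsteinChart.exists_matForm_eq (hG : IsEinsteinChart μ G ν z₀)
    {ζ : Fin (n + 1) → ℂ} (hζ : ζ 0 = z₀) :
    ∃ a : Fin (n + 1) → ℂ, a 0 = 1 ∧
      matForm (curvMatrix (affineNormSq d k (fun z => symForm d (G z)) ν) ζ) a a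
        = (((d * μ + k) * logCurvature ν z₀ : ℝ) : ℂ) := by
  obtain ⟨T, hT, -⟩ := hG.exists_chernForm_sym d
  obtain ⟨a, c, ha, hac⟩ := exists_horizontal (T z₀) (Fin.tail ζ)
  obtain ⟨h, hh⟩ := (hG.isMetricChart_sym (d := d)).metric.self_of_nhds
  obtain ⟨u, w, hu, hw, hM, -⟩ := hG.matForm_curvMatrix (k := k) hζ hh a
  refine ⟨a, ha, ?_⟩
  have hw' : w = conj (d * c : ℂ) • u := h.ext_right fun v => by
    rw [LinearMap.map_smulₛₗ, Complex.conj_conj, hw, hu, ha, (hT.self_of_nhds v).1, smul_eq_mul]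
    exact dHol_affinePower_sub (t := 1) (by simpa using hac) v
  have hu0 : u ≠ 0 := by
    rintro rfl
    exact affinePower_ne_zero (d := d) ζ (LinearMap.ext fun v => by rw [← hu v]; simp)
  have hpos := h.pos u hu0
  have e1 : (h.form w w).re = ‖(d * c : ℂ)‖ ^ 2 * (h.form u u).re := by
    rw [hw', LinearMap.map_smulₛₗ, LinearMap.map_smul, LinearMap.smul_apply, Complex.conj_conj,
      smul_eq_mul, smul_eq_mul, ← mul_assoc, Complex.mul_conj', ← Complex.ofReal_pow,
      Complex.re_ofReal_mul]
  have e2 : ‖h.form u w‖ = ‖(d * c : ℂ)‖ * (h.form u u).re := by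
    rw [hw', LinearMap.map_smulₛₗ, Complex.conj_conj, smul_eq_mul, norm_mul, h.self_eq_ofReal,
      Complex.norm_real, Complex.ofReal_re, Real.norm_of_nonneg hpos.le]
  rw [hM, e1, e2, ha]
  congr 1
  field_simp
  simp

/-- On a fibre `z` is fixed, and by `dualNormSq_sym` the logarithm of the frame norm is a constant
plus `d` times that of the Fubini-Study frame. -/
theorem submatrix_curvMatrix {h : HermitianMetric (Fin (n + 1) → ℂ)}
    {b : Module.Basis (Fin (n + 1)) ℂ (Fin (n + 1) → ℂ)}
    (hb : ∀ i j, h.form (b i) (b j) = if i = j then 1 else 0) {ζ : Fin (n + 1) → ℂ}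
    (hh : h.form = G (ζ 0)) (hν0 : 0 < ν (ζ 0))
    (hN : ContDiffAt ℝ 2 (affineNormSq d k (fun z => symForm d (G z)) ν) ζ) :
    (curvMatrix (affineNormSq d k (fun z => symForm d (G z)) ν) ζ).submatrix Fin.succ Fin.succ
      = (d : ℂ) • curvMatrix (fun y => 1 / dualNormSq h.form (affineCovector y)) (Fin.tail ζ) := by
  let J : (Fin n → ℂ) →L[ℂ] (Fin (n + 1) → ℂ) := ContinuousLinearMap.pi
    (Fin.cons 0 fun i => ContinuousLinearMap.proj i)
  have hJ : ∀ y, J y = Fin.cons 0 y := by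
    intro y
    funext j
    refine Fin.cases ?_ (fun i => ?_) j <;> simp [J]
  have hJ2 : ∀ y, J y + Pi.single 0 (ζ 0) = Fin.cons (ζ 0) y := by
    intro y
    rw [hJ]
    funext j
    refine Fin.cases ?_ (fun i => ?_) j <;> simp
  have hJs : ∀ b : Fin n, J (Pi.single b 1) = Pi.single b.succ 1 := by
    intro b
    rw [hJ]
    funext j
    refine Fin.cases ?_ (fun i => ?_) j
    · simp [(Fin.succ_ne_zero b).symm]
    · simp [Pi.single_apply]
  have hζJ : J (Fin.tail ζ) + Pi.single 0 (ζ 0) = ζ := by rw [hJ2, Fin.cons_self_tail]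
  have hpos : ∀ y : Fin n → ℂ, 0 < dualNormSq h.form (affineCovector y) :=
    fun y => h.dualNormSq_pos (affineCovector_ne_zero y)
  have hN0 : ∀ y : Fin n → ℂ, affineNormSq d k (fun z => symForm d (G z)) ν (Fin.cons (ζ 0) y)
      = ν (ζ 0) ^ k / dualNormSq h.form (affineCovector y) ^ d := by
    intro y
    rw [affineNormSq, Fin.cons_zero, ← hh, affinePower, Fin.tail_cons, h.dualNormSq_sym]
  have hlN : ContDiffAt ℝ 2 (fun ζ =>
      (Real.log (affineNormSq d k (fun z => symForm d (G z)) ν ζ) : ℂ)) ζ := by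
    refine Complex.ofRealCLM.contDiff.contDiffAt.comp ζ (hN.log ?_)
    have h1 := hN0 (Fin.tail ζ)
    rw [Fin.cons_self_tail] at h1
    rw [h1]
    have := hpos (Fin.tail ζ)
    positivity
  have hlog : ∀ y : Fin n → ℂ,
      (Real.log (affineNormSq d k (fun z => symForm d (G z)) ν (J y + Pi.single 0 (ζ 0))) : ℂ)
      = ((k * Real.log (ν (ζ 0)) : ℝ) : ℂ)
        + d * (Real.log (1 / dualNormSq h.form (affineCovector y)) : ℂ) := by
    intro y
    rw [hJ2, hN0, Real.log_div (by positivity) (pow_pos (hpos y) d).ne', Real.log_pow,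
      Real.log_pow, one_div, Real.log_inv]
    push_cast
    ring
  have hL : ∀ y : Fin n → ℂ, ContDiffAt ℝ 2 (fun y : Fin n → ℂ =>
      (Real.log (1 / dualNormSq h.form (affineCovector y)) : ℂ)) y := fun y =>
    Complex.ofRealCLM.contDiff.contDiffAt.comp y ((contDiffAt_const.div
      (((contDiff_dualNormSq_affineCovector hb).of_le ENat.LEInfty.out).contDiffAt)
        (hpos y).ne').log (one_div_pos.2 (hpos y)).ne')
  ext i j
  simp only [Matrix.submatrix_apply, Matrix.smul_apply, curvMatrix, Matrix.of_apply, smul_eq_mul,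
    mul_neg]
  congr 1
  have hd1 := (hlN.dAnti (n := 1) (by norm_num) (J (Pi.single j 1))).differentiableAt (by simp)
  have e1 := dHol_comp_affine J (Pi.single 0 (ζ 0)) (F := fun y => dAnti (fun ζ =>
    (Real.log (affineNormSq d k (fun z => symForm d (G z)) ν ζ) : ℂ)) y (J (Pi.single j 1)))
    (p := Fin.tail ζ) (by rw [hζJ]; exact hd1) (Pi.single i 1)
  rw [hζJ] at e1
  rw [← hJs i, ← hJs j, ← e1, ← dHol_const_mul _
    (((hL _).dAnti (n := 1) (by norm_num) _).differentiableAt (by simp))]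
  refine dHol_congr ?_ _
  have hev : ∀ᶠ y in 𝓝 (Fin.tail ζ), ContDiffAt ℝ 2 (fun ζ =>
      (Real.log (affineNormSq d k (fun z => symForm d (G z)) ν ζ) : ℂ))
      (J y + Pi.single 0 (ζ 0)) := by
    have hc : ContinuousAt (fun y => J y + Pi.single 0 (ζ 0)) (Fin.tail ζ) := by fun_prop
    refine hc.eventually ?_
    simp only [hζJ]
    exact hlN.eventually (by simp)
  filter_upwards [hev] with y hy
  rw [← dAnti_comp_affine J (Pi.single 0 (ζ 0)) (hy.differentiableAt (by simp))]
  simp only [hlog]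
  rw [dAnti_add (differentiableAt_const _)
    (((hL y).differentiableAt (by simp)).const_mul _), dAnti_const, zero_add,
    dAnti_const_mul _ ((hL y).differentiableAt (by simp))]

theorem matForm_corner (c : ℂ) (a : Fin (n + 1) → ℂ) :
    matForm (Matrix.single 0 0 c) a a = c * ‖a 0‖ ^ 2 := by
  rw [matForm_apply, Finset.sum_eq_single 0 _ (by simp), Finset.sum_eq_single 0 _ (by simp)]
  · rw [Matrix.single_apply_same, Complex.mul_conj']
    ring
  · intro j _ hj
    simp [hj.symm]
  · intro i _ hi
    simp [hi.symm]

/-- The volume form of the unperturbed metric is the product of the volume forms of the base and of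
the fibre. -/
theorem IsEinsteinChart.volCoeff_eq (hG : IsEinsteinChart μ G ν z₀)
    {h : HermitianMetric (Fin (n + 1) → ℂ)} (hh : h.form = G z₀) {ζ : Fin (n + 1) → ℂ}
    (hζ : ζ 0 = z₀) :
    volCoeff (affineNormSq d k (fun z => symForm d (G z)) ν) ζ
      = ((2 * logCurvature ν z₀ * (d * μ + k) * d ^ n : ℝ) : ℂ)
        * volCoeff (fun y => 1 / dualNormSq h.form (affineCovector y)) (Fin.tail ζ) := by
  obtain ⟨b, hb⟩ := h.exists_orthonormal_basis_fin
  obtain ⟨hs, hhs⟩ := (hG.isMetricChart_sym (d := d)).metric.self_of_nhds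
  set M := curvMatrix (affineNormSq d k (fun z => symForm d (G z)) ν) ζ with hM
  set c : ℂ := (((d * μ + k) * logCurvature ν z₀ : ℝ) : ℂ) with hc
  have hS : ∀ a : Fin (n + 1) → ℂ, ∃ q : ℝ, 0 ≤ q ∧ matForm (M - Matrix.single 0 0 c) a a = q := by
    intro a
    obtain ⟨u, w, -, -, h1, h2⟩ := hG.matForm_curvMatrix (k := k) hζ hhs a
    refine ⟨_, h2, ?_⟩
    rw [matForm_sub, h1, matForm_corner, hc]
    push_cast
    ring
  obtain ⟨a, ha, haM⟩ := hG.exists_matForm_eq (d := d) (k := k) hζ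
  -- Removing the horizontal curvature `c` from the corner leaves a semidefinite matrix for which
  -- the horizontal direction is isotropic. By `det_add_corner`, the determinant of `M` is then `c`
  -- times that of the fibre block.
  have hdet : (M - Matrix.single 0 0 c).det = 0 := by
    refine det_eq_zero_of_matForm_eq_zero (x := a) (fun x => ?_) (fun x => ?_) ?_ ?_
    · obtain ⟨q, -, hq⟩ := hS x
      rw [hq, Complex.ofReal_im]
    · obtain ⟨q, hq0, hq⟩ := hS x
      rwa [hq, Complex.ofReal_re]
    · rintro rfl
      simp at ha
    · rw [matForm_sub, haM, matForm_corner, ha]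
      simp [hc]
  have hdM := det_add_corner (M - Matrix.single 0 0 c) c
  have hsub : (M - Matrix.single 0 0 c).submatrix Fin.succ Fin.succ
      = M.submatrix Fin.succ Fin.succ := by
    ext i j
    simp [(Fin.succ_ne_zero i).symm]
  obtain ⟨hq0, hq, -⟩ := hG.mixed_hessian_log (d := d)
    hG.isMetricChart_sym (B := fun _ _ _ => 0) (fun _ _ _ => (add_zero _).symm) hζ 0
  subst hζ
  have hN : ContDiffAt ℝ 2 (affineNormSq d k (fun z => symForm d (G z)) ν) ζ := by
    refine ContDiffAt.div (ContDiffAt.pow ?_ k) hq hq0.ne'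
    exact hG.weight.comp ζ
      (((ContinuousLinearMap.proj 0 : (Fin (n + 1) → ℂ) →L[ℂ] ℂ).restrictScalars
        ℝ).contDiff.contDiffAt)
  rw [sub_add_cancel, hdet, zero_add, hsub, submatrix_curvMatrix hb hh hG.weight_pos hN,
    Matrix.det_smul, Fintype.card_fin] at hdM
  rw [volCoeff, volCoeff, ← hM, hdM, hc]
  push_cast
  ring

end ChartDeterminant

end

/-! ### Comparison of the integrands -/

noncomputable section

open Filter Topology

section ChartComparison

variable {n d k : ℕ} {μ : ℝ} {G : ℂ → SesqForm (Fin (n + 1) → ℂ)} {ν : ℂ → ℝ} {z₀ : ℂ}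

/-- The relative error of the determinant of the curvature matrix. -/
def volumeErrorConstant (n : ℕ) : ℝ :=
  (n + 1).factorial * ((n + 1 : ℕ) * (1 + 960 * (n + 1)) ^ (n + 1)) * (4 * (480 * (n + 1)))

theorem volumeErrorConstant_nonneg (n : ℕ) : 0 ≤ volumeErrorConstant n := by
  unfold volumeErrorConstant
  positivity

/-- The volume density of the Fubini-Study metric of `h` in the affine chart. -/
def fubiniStudyDensity (h : HermitianMetric (Fin (n + 1) → ℂ)) (y : Fin n → ℂ) : ℝ :=
  (volCoeff (fun y => 1 / dualNormSq h.form (affineCovector y)) y).re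

theorem fubiniStudyDensity_pos (h : HermitianMetric (Fin (n + 1) → ℂ)) (y : Fin n → ℂ) :
    0 < fubiniStudyDensity h y := by
  obtain ⟨b, hb⟩ := h.exists_orthonormal_basis_fin
  rw [fubiniStudyDensity, volCoeff_fubiniStudy hb, Complex.ofReal_re]
  have := h.dualNormSq_pos (affineCovector_ne_zero y)
  have := norm_pos_iff.2 (basisMatrix_det_ne_zero b)
  positivity

theorem fubiniStudyDensity_eq (h : HermitianMetric (Fin (n + 1) → ℂ)) (y : Fin n → ℂ) :
    volCoeff (fun y => 1 / dualNormSq h.form (affineCovector y)) y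
      = (fubiniStudyDensity h y : ℂ) := by
  obtain ⟨b, hb⟩ := h.exists_orthonormal_basis_fin
  rw [fubiniStudyDensity, volCoeff_fubiniStudy hb, Complex.ofReal_re]

theorem IsEinsteinChart.norm_volCoeff_sub_le (hG : IsEinsteinChart μ G ν z₀) (hd : 0 < d)
    (hlam : 1 / ((n : ℝ) + 1) ≤ d * μ + k)
    {K : ℂ → SesqForm (Sym[ℂ]^d (Fin (n + 1) → ℂ))} (hK : IsMetricChart K z₀) {e : ℝ}
    (he : 0 ≤ e) (he2 : e ≤ 1 / 2)
    (hC : C2NormAt (fun z s t => symForm d (G z) s t) (logCurvature ν)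
      (fun z s t => (K z - symForm d (G z)) s t) z₀ ≤ ENNReal.ofReal e)
    {h : HermitianMetric (Fin (n + 1) → ℂ)} (hh : h.form = G z₀) {ζ : Fin (n + 1) → ℂ}
    (hζ : ζ 0 = z₀) :
    ‖volCoeff (affineNormSq d k K ν) ζ - ((2 * logCurvature ν z₀ * (d * μ + k) * d ^ n
        * fubiniStudyDensity h (Fin.tail ζ) : ℝ) : ℂ)‖
      ≤ volumeErrorConstant n * e * (2 * logCurvature ν z₀ * (d * μ + k) * d ^ n
        * fubiniStudyDensity h (Fin.tail ζ)) := by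
  have hlam0 : 0 < d * μ + k := lt_of_lt_of_le (by positivity) hlam
  have hρ := hG.curvature_pos
  have hF := fubiniStudyDensity_pos h (Fin.tail ζ)
  have hv := hG.volCoeff_eq (d := d) (k := k) hh hζ
  rw [fubiniStudyDensity_eq, ← Complex.ofReal_mul] at hv
  have hpos : 0 < 2 * logCurvature ν z₀ * (d * μ + k) * d ^ n
      * fubiniStudyDensity h (Fin.tail ζ) := by positivity
  have hM := hG.matForm_curvMatrix_sub_le hlam hK he he2 hC hζ
  set M := curvMatrix (affineNormSq d k (fun z => symForm d (G z)) ν) ζ with hMdef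
  -- The explicit product formula for the volume form shows that `M` is nondegenerate, which
  -- upgrades its semidefiniteness to positive definiteness.
  have hdet : M.det ≠ 0 := by
    intro h0
    rw [volCoeff, ← hMdef, h0, mul_zero] at hv
    exact hpos.ne (by exact_mod_cast hv)
  have hMp : ∀ x, x ≠ 0 → 0 < (matForm M x x).re := by
    intro x hx
    refine lt_of_le_of_ne (hM x).2.1 fun h0 => hdet ?_
    exact det_eq_zero_of_matForm_eq_zero (fun x => (hM x).1) (fun x => (hM x).2.1) hx
      (Complex.ext h0.symm (hM x).1)
  have hδ : 0 ≤ 480 * (n + 1) * e := by positivity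
  -- With `δ = 480 (n+1) e` and `e ≤ 1/2` one has `4δ ≤ 960 (n+1)`, so `D`, and with it the
  -- constant, depends on `n` only.
  have key := norm_det_add_sub_le (M := M) (R := curvMatrix (affineNormSq d k K ν) ζ - M)
    (δ := 480 * (n + 1) * e) (D := 960 * (n + 1)) hδ
    (by
      have : (0 : ℝ) ≤ n + 1 := by positivity
      nlinarith) (fun x => (hM x).1) hMp (fun x => (hM x).2.2)
  rw [add_sub_cancel] at key
  rw [← hv, volCoeff, volCoeff, ← hMdef, ← mul_sub, norm_mul]
  have hnv : ‖(2 : ℂ) ^ (n + 1)‖ * ‖M.det‖ = 2 * logCurvature ν z₀ * (d * μ + k) * d ^ n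
      * fubiniStudyDensity h (Fin.tail ζ) := by
    rw [← norm_mul, ← Real.norm_of_nonneg hpos.le, ← Complex.norm_real, ← hv]
    rfl
  calc ‖(2 : ℂ) ^ (n + 1)‖ * ‖(curvMatrix (affineNormSq d k K ν) ζ).det - M.det‖
      ≤ ‖(2 : ℂ) ^ (n + 1)‖ * ((n + 1).factorial * ((n + 1 : ℕ)
          * (1 + 960 * (n + 1)) ^ (n + 1)) * (4 * (480 * (n + 1) * e)) * ‖M.det‖) := by gcongr
    _ = volumeErrorConstant n * e * (‖(2 : ℂ) ^ (n + 1)‖ * ‖M.det‖) := by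
        unfold volumeErrorConstant
        ring
    _ = _ := by rw [hnv]

/-- The pairing times the volume form, compared with the unperturbed one. -/
theorem IsEinsteinChart.norm_pairing_sub_le (hG : IsEinsteinChart μ G ν z₀) (hd : 0 < d)
    (hlam : 1 / ((n : ℝ) + 1) ≤ d * μ + k)
    {K : ℂ → SesqForm (Sym[ℂ]^d (Fin (n + 1) → ℂ))} (hK : IsMetricChart K z₀) {e : ℝ}
    (he : 0 ≤ e) (he2 : e ≤ 1 / 2)
    (hC : C2NormAt (fun z s t => symForm d (G z) s t) (logCurvature ν)
      (fun z s t => (K z - symForm d (G z)) s t) z₀ ≤ ENNReal.ofReal e)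
    {h : HermitianMetric (Fin (n + 1) → ℂ)} (hh : h.form = G z₀) {ζ : Fin (n + 1) → ℂ}
    (hζ : ζ 0 = z₀) (s t : Sym[ℂ]^d (Fin (n + 1) → ℂ)) :
    ‖hatInner d (K z₀) s t (affineCovector (Fin.tail ζ)) * volCoeff (affineNormSq d k K ν) ζ
        - hatInner d (symForm d (G z₀)) s t (affineCovector (Fin.tail ζ))
          * ((2 * logCurvature ν z₀ * (d * μ + k) * d ^ n
            * fubiniStudyDensity h (Fin.tail ζ) : ℝ) : ℂ)‖
      ≤ (5 * volumeErrorConstant n + 10) * e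
        * ‖hatInner d (symForm d (G z₀)) s t (affineCovector (Fin.tail ζ))‖
        * (2 * logCurvature ν z₀ * (d * μ + k) * d ^ n
          * fubiniStudyDensity h (Fin.tail ζ)) := by
  have hlam0 : 0 < d * μ + k := lt_of_lt_of_le (by positivity) hlam
  have hρ := hG.curvature_pos
  have hF := fubiniStudyDensity_pos h (Fin.tail ζ)
  have hvol := hG.norm_volCoeff_sub_le hd hlam hK he he2 hC hh hζ
  set v₀ := 2 * logCurvature ν z₀ * (d * μ + k) * d ^ n
          * fubiniStudyDensity h (Fin.tail ζ) with hv₀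
  have hv₀p : 0 < v₀ := by positivity
  set v := volCoeff (affineNormSq d k K ν) ζ with hv
  obtain ⟨hK', hhK⟩ := hK.metric.self_of_nhds
  let hs : HermitianMetric (Sym[ℂ]^d (Fin (n + 1) → ℂ)) := h.sym d
  have hhs : hs.form = symForm d (G z₀) := by rw [← hh]; rfl
  obtain ⟨u, hu⟩ := hK'.exists_riesz (affinePower d ζ)
  obtain ⟨u₀, hu₀⟩ := hs.exists_riesz (affinePower d ζ)
  obtain ⟨c0, -⟩ := formNorm_le_of_C2NormAt_le hρ hC
  have hform : ∀ u v, symForm d (G z₀) u v = hs.form u v := fun u v => by rw [hhs]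
  simp only [hform] at c0
  have b0 := norm_le_of_formNorm_le (SesqForm.isSesq _) he c0
  obtain ⟨h1, h2⟩ := HermitianMetric.riesz_perturbation (h := hs) (K := hK') he he2
    (fun x y => by
      have := b0 x y
      rwa [LinearMap.sub_apply, LinearMap.sub_apply, ← hhK, ← hhs] at this)
    (u₀ := u₀) (u := u) (fun v => by rw [hu, hu₀])
  have hQ := hK'.dualNormSq_eq hu
  have hQ₀ := hs.dualNormSq_eq hu₀
  have hQp := hK'.dualNormSq_pos (affinePower_ne_zero (d := d) ζ)
  have hQ₀p := hs.dualNormSq_pos (affinePower_ne_zero (d := d) ζ)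
  rw [← hQ, ← hQ₀] at h1
  rw [← hQ, ← hQ₀] at h2
  simp only [hatInner]
  rw [← hhK, ← hhs]
  change ‖_ / (dualNormSq hK'.form (affinePower d ζ) : ℂ) * v
    - _ / (dualNormSq hs.form (affinePower d ζ) : ℂ) * (v₀ : ℂ)‖
    ≤ _ * ‖_ / (dualNormSq hs.form (affinePower d ζ) : ℂ)‖ * _
  set Q := dualNormSq hK'.form (affinePower d ζ) with hQdef
  set Q₀ := dualNormSq hs.form (affinePower d ζ) with hQ₀def
  set P : ℂ := covecPow d (affineCovector (Fin.tail ζ)) s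
    * conj (covecPow d (affineCovector (Fin.tail ζ)) t) with hP
  have hQc : (Q : ℂ) ≠ 0 := by exact_mod_cast hQp.ne'
  have hQ₀c : (Q₀ : ℂ) ≠ 0 := by exact_mod_cast hQ₀p.ne'
  -- Two sources of error are separated, the volume form and the dual norm. The quotient `Q₀ / Q` is
  -- at most `5` and the relative error of `Q` at most `2e · 5`, hence the constant `5
  -- volumeErrorConstant + 10`.
  have e1 : P / (Q : ℂ) * v - P / (Q₀ : ℂ) * (v₀ : ℂ)
      = P / (Q₀ : ℂ) * (((Q₀ / Q : ℝ) : ℂ) * (v - v₀) + (((Q₀ - Q) / Q : ℝ) : ℂ) * v₀) := by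
    push_cast
    field_simp
    ring
  have e2 : |Q₀ / Q| ≤ 5 := by
    rw [abs_of_pos (by positivity), div_le_iff₀ hQp]
    exact h2
  have e3 : |(Q₀ - Q) / Q| ≤ 10 * e := by
    rw [abs_div, abs_of_pos hQp, div_le_iff₀ hQp, abs_sub_comm]
    calc |Q - Q₀| ≤ 2 * e * Q₀ := h1
      _ ≤ 2 * e * (5 * Q) := by gcongr
      _ = _ := by ring
  rw [e1, norm_mul]
  calc ‖P / (Q₀ : ℂ)‖ * ‖((Q₀ / Q : ℝ) : ℂ) * (v - v₀) + (((Q₀ - Q) / Q : ℝ) : ℂ) * v₀‖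
      ≤ ‖P / (Q₀ : ℂ)‖ * (5 * (volumeErrorConstant n * e * v₀) + 10 * e * v₀) := by
        gcongr
        refine (norm_add_le _ _).trans (add_le_add ?_ ?_)
        · rw [norm_mul, Complex.norm_real, Real.norm_eq_abs]
          gcongr
        · rw [norm_mul, Complex.norm_real, Real.norm_eq_abs, Complex.norm_real,
            Real.norm_of_nonneg hv₀p.le]
          gcongr
    _ = _ := by ring

end ChartComparison

end

/-! ### The integrand in a chart -/

noncomputable section

open Filter Topology

section ChartIntegral

variable {n d k : ℕ} {μ : ℝ} {G : ℂ → SesqForm (Fin (n + 1) → ℂ)} {ν : ℂ → ℝ} {z₀ : ℂ}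

/-- Fubini's theorem for functions on the part of `ℂ^{n+1}` over a subset of `ℂ`. -/
theorem measurePreserving_cons (n : ℕ) :
    MeasurePreserving (fun p : ℂ × (Fin n → ℂ) => (Fin.cons p.1 p.2 : Fin (n + 1) → ℂ))
      (volume.prod volume) volume ∧
    MeasurableEmbedding fun p : ℂ × (Fin n → ℂ) => (Fin.cons p.1 p.2 : Fin (n + 1) → ℂ) := by
  have hmp := (volume_preserving_piFinSuccAbove (fun _ : Fin (n + 1) => ℂ) 0).symm
  have hcons : (fun p : ℂ × (Fin n → ℂ) => (Fin.cons p.1 p.2 : Fin (n + 1) → ℂ))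
      = (MeasurableEquiv.piFinSuccAbove (fun _ : Fin (n + 1) => ℂ) 0).symm := by
    funext p
    simp [MeasurableEquiv.piFinSuccAbove, Fin.insertNthEquiv]
  rw [hcons]
  exact ⟨hmp, MeasurableEquiv.measurableEmbedding _⟩

theorem preimage_cons (P : Set ℂ) :
    (fun p : ℂ × (Fin n → ℂ) => (Fin.cons p.1 p.2 : Fin (n + 1) → ℂ)) ⁻¹' {ζ | ζ 0 ∈ P}
      = P ×ˢ Set.univ := by
  ext p
  simp [Set.mem_ofPred_eq]

theorem integrableOn_fibration_iff {F : (Fin (n + 1) → ℂ) → ℂ} {P : Set ℂ} :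
    IntegrableOn F {ζ | ζ 0 ∈ P} ↔ Integrable (fun p : ℂ × (Fin n → ℂ) => F (Fin.cons p.1 p.2))
      ((volume.restrict P).prod volume) := by
  obtain ⟨h1, h2⟩ := measurePreserving_cons n
  rw [← h1.integrableOn_comp_preimage h2, preimage_cons, IntegrableOn, ← Measure.prod_restrict,
    Measure.restrict_univ]
  rfl

theorem setIntegral_fibration {F : (Fin (n + 1) → ℂ) → ℂ} {P : Set ℂ}
    (hF : IntegrableOn F {ζ | ζ 0 ∈ P}) :
    ∫ ζ in {ζ | ζ 0 ∈ P}, F ζ = ∫ z in P, ∫ y : Fin n → ℂ, F (Fin.cons z y) := by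
  obtain ⟨h1, h2⟩ := measurePreserving_cons n
  rw [← h1.setIntegral_preimage_emb h2, preimage_cons, ← Measure.prod_restrict,
    Measure.restrict_univ]
  exact integral_prod _ (integrableOn_fibration_iff.1 hF)

/-- A map to a finite-dimensional space is continuous at `z` if its coordinates are. -/
def IsWeaklyContinuousAt {S : Type*} [AddCommGroup S] [Module ℂ S] (f : ℂ → S) (z : ℂ) : Prop :=
  ∀ φ : S →ₗ[ℂ] ℂ, ContinuousAt (fun z => φ (f z)) z

theorem IsWeaklyContinuousAt.sesq {S : Type*} [AddCommGroup S] [Module ℂ S] [FiniteDimensional ℂ S]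
    {K : ℂ → SesqForm S} {f g : ℂ → S} (hf : IsWeaklyContinuousAt f z₀)
    (hg : IsWeaklyContinuousAt g z₀) (hK : ∀ u v, ContinuousAt (fun z => K z u v) z₀) :
    ContinuousAt (fun z => K z (f z) (g z)) z₀ := by
  let b := Module.finBasis ℂ S
  have e : (fun z => K z (f z) (g z))
      = fun z => ∑ i, ∑ j, b.repr (f z) i * conj (b.repr (g z) j) * K z (b i) (b j) := by
    funext z
    exact sesq_eq_sum _ b _ _
  rw [e]
  refine tendsto_finsetSum _ fun i _ => tendsto_finsetSum _ fun j _ => ?_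
  exact ((hf (b.coord i)).mul (Complex.continuous_conj.continuousAt.comp (hg (b.coord j)))).mul
    (hK _ _)

theorem continuousAt_affinePower {f : ℂ → Sym[ℂ]^d (Fin (n + 1) → ℂ)} {ζ : Fin (n + 1) → ℂ}
    (hf : IsWeaklyContinuousAt f (ζ 0)) :
    ContinuousAt (fun ζ : Fin (n + 1) → ℂ => affinePower d ζ (f (ζ 0))) ζ := by
  let b := Module.finBasis ℂ (Sym[ℂ]^d (Fin (n + 1) → ℂ))
  have e : (fun ζ : Fin (n + 1) → ℂ => affinePower d ζ (f (ζ 0)))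
      = fun ζ => ∑ i, b.repr (f (ζ 0)) i * affinePower d ζ (b i) := by
    funext ζ
    exact dual_eq_sum _ b _
  rw [e]
  refine tendsto_finsetSum _ fun i _ => ?_
  have h1 : ContinuousAt (fun ζ : Fin (n + 1) → ℂ => b.repr (f (ζ 0)) i) ζ :=
    ContinuousAt.comp (f := fun ζ : Fin (n + 1) → ℂ => ζ 0) (hf (b.coord i))
      (continuous_apply 0).continuousAt
  exact h1.mul ((contDiff_affinePower (m := 0) (b i)).continuous.continuousAt)

theorem continuousAt_logCurvature (hν : ContDiffAt ℝ 2 ν z₀) (hν0 : 0 < ν z₀) :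
    ContinuousAt (logCurvature ν) z₀ := by
  have h1 : ContDiffAt ℝ 2 (fun z => (Real.log (ν z) : ℂ)) z₀ :=
    Complex.ofRealCLM.contDiff.contDiffAt.comp _ (hν.log hν0.ne')
  have h2 := ((h1.dAnti (n := 1) (by norm_num) 1).dHol (n := 0) (by norm_num) 1).continuousAt
  exact Complex.continuous_re.continuousAt.comp h2.neg

theorem continuousAt_volCoeff {m : ℕ} {N : (Fin m → ℂ) → ℝ} {ζ : Fin m → ℂ}
    (hN : ContDiffAt ℝ 2 N ζ) (h0 : N ζ ≠ 0) : ContinuousAt (volCoeff N) ζ := by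
  have h1 : ContDiffAt ℝ 2 (fun z => (Real.log (N z) : ℂ)) ζ :=
    Complex.ofRealCLM.contDiff.contDiffAt.comp _ (hN.log h0)
  have h2 : ContinuousAt (curvMatrix N) ζ := by
    refine tendsto_pi_nhds.2 fun a => tendsto_pi_nhds.2 fun b => ?_
    exact (((h1.dAnti (n := 1) (by norm_num) (Pi.single b 1)).dHol (n := 0) (by norm_num)
      (Pi.single a 1)).continuousAt).neg
  exact continuousAt_const.mul
    ((Continuous.matrix_det continuous_id).continuousAt.comp h2)

/-- The integrand of `∫ ⟨ŝ, t̂⟩ dvol` in affine coordinates. -/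
def chartIntegrand (d k : ℕ) (K : ℂ → SesqForm (Sym[ℂ]^d (Fin (n + 1) → ℂ))) (ν : ℂ → ℝ)
    (s t : ℂ → Sym[ℂ]^d (Fin (n + 1) → ℂ)) (ζ : Fin (n + 1) → ℂ) : ℂ :=
  (ν (ζ 0) ^ k : ℝ) * hatInner d (K (ζ 0)) (s (ζ 0)) (t (ζ 0)) (affineCovector (Fin.tail ζ))
    * volCoeff (affineNormSq d k K ν) ζ

variable {K : ℂ → SesqForm (Sym[ℂ]^d (Fin (n + 1) → ℂ))}
  {s t : ℂ → Sym[ℂ]^d (Fin (n + 1) → ℂ)}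

/-- Serves for measurability of the integrand. The curvature is continuous because the frame norm is
`C²`, which comes with the Hessian formula. -/
theorem IsEinsteinChart.continuousAt_chartIntegrand (hG : IsEinsteinChart μ G ν z₀)
    (hK : IsMetricChart K z₀) (hs : IsWeaklyContinuousAt s z₀) (ht : IsWeaklyContinuousAt t z₀)
    {ζ : Fin (n + 1) → ℂ} (hζ : ζ 0 = z₀) : ContinuousAt (chartIntegrand d k K ν s t) ζ := by
  obtain ⟨hq0, hq, -⟩ := hG.mixed_hessian_log (d := d) hK
    (B := fun z s t => (K z - symForm d (G z)) s t)
    (fun _ _ _ => by rw [LinearMap.sub_apply, LinearMap.sub_apply]; ring) hζ 0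
  subst hζ
  have hνζ : ContDiffAt ℝ 2 (fun ζ : Fin (n + 1) → ℂ => ν (ζ 0) ^ k) ζ :=
    ContDiffAt.pow (hG.weight.comp ζ
      (((ContinuousLinearMap.proj 0 : (Fin (n + 1) → ℂ) →L[ℂ] ℂ).restrictScalars
        ℝ).contDiff.contDiffAt)) k
  have hN : ContDiffAt ℝ 2 (affineNormSq d k K ν) ζ := hνζ.div hq hq0.ne'
  have hν0 := hG.weight_pos
  have h1 := continuousAt_volCoeff hN (by unfold affineNormSq; positivity)
  have h2 : ContinuousAt (fun ζ : Fin (n + 1) → ℂ => ((ν (ζ 0) ^ k : ℝ) : ℂ)) ζ :=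
    Complex.continuous_ofReal.continuousAt.comp hνζ.continuousAt
  have h3 : ContinuousAt (fun ζ : Fin (n + 1) → ℂ =>
      (dualNormSq (K (ζ 0)) (affinePower d ζ) : ℂ)) ζ :=
    Complex.continuous_ofReal.continuousAt.comp hq.continuousAt
  refine (h2.mul (((continuousAt_affinePower hs).mul
    (Complex.continuous_conj.continuousAt.comp (continuousAt_affinePower ht))).div h3 ?_)).mul h1
  exact_mod_cast hq0.ne'

theorem IsEinsteinChart.chartIntegrand_eq (hG : IsEinsteinChart μ G ν z₀)
    {h : HermitianMetric (Fin (n + 1) → ℂ)} (hh : h.form = G z₀) (y : Fin n → ℂ) :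
    chartIntegrand d k (fun z => symForm d (G z)) ν s t (Fin.cons z₀ y)
      = ((ν z₀ ^ k * (2 * logCurvature ν z₀) * (d * μ + k) : ℝ) : ℂ) * ((d : ℂ) ^ n *
        (hatInner d (symForm d h.form) (s z₀) (t z₀) (affineCovector y) *
          volCoeff (fun y => 1 / dualNormSq h.form (affineCovector y)) y)) := by
  rw [chartIntegrand, hG.volCoeff_eq hh (Fin.cons_zero _ _), Fin.cons_zero, Fin.tail_cons, hh]
  push_cast
  ring

/-- For the unperturbed metric the volume form is a product, so the fibre integral is exactly the
one defining the fibre constant, times the density on the base. -/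
theorem IsEinsteinChart.integral_chartIntegrand (hG : IsEinsteinChart μ G ν z₀) :
    Integrable (fun y : Fin n → ℂ =>
      chartIntegrand d k (fun z => symForm d (G z)) ν s t (Fin.cons z₀ y)) ∧
    ∫ y : Fin n → ℂ, chartIntegrand d k (fun z => symForm d (G z)) ν s t (Fin.cons z₀ y)
      = ((fibreConstant n d * (d * μ + k) : ℝ) : ℂ) * (symForm d (G z₀) (s z₀) (t z₀)
        * ((ν z₀ ^ k * (2 * logCurvature ν z₀) : ℝ) : ℂ)) := by
  obtain ⟨h, hh⟩ := hG.metric.self_of_nhds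
  obtain ⟨h1, h2⟩ := hatInner_mul_volCoeff_fubiniStudy h (s z₀) (t z₀)
  simp only [hG.chartIntegrand_eq hh]
  refine ⟨(h1.const_mul _).const_mul _, ?_⟩
  rw [integral_const_mul, integral_const_mul, h2, hh]
  push_cast
  ring

/-- The integrand is a nonnegative density times `f^{⊗ d}(s)` and the conjugate of `f^{⊗ d}(t)`; the
mean inequality then bounds it by the diagonal ones. The latter can be integrated in absolute value
without loss. -/
theorem IsEinsteinChart.chartIntegrand_self (hG : IsEinsteinChart μ G ν z₀)
    (hlam : 0 < d * μ + k) {ζ : Fin (n + 1) → ℂ} (hζ : ζ 0 = z₀) :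
    chartIntegrand d k (fun z => symForm d (G z)) ν s s ζ
      = (‖chartIntegrand d k (fun z => symForm d (G z)) ν s s ζ‖ : ℂ) ∧
    ‖chartIntegrand d k (fun z => symForm d (G z)) ν s t ζ‖
      ≤ (‖chartIntegrand d k (fun z => symForm d (G z)) ν s s ζ‖
        + ‖chartIntegrand d k (fun z => symForm d (G z)) ν t t ζ‖) / 2 := by
  subst hζ
  obtain ⟨h, hh⟩ := hG.metric.self_of_nhds
  have hρ := hG.curvature_pos
  have hν := hG.weight_pos
  have hF := fubiniStudyDensity_pos h (Fin.tail ζ)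
  have hQ : 0 < dualNormSq (symForm d (G (ζ 0))) (covecPow d (affineCovector (Fin.tail ζ))) := by
    rw [← hh]
    exact (h.sym d).dualNormSq_pos (affinePower_ne_zero ζ)
  set c : ℝ := ν (ζ 0) ^ k * (2 * logCurvature ν (ζ 0) * (d * μ + k) * d ^ n)
    * fubiniStudyDensity h (Fin.tail ζ)
    / dualNormSq (symForm d (G (ζ 0))) (covecPow d (affineCovector (Fin.tail ζ))) with hc
  have hc0 : 0 ≤ c := by positivity
  have key : ∀ s t, chartIntegrand d k (fun z => symForm d (G z)) ν s t ζ
      = c * (affinePower d ζ (s (ζ 0)) * conj (affinePower d ζ (t (ζ 0)))) := by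
    intro s t
    rw [chartIntegrand, hG.volCoeff_eq hh rfl, fubiniStudyDensity_eq, hatInner, hc]
    simp only [affinePower]
    push_cast
    ring
  have hn : ∀ s t, ‖chartIntegrand d k (fun z => symForm d (G z)) ν s t ζ‖
      = c * (‖affinePower d ζ (s (ζ 0))‖ * ‖affinePower d ζ (t (ζ 0))‖) := by
    intro s t
    rw [key, norm_mul, Complex.norm_real, Real.norm_of_nonneg hc0, norm_mul, RCLike.norm_conj]
  constructor
  · rw [hn, key, Complex.mul_conj']
    push_cast
    ring
  · rw [hn, hn, hn]
    nlinarith [mul_nonneg hc0 (sq_nonneg (‖affinePower d ζ (s (ζ 0))‖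
      - ‖affinePower d ζ (t (ζ 0))‖))]

theorem IsEinsteinChart.norm_chartIntegrand_sub_le (hG : IsEinsteinChart μ G ν z₀) (hd : 0 < d)
    (hlam : 1 / ((n : ℝ) + 1) ≤ d * μ + k) (hK : IsMetricChart K z₀) {e : ℝ}
    (he : 0 ≤ e) (he2 : e ≤ 1 / 2)
    (hC : C2NormAt (fun z s t => symForm d (G z) s t) (logCurvature ν)
      (fun z s t => (K z - symForm d (G z)) s t) z₀ ≤ ENNReal.ofReal e)
    {ζ : Fin (n + 1) → ℂ} (hζ : ζ 0 = z₀) :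
    ‖chartIntegrand d k K ν s t ζ - chartIntegrand d k (fun z => symForm d (G z)) ν s t ζ‖
      ≤ (5 * volumeErrorConstant n + 10) * e
        * ‖chartIntegrand d k (fun z => symForm d (G z)) ν s t ζ‖ := by
  obtain ⟨h, hh⟩ := hG.metric.self_of_nhds
  have hlam0 : 0 < d * μ + k := lt_of_lt_of_le (by positivity) hlam
  have hρ := hG.curvature_pos
  have hν := hG.weight_pos
  have hF := fubiniStudyDensity_pos h (Fin.tail ζ)
  have h1 := hG.norm_pairing_sub_le hd hlam hK he he2 hC hh hζ (s z₀) (t z₀)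
  rw [chartIntegrand, chartIntegrand, hG.volCoeff_eq hh hζ, fubiniStudyDensity_eq,
    ← Complex.ofReal_mul, hζ, mul_assoc, mul_assoc, ← mul_sub, norm_mul, norm_mul, norm_mul]
  rw [Complex.norm_real, Complex.norm_real, Real.norm_of_nonneg (by positivity : (0 : ℝ) ≤ ν z₀ ^ k),
    Real.norm_of_nonneg (by positivity : (0 : ℝ) ≤ 2 * logCurvature ν z₀ * (d * μ + k) * d ^ n
          * fubiniStudyDensity h (Fin.tail ζ))]
  calc _ ≤ ν z₀ ^ k * _ := mul_le_mul_of_nonneg_left h1 (by positivity)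
    _ = _ := by ring

end ChartIntegral

end

/-! ### The estimate in a chart -/

noncomputable section

open Filter Topology

section ChartEstimate

variable {n d k : ℕ} {μ : ℝ} {G : ℂ → SesqForm (Fin (n + 1) → ℂ)} {ν : ℂ → ℝ} {z₀ : ℂ}
  {K : ℂ → SesqForm (Sym[ℂ]^d (Fin (n + 1) → ℂ))} {e : ℝ}

/-- From `|K - G| ≤ e |x| |y|` with `e ≤ 1/2`. Errors measured in the Einstein metric are thereby
expressed in the metric for which the basis of sections is orthonormal. -/
theorem IsEinsteinChart.form_comparison (hG : IsEinsteinChart μ G ν z₀) (hK : IsMetricChart K z₀)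
    (he : 0 ≤ e) (he2 : e ≤ 1 / 2)
    (hC : C2NormAt (fun z s t => symForm d (G z) s t) (logCurvature ν)
      (fun z s t => (K z - symForm d (G z)) s t) z₀ ≤ ENNReal.ofReal e)
    (x y : Sym[ℂ]^d (Fin (n + 1) → ℂ)) :
    0 ≤ (symForm d (G z₀) x x).re ∧ (symForm d (G z₀) x x).re ≤ 2 * (K z₀ x x).re ∧
    ‖symForm d (G z₀) x y - K z₀ x y‖
      ≤ e * (((symForm d (G z₀) x x).re + (symForm d (G z₀) y y).re) / 2) := by
  obtain ⟨h, hh⟩ := (hG.isMetricChart_sym (d := d)).metric.self_of_nhds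
  obtain ⟨hK', hhK⟩ := hK.metric.self_of_nhds
  obtain ⟨c0, -⟩ := formNorm_le_of_C2NormAt_le hG.curvature_pos hC
  have hform : ∀ u v, symForm d (G z₀) u v = h.form u v := fun u v => by rw [hh]
  simp only [hform] at c0 ⊢
  have b0 : ∀ x y, ‖h.form x y - K z₀ x y‖ ≤ e * (√(h.form x x).re * √(h.form y y).re) := by
    intro x y
    have := norm_le_of_formNorm_le (SesqForm.isSesq _) he c0 x y
    rwa [LinearMap.sub_apply, LinearMap.sub_apply, hform, norm_sub_rev, mul_assoc] at this
  refine ⟨h.re_self_nonneg x, ?_, (b0 x y).trans ?_⟩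
  · have h1 := b0 x x
    rw [Real.mul_self_sqrt (h.re_self_nonneg x)] at h1
    have h2 := (Complex.abs_re_le_norm _).trans h1
    rw [Complex.sub_re] at h2
    have h3 := (abs_le.1 h2).2
    have h4 : e * (h.form x x).re ≤ 1 / 2 * (h.form x x).re :=
      mul_le_mul_of_nonneg_right he2 (h.re_self_nonneg x)
    linarith
  · refine mul_le_mul_of_nonneg_left ?_ he
    have h1 := Real.sq_sqrt (h.re_self_nonneg x)
    have h2 := Real.sq_sqrt (h.re_self_nonneg y)
    nlinarith [sq_nonneg (√(h.form x x).re - √(h.form y y).re)]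

variable {C P : Set ℂ} {s t : ℂ → Sym[ℂ]^d (Fin (n + 1) → ℂ)}

theorem aestronglyMeasurable_fibration {F : (Fin (n + 1) → ℂ) → ℂ}
    (hP : MeasurableSet P) (hF : ∀ ζ, ζ 0 ∈ P → ContinuousAt F ζ) :
    AEStronglyMeasurable F (volume.restrict {ζ | ζ 0 ∈ P}) ∧
    AEStronglyMeasurable (fun p : ℂ × (Fin n → ℂ) => F (Fin.cons p.1 p.2))
      ((volume.restrict P).prod volume) := by
  have hm : MeasurableSet {ζ : Fin (n + 1) → ℂ | ζ 0 ∈ P} := measurable_pi_apply 0 hP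
  have h1 : AEStronglyMeasurable F (volume.restrict {ζ | ζ 0 ∈ P}) :=
    ContinuousOn.aestronglyMeasurable (fun ζ hζ => (hF ζ hζ).continuousWithinAt) hm
  refine ⟨h1, ?_⟩
  have h2 := h1.comp_measurePreserving
    ((measurePreserving_cons n).1.restrict_preimage_emb (measurePreserving_cons n).2
      {ζ | ζ 0 ∈ P})
  rw [preimage_cons, ← Measure.prod_restrict, Measure.restrict_univ] at h2
  exact h2

/-- The density of `ν^k ω`. -/
def weightDensity (k : ℕ) (ν : ℂ → ℝ) (z : ℂ) : ℝ :=
  ν z ^ k * (2 * logCurvature ν z)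

/-- The integrand is continuous on the compact set `C`; this is why the pieces of a `FrameCover` lie
in compact subsets of the frame domains. -/
theorem integrableOn_form (hCc : IsCompact C) (hPC : P ⊆ C)
    (hν : ∀ z ∈ C, ContDiffAt ℝ 2 ν z) (hν0 : ∀ z ∈ C, 0 < ν z) (hK : ∀ z ∈ C, IsMetricChart K z)
    (hs : ∀ z ∈ C, IsWeaklyContinuousAt s z) (ht : ∀ z ∈ C, IsWeaklyContinuousAt t z) :
    IntegrableOn (fun z => K z (s z) (t z) * (weightDensity k ν z : ℂ)) P := by
  refine IntegrableOn.mono_set (ContinuousOn.integrableOn_compact hCc fun z hz => ?_) hPC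
  refine ContinuousAt.continuousWithinAt (ContinuousAt.mul ?_ ?_)
  · exact (hs z hz).sesq (ht z hz) fun u v => ((hK z hz).contDiff u v).continuousAt
  · refine Complex.continuous_ofReal.continuousAt.comp ?_
    exact ((hν z hz).continuousAt.pow k).mul
      (continuousAt_const.mul (continuousAt_logCurvature (hν z hz) (hν0 z hz)))

/-- The diagonal integrand equals its norm, so the exact fibre integral is also the integral of the
norm. -/
theorem integral_norm_chartIntegrand (hCc : IsCompact C) (hPC : P ⊆ C) (hP : MeasurableSet P)
    (hlam : 0 < d * μ + k)
    (hG : ∀ z ∈ C, IsEinsteinChart μ G ν z) (hs : ∀ z ∈ C, IsWeaklyContinuousAt s z) :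
    IntegrableOn (fun ζ => ‖chartIntegrand d k (fun z => symForm d (G z)) ν s s ζ‖)
      {ζ | ζ 0 ∈ P} ∧
    ∫ ζ in {ζ | ζ 0 ∈ P}, ‖chartIntegrand d k (fun z => symForm d (G z)) ν s s ζ‖
      = fibreConstant n d * (d * μ + k)
        * ∫ z in P, (symForm d (G z) (s z) (s z)).re * weightDensity k ν z := by
  have hI := integrableOn_form (k := k) hCc hPC (fun z hz => (hG z hz).weight)
    (fun z hz => (hG z hz).weight_pos)
    (fun z hz => (hG z hz).isMetricChart_sym (d := d)) hs hs
  have hm := aestronglyMeasurable_fibration hP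
    (F := chartIntegrand d k (fun z => symForm d (G z)) ν s s) (fun ζ hζ =>
      (hG _ (hPC hζ)).continuousAt_chartIntegrand (hG _ (hPC hζ)).isMetricChart_sym
        (hs _ (hPC hζ)) (hs _ (hPC hζ)) rfl)
  have hfib : ∀ z ∈ P, ∫ y : Fin n → ℂ,
      ‖chartIntegrand d k (fun z => symForm d (G z)) ν s s (Fin.cons z y)‖
      = fibreConstant n d * (d * μ + k)
        * ((symForm d (G z) (s z) (s z)).re * weightDensity k ν z) := by
    intro z hz
    have h1 := ((hG z (hPC hz)).integral_chartIntegrand (d := d) (k := k) (s := s) (t := s)).2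
    have h2 : ∀ y : Fin n → ℂ, chartIntegrand d k (fun z => symForm d (G z)) ν s s (Fin.cons z y)
        = (‖chartIntegrand d k (fun z => symForm d (G z)) ν s s (Fin.cons z y)‖ : ℂ) := fun y =>
      ((hG z (hPC hz)).chartIntegrand_self (t := s) hlam (Fin.cons_zero _ _)).1
    rw [integral_congr_ae (Eventually.of_forall h2), integral_complex_ofReal] at h1
    have h3 := congrArg Complex.re h1
    rw [Complex.ofReal_re, Complex.re_ofReal_mul, Complex.re_mul_ofReal] at h3
    exact h3
  have hint : IntegrableOn (chartIntegrand d k (fun z => symForm d (G z)) ν s s)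
      {ζ | ζ 0 ∈ P} := by
    -- The affine fibre is not compact, so integrability comes from Tonelli: each fibre is
    -- integrable, and the explicit fibre integrals of the norm are integrable over the base.
    rw [integrableOn_fibration_iff, integrable_prod_iff hm.2]
    refine ⟨ae_restrict_of_forall_mem hP fun z hz => ((hG z (hPC hz)).integral_chartIntegrand).1, ?_⟩
    have h1 := (hI.re).const_mul (fibreConstant n d * (d * μ + k))
    refine h1.congr ?_
    refine ae_restrict_of_forall_mem hP fun z hz => ?_
    simp only
    rw [hfib z hz]
    congr 1
    exact Complex.re_mul_ofReal _ _
  refine ⟨hint.norm, ?_⟩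
  have h4 := setIntegral_fibration (F := fun ζ =>
    (‖chartIntegrand d k (fun z => symForm d (G z)) ν s s ζ‖ : ℂ)) hint.norm.ofReal
  simp only [integral_complex_ofReal] at h4
  rw [Complex.ofReal_inj] at h4
  rw [h4, setIntegral_congr_fun hP hfib, integral_const_mul]

/-- The integral of the pairing over the part of the projective bundle in a chart. -/
theorem chart_integral_estimate (hd : 0 < d) (hlam : 1 / ((n : ℝ) + 1) ≤ d * μ + k)
    (he : 0 ≤ e) (he2 : e ≤ 1 / 2) (hCc : IsCompact C) (hPC : P ⊆ C) (hP : MeasurableSet P)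
    (hG : ∀ z ∈ C, IsEinsteinChart μ G ν z) (hK : ∀ z ∈ C, IsMetricChart K z)
    (hC : ∀ z ∈ C, C2NormAt (fun z s t => symForm d (G z) s t) (logCurvature ν)
      (fun z s t => (K z - symForm d (G z)) s t) z ≤ ENNReal.ofReal e)
    (hs : ∀ z ∈ C, IsWeaklyContinuousAt s z) (ht : ∀ z ∈ C, IsWeaklyContinuousAt t z) :
    ‖(∫ ζ in {ζ | ζ 0 ∈ P}, chartIntegrand d k K ν s t ζ)
        - ((fibreConstant n d * (d * μ + k) : ℝ) : ℂ)
          * ∫ z in P, K z (s z) (t z) * (weightDensity k ν z : ℂ)‖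
      ≤ fibreConstant n d * (5 * volumeErrorConstant n + 11) * e * (d * μ + k)
        * ((∫ z in P, K z (s z) (s z) * (weightDensity k ν z : ℂ)).re
          + (∫ z in P, K z (t z) (t z) * (weightDensity k ν z : ℂ)).re) := by
  have hlam0 : 0 < d * μ + k := lt_of_lt_of_le (by positivity) hlam
  have hf := fibreConstant_nonneg n d
  have hv := volumeErrorConstant_nonneg n
  have hw : ∀ z ∈ C, 0 ≤ weightDensity k ν z := by
    intro z hz
    have := (hG z hz).weight_pos
    have := (hG z hz).curvature_pos
    unfold weightDensity
    positivity
  have hν : ∀ z ∈ C, ContDiffAt ℝ 2 ν z := fun z hz => (hG z hz).weight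
  have hν0 : ∀ z ∈ C, 0 < ν z := fun z hz => (hG z hz).weight_pos
  have hK₀ : ∀ z ∈ C, IsMetricChart (fun z => symForm d (G z)) z :=
    fun z hz => (hG z hz).isMetricChart_sym
  have hcmp := fun z hz => (hG z hz).form_comparison (hK z hz) he he2 (hC z hz)
  set A₀ := chartIntegrand d k (fun z => symForm d (G z)) ν with hA₀
  set A := chartIntegrand d k K ν with hA
  obtain ⟨is, js⟩ := integral_norm_chartIntegrand (k := k) hCc hPC hP hlam0 hG hs
  obtain ⟨it, jt⟩ := integral_norm_chartIntegrand (k := k) hCc hPC hP hlam0 hG ht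
  have hmS : MeasurableSet {ζ : Fin (n + 1) → ℂ | ζ 0 ∈ P} := measurable_pi_apply 0 hP
  have hbound : ∀ ζ : Fin (n + 1) → ℂ, ζ 0 ∈ P →
      ‖A₀ s t ζ‖ ≤ (‖A₀ s s ζ‖ + ‖A₀ t t ζ‖) / 2 := fun ζ hζ =>
    ((hG _ (hPC hζ)).chartIntegrand_self hlam0 rfl).2
  have hdiff : ∀ ζ : Fin (n + 1) → ℂ, ζ 0 ∈ P →
      ‖A s t ζ - A₀ s t ζ‖ ≤ (5 * volumeErrorConstant n + 10) * e * ‖A₀ s t ζ‖ := fun ζ hζ =>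
    (hG _ (hPC hζ)).norm_chartIntegrand_sub_le hd hlam (hK _ (hPC hζ)) he he2 (hC _ (hPC hζ)) rfl
  -- Dominated by the mean of the two diagonal integrands. The perturbed integrand is then dominated
  -- by a multiple of this one, through its relative error.
  have iA₀ : IntegrableOn (A₀ s t) {ζ | ζ 0 ∈ P} := by
    refine Integrable.mono' ((is.add it).div_const 2) ?_
      (ae_restrict_of_forall_mem hmS fun ζ hζ => hbound ζ hζ)
    exact (aestronglyMeasurable_fibration hP fun ζ hζ =>
      (hG _ (hPC hζ)).continuousAt_chartIntegrand (hK₀ _ (hPC hζ))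
        (hs _ (hPC hζ)) (ht _ (hPC hζ)) rfl).1
  have iA : IntegrableOn (A s t) {ζ | ζ 0 ∈ P} := by
    refine Integrable.mono' (iA₀.norm.const_mul (1 + (5 * volumeErrorConstant n + 10) * e)) ?_
      (ae_restrict_of_forall_mem hmS fun ζ hζ => ?_)
    · exact (aestronglyMeasurable_fibration hP fun ζ hζ =>
        (hG _ (hPC hζ)).continuousAt_chartIntegrand (hK _ (hPC hζ))
          (hs _ (hPC hζ)) (ht _ (hPC hζ)) rfl).1
    · have h1 := hdiff ζ hζ
      have h2 := norm_le_norm_add_norm_sub (A₀ s t ζ) (A s t ζ)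
      rw [norm_sub_rev] at h2
      linarith
  have iK := fun {f g} (hf : ∀ z ∈ C, IsWeaklyContinuousAt f z)
    (hg : ∀ z ∈ C, IsWeaklyContinuousAt g z) =>
    integrableOn_form (k := k) (K := K) hCc hPC hν hν0 hK hf hg
  have iK₀ := fun {f g} (hf : ∀ z ∈ C, IsWeaklyContinuousAt f z)
    (hg : ∀ z ∈ C, IsWeaklyContinuousAt g z) =>
    integrableOn_form (k := k) (K := fun z => symForm d (G z)) hCc hPC hν hν0 hK₀ hf hg
  have rK₀ : ∀ {f : ℂ → Sym[ℂ]^d (Fin (n + 1) → ℂ)}, (∀ z ∈ C, IsWeaklyContinuousAt f z) →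
      IntegrableOn (fun z => (symForm d (G z) (f z) (f z)).re * weightDensity k ν z) P := by
    intro f hf
    refine (iK₀ hf hf).re.congr (Eventually.of_forall fun z => ?_)
    exact Complex.re_mul_ofReal _ _
  have hJ : ∀ {f : ℂ → Sym[ℂ]^d (Fin (n + 1) → ℂ)}, (∀ z ∈ C, IsWeaklyContinuousAt f z) →
      ∫ z in P, (symForm d (G z) (f z) (f z)).re * weightDensity k ν z
        ≤ 2 * (∫ z in P, K z (f z) (f z) * (weightDensity k ν z : ℂ)).re := by
    intro f hf
    rw [← RCLike.re_eq_complex_re, ← integral_re (iK hf hf), ← integral_const_mul]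
    refine setIntegral_mono_on (rK₀ hf) ((iK hf hf).re.const_mul 2) hP fun z hz => ?_
    rw [RCLike.re_eq_complex_re, Complex.re_mul_ofReal, ← mul_assoc]
    exact mul_le_mul_of_nonneg_right (hcmp z (hPC hz) (f z) (f z)).2.1 (hw z (hPC hz))
  have hA₀int : ∫ ζ in {ζ | ζ 0 ∈ P}, A₀ s t ζ
      = ((fibreConstant n d * (d * μ + k) : ℝ) : ℂ)
        * ∫ z in P, symForm d (G z) (s z) (t z) * (weightDensity k ν z : ℂ) := by
    rw [setIntegral_fibration iA₀, ← integral_const_mul]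
    exact setIntegral_congr_fun hP fun z hz => ((hG z (hPC hz)).integral_chartIntegrand).2
  set Js := ∫ z in P, (symForm d (G z) (s z) (s z)).re * weightDensity k ν z with hJs
  set Jt := ∫ z in P, (symForm d (G z) (t z) (t z)).re * weightDensity k ν z with hJt
  have h1 : ‖(∫ ζ in {ζ | ζ 0 ∈ P}, A s t ζ) - ∫ ζ in {ζ | ζ 0 ∈ P}, A₀ s t ζ‖
      ≤ (5 * volumeErrorConstant n + 10) * e
        * ((fibreConstant n d * (d * μ + k) * Js + fibreConstant n d * (d * μ + k) * Jt) / 2) := by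
    rw [← integral_sub iA iA₀, ← js, ← jt, ← integral_add is it, ← integral_div,
      ← integral_const_mul]
    refine norm_integral_le_of_norm_le (((is.add it).div_const 2).const_mul _)
      (ae_restrict_of_forall_mem hmS fun ζ hζ => (hdiff ζ hζ).trans ?_)
    exact mul_le_mul_of_nonneg_left (hbound ζ hζ) (by positivity)
  have h2 : ‖(∫ z in P, symForm d (G z) (s z) (t z) * (weightDensity k ν z : ℂ))
      - ∫ z in P, K z (s z) (t z) * (weightDensity k ν z : ℂ)‖ ≤ e * ((Js + Jt) / 2) := by
    rw [← integral_sub (iK₀ hs ht) (iK hs ht), hJs, hJt, ← integral_add (rK₀ hs) (rK₀ ht),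
      ← integral_div, ← integral_const_mul]
    refine norm_integral_le_of_norm_le ((((rK₀ hs).add (rK₀ ht)).div_const 2).const_mul _)
      (ae_restrict_of_forall_mem hP fun z hz => ?_)
    rw [← sub_mul, norm_mul, Complex.norm_real, Real.norm_of_nonneg (hw z (hPC hz))]
    calc _ ≤ e * (((symForm d (G z) (s z) (s z)).re + (symForm d (G z) (t z) (t z)).re) / 2)
          * weightDensity k ν z := mul_le_mul_of_nonneg_right
            (hcmp z (hPC hz) (s z) (t z)).2.2 (hw z (hPC hz))
      _ = _ := by ring
  have h3 : Js ≤ 2 * (∫ z in P, K z (s z) (s z) * (weightDensity k ν z : ℂ)).re := hJ hs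
  have h4 : Jt ≤ 2 * (∫ z in P, K z (t z) (t z) * (weightDensity k ν z : ℂ)).re := hJ ht
  -- Pass through the unperturbed integrand, whose integral is exact. Changing the integrand costs
  -- `5 volumeErrorConstant + 10` and changing the form on the base costs `1`. The mean `(Js + Jt) /
  -- 2` becomes the sum of the two `K`-integrals because `G ≤ 2K`.
  calc _ = ‖((∫ ζ in {ζ | ζ 0 ∈ P}, A s t ζ) - ∫ ζ in {ζ | ζ 0 ∈ P}, A₀ s t ζ)
        + ((fibreConstant n d * (d * μ + k) : ℝ) : ℂ)
          * ((∫ z in P, symForm d (G z) (s z) (t z) * (weightDensity k ν z : ℂ))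
            - ∫ z in P, K z (s z) (t z) * (weightDensity k ν z : ℂ))‖ := by
        rw [hA₀int]
        congr 1
        ring
    _ ≤ (5 * volumeErrorConstant n + 10) * e
        * ((fibreConstant n d * (d * μ + k) * Js + fibreConstant n d * (d * μ + k) * Jt) / 2)
        + fibreConstant n d * (d * μ + k) * (e * ((Js + Jt) / 2)) := by
        refine (norm_add_le _ _).trans (add_le_add h1 ?_)
        rw [norm_mul, Complex.norm_real, Real.norm_of_nonneg (by positivity)]
        gcongr
    _ = fibreConstant n d * (5 * volumeErrorConstant n + 11) * e * (d * μ + k)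
        * ((Js + Jt) / 2) := by ring
    _ ≤ _ := by
        refine mul_le_mul_of_nonneg_left ?_ (by positivity)
        linarith

end ChartEstimate

end

/-! ### Holomorphic frames -/

noncomputable section

open Filter Topology

section Algebra

variable {V W M : Type*} [AddCommGroup V] [Module ℂ V] [AddCommGroup W] [Module ℂ W]
  [AddCommGroup M] [Module ℂ M]

/-- The linear equivalence of symmetric powers given by mutually inverse linear maps. -/
def symEquiv (d : ℕ) (T : V →ₗ[ℂ] W) (S : W →ₗ[ℂ] V) (hTS : T ∘ₗ S = LinearMap.id)
    (hST : S ∘ₗ T = LinearMap.id) : Sym[ℂ]^d V ≃ₗ[ℂ] Sym[ℂ]^d W :=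
  LinearEquiv.ofLinearMap (symMap d T) (symMap d S)
    (by rw [← symMap_comp, hTS, symMap_id]) (by rw [← symMap_comp, hST, symMap_id])

theorem covecPow_comp_symMap (d : ℕ) {T : V →ₗ[ℂ] W} {S : W →ₗ[ℂ] V}
    (hTS : T ∘ₗ S = LinearMap.id) (f : Module.Dual ℂ W) :
    covecPow d (f ∘ₗ T) ∘ₗ symMap d S = covecPow d f := by
  rw [← covecPow_comp, LinearMap.comp_assoc, hTS, LinearMap.comp_id]

theorem dualNormSq_covecPow_comp (d : ℕ) {T : V →ₗ[ℂ] W} {S : W →ₗ[ℂ] V}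
    (hTS : T ∘ₗ S = LinearMap.id) (hST : S ∘ₗ T = LinearMap.id) (A : SesqForm (Sym[ℂ]^d V))
    (f : Module.Dual ℂ W) :
    dualNormSq A (covecPow d (f ∘ₗ T)) = dualNormSq (pullForm (symMap d S) A) (covecPow d f) := by
  rw [← covecPow_comp_symMap d hTS f]
  exact (dualNormSq_pullForm (symEquiv d S T hST hTS) A _).symm

/-- The multiplication `ℂ^{⊗ k} → ℂ`. -/
def lineCoord (k : ℕ) : (⨂[ℂ]^k ℂ) →ₗ[ℂ] ℂ :=
  PiTensorProduct.lift (MultilinearMap.mkPiAlgebra ℂ (Fin k) ℂ)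

theorem lineCoord_map_smul (k : ℕ) {A : M →ₗ[ℂ] ℂ} {l : M} (hA : ∀ v, A v • l = v)
    (m : ⨂[ℂ]^k M) :
    lineCoord k (PiTensorProduct.map (fun _ => A) m) • PiTensorProduct.tprod ℂ (fun _ => l)
      = m := by
  induction m using PiTensorProduct.induction_on with
  | smul_tprod r v =>
    have h : PiTensorProduct.tprod ℂ v
        = (∏ i, A (v i)) • PiTensorProduct.tprod ℂ (fun _ : Fin k => l) := by
      rw [← MultilinearMap.map_smul_univ]
      simp [hA]
    rw [map_smul, map_smul, PiTensorProduct.map_tprod, lineCoord, PiTensorProduct.lift.tprod,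
      MultilinearMap.mkPiAlgebra_apply, h, smul_assoc]
  | add a b ha hb => rw [map_add, map_add, add_smul, ha, hb]

/-- The multiplication `Sym^d V ⊗ ℂ^{⊗ k} → Sym^d V`. -/
def twistCoord (d k : ℕ) : (Sym[ℂ]^d V) ⊗[ℂ] (⨂[ℂ]^k ℂ) →ₗ[ℂ] Sym[ℂ]^d V :=
  (TensorProduct.rid ℂ _).toLinearMap ∘ₗ LinearMap.lTensor _ (lineCoord k)

/-- The second factor is a power of a line, so every element is a vector of `Sym^d` tensored with
the power of the frame `l`. Sections thus become functions with values in a fixed `Sym^d`. -/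
theorem symMap_twistCoord_tmul (d k : ℕ) {T : V →ₗ[ℂ] W} {S : W →ₗ[ℂ] V}
    (hST : S ∘ₗ T = LinearMap.id) {A : M →ₗ[ℂ] ℂ} {l : M} (hA : ∀ v, A v • l = v)
    (w : (Sym[ℂ]^d V) ⊗[ℂ] (⨂[ℂ]^k M)) :
    symMap d S (twistCoord d k
        (TensorProduct.map (symMap d T) (PiTensorProduct.map fun _ => A) w))
      ⊗ₜ[ℂ] PiTensorProduct.tprod ℂ (fun _ => l) = w := by
  induction w using TensorProduct.induction_on with
  | zero => simp
  | tmul u m =>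
    have h : symMap d S (symMap d T u) = u := by
      rw [← LinearMap.comp_apply, ← symMap_comp, hST, symMap_id, LinearMap.id_apply]
    simp only [twistCoord, TensorProduct.map_tmul, LinearMap.comp_apply, LinearMap.lTensor_tmul,
      LinearEquiv.coe_coe, TensorProduct.rid_tmul, map_smul, h]
    rw [TensorProduct.smul_tmul, lineCoord_map_smul k hA]
  | add a b ha hb => rw [map_add, map_add, map_add, TensorProduct.add_tmul, ha, hb]

theorem tensorForm_symMap_tmul (d k : ℕ) (S : W →ₗ[ℂ] V) (A : SesqForm (Sym[ℂ]^d V))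
    (B : SesqForm M) (l : M) (s t : Sym[ℂ]^d W) :
    tensorForm A (tensorPowForm k B)
        (symMap d S s ⊗ₜ[ℂ] PiTensorProduct.tprod ℂ (fun _ => l))
        (symMap d S t ⊗ₜ[ℂ] PiTensorProduct.tprod ℂ (fun _ => l))
      = pullForm (symMap d S) A s t * B l l ^ k := by
  rw [tensorForm_tmul, tensorPowForm_tprod, pullForm_apply]
  simp

theorem hatInnerTwist_symMap_tmul (d k : ℕ) {T : V →ₗ[ℂ] W} {S : W →ₗ[ℂ] V}
    (hTS : T ∘ₗ S = LinearMap.id) (hST : S ∘ₗ T = LinearMap.id) (A : SesqForm (Sym[ℂ]^d V))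
    (B : SesqForm M) (l : M) (s t : Sym[ℂ]^d W) (f : Module.Dual ℂ W) :
    hatInnerTwist d A (tensorPowForm k B)
        (symMap d S s ⊗ₜ[ℂ] PiTensorProduct.tprod ℂ (fun _ => l))
        (symMap d S t ⊗ₜ[ℂ] PiTensorProduct.tprod ℂ (fun _ => l)) (f ∘ₗ T)
      = B l l ^ k * hatInner d (pullForm (symMap d S) A) s t f := by
  have h : ∀ u, hatSection d (f ∘ₗ T) (symMap d S u ⊗ₜ[ℂ] PiTensorProduct.tprod ℂ
      (fun _ : Fin k => l)) = covecPow d f u • PiTensorProduct.tprod ℂ (fun _ => l) := by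
    intro u
    rw [← covecPow_comp_symMap d hTS f]
    simp [hatSection]
  rw [hatInnerTwist, hatInner, h, h, dualNormSq_covecPow_comp d hTS hST,
    LinearMap.map_smulₛₗ, LinearMap.map_smul, LinearMap.smul_apply, tensorPowForm_tprod]
  simp only [Finset.prod_const, Finset.card_univ, Fintype.card_fin, smul_eq_mul]
  ring

end Algebra

/-! ### Passage from the bundles to local data. -/

section Frames

variable {X : Type*} [TopologicalSpace X] [ChartedSpace ℂ X]

section OneBundle

variable {F : Type*} [NormedAddCommGroup F] [NormedSpace ℂ F]
  {E : X → Type*} [TopologicalSpace (TotalSpace F E)] [∀ x, AddCommGroup (E x)]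
  [∀ x, Module ℂ (E x)] [∀ x, TopologicalSpace (E x)] [FiberBundle F E] [VectorBundle ℂ F E]
  {c : X} {z : ℂ}

theorem isOpen_frameDom (c : X) : IsOpen (frameDom F E c) :=
  (chartAt ℂ c).isOpen_image_of_subset_source
    ((chartAt ℂ c).open_source.inter (trivializationAt F E c).open_baseSet) Set.inter_subset_left

theorem symm_mem_baseSet (hz : z ∈ frameDom F E c) :
    (chartAt ℂ c).symm z ∈ (trivializationAt F E c).baseSet := by
  obtain ⟨x, hx, rfl⟩ := hz
  rw [(chartAt ℂ c).left_inv hx.1]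
  exact hx.2

theorem linearMapAt_comp_symmₗ (hz : z ∈ frameDom F E c) :
    (trivializationAt F E c).linearMapAt ℂ ((chartAt ℂ c).symm z)
      ∘ₗ (trivializationAt F E c).symmₗ ℂ ((chartAt ℂ c).symm z) = LinearMap.id :=
  LinearMap.ext fun v => (trivializationAt F E c).linearMapAt_symmₗ (symm_mem_baseSet hz) v

theorem symmₗ_comp_linearMapAt (hz : z ∈ frameDom F E c) :
    (trivializationAt F E c).symmₗ ℂ ((chartAt ℂ c).symm z)
      ∘ₗ (trivializationAt F E c).linearMapAt ℂ ((chartAt ℂ c).symm z) = LinearMap.id :=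
  LinearMap.ext fun v => (trivializationAt F E c).symmₗ_linearMapAt (symm_mem_baseSet hz) v

theorem exists_metric_frameForm (h : ∀ x, HermitianMetric (E x)) (hz : z ∈ frameDom F E c) :
    ∃ h' : HermitianMetric F, h'.form = frameForm F (fun x => (h x).form) c z :=
  ⟨(h _).pull _ (LinearMap.injective_of_comp_eq_id _ _ (linearMapAt_comp_symmₗ hz)), rfl⟩

theorem exists_metric_symFrameForm {d : ℕ} (H : ∀ x, HermitianMetric (Sym[ℂ]^d (E x)))
    (hz : z ∈ frameDom F E c) :
    ∃ h' : HermitianMetric (Sym[ℂ]^d F), h'.form = symFrameForm F d (fun x => (H x).form) c z :=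
  ⟨(H _).pull _ (symMap_injective_of_leftInverse d (linearMapAt_comp_symmₗ hz)), rfl⟩

theorem symFrameForm_symForm (d : ℕ) (h : ∀ x, SesqForm (E x)) (c : X) (z : ℂ) :
    symFrameForm F d (fun x => symForm d (h x)) c z = symForm d (frameForm F h c z) :=
  (symForm_pullForm d _ _).symm

end OneBundle

section TwoBundles

variable {n : ℕ} {E : X → Type*} [TopologicalSpace (TotalSpace (Fin (n + 1) → ℂ) E)]
  [∀ x, AddCommGroup (E x)] [∀ x, Module ℂ (E x)] [∀ x, TopologicalSpace (E x)]
  [FiberBundle (Fin (n + 1) → ℂ) E] [VectorBundle ℂ (Fin (n + 1) → ℂ) E]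
  {L : X → Type*} [TopologicalSpace (TotalSpace ℂ L)] [∀ x, AddCommGroup (L x)]
  [∀ x, Module ℂ (L x)] [∀ x, TopologicalSpace (L x)] [FiberBundle ℂ L] [VectorBundle ℂ ℂ L]
  {g : ∀ x, HermitianMetric (L x)} {h : ∀ x, HermitianMetric (E x)} {d k : ℕ} {μ : ℝ}
  {H : ∀ x, HermitianMetric (Sym[ℂ]^d (E x))} {c : X} {z : ℂ}

theorem IsSmoothSymMetric.isMetricChart (hH : IsSmoothSymMetric (Fin (n + 1) → ℂ) d H)
    (hz : z ∈ frameDom (Fin (n + 1) → ℂ) E c) :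
    IsMetricChart (symFrameForm (Fin (n + 1) → ℂ) d (fun x => (H x).form) c) z where
  metric := by
    filter_upwards [(isOpen_frameDom c).mem_nhds hz] with y hy
    exact exists_metric_symFrameForm H hy
  contDiff u v := ((hH c u v).contDiffAt ((isOpen_frameDom c).mem_nhds hz)).of_le
    ENat.LEInfty.out

theorem lineNormSq_pos (hz : z ∈ frameDom ℂ L c) : 0 < lineNormSq g c z := by
  obtain ⟨h', hh'⟩ := exists_metric_frameForm g hz
  rw [lineNormSq, ← hh']
  exact h'.pos 1 one_ne_zero

theorem IsHermitianEinstein.isEinsteinChart (he : IsHermitianEinstein n h g μ)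
    (hg : IsSmoothMetric ℂ g) (hg' : IsPositiveMetric g)
    (hh : IsSmoothMetric (Fin (n + 1) → ℂ) h)
    (hz : z ∈ frameDom (Fin (n + 1) → ℂ) E c ∩ frameDom ℂ L c) :
    IsEinsteinChart μ (frameForm (Fin (n + 1) → ℂ) (fun x => (h x).form) c) (lineNormSq g c) z where
  metric := by
    filter_upwards [(isOpen_frameDom c).mem_nhds hz.1] with y hy
    exact exists_metric_frameForm h hy
  contDiff u v := ((hh c u v).contDiffAt ((isOpen_frameDom c).mem_nhds hz.1)).of_le
    ENat.LEInfty.out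
  weight := Complex.reCLM.contDiff.contDiffAt.comp z
    (((hg c 1 1).contDiffAt ((isOpen_frameDom c).mem_nhds hz.2)).of_le ENat.LEInfty.out)
  weight_pos := lineNormSq_pos hz.2
  curvature_pos := hg' c z hz.2
  einstein := he c z hz

theorem C2NormAt_le_of_symC2Dist_le {e : ENNReal} (hC : symC2Dist n d H h g ≤ e)
    (hz : z ∈ frameDom (Fin (n + 1) → ℂ) E c ∩ frameDom ℂ L c) :
    C2NormAt
      (fun z s t => symForm d (frameForm (Fin (n + 1) → ℂ) (fun x => (h x).form) c z) s t)
      (logCurvature (lineNormSq g c))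
      (fun z s t => (symFrameForm (Fin (n + 1) → ℂ) d (fun x => (H x).form) c z
        - symForm d (frameForm (Fin (n + 1) → ℂ) (fun x => (h x).form) c z)) s t) z ≤ e := by
  refine le_trans (le_of_eq ?_) ((le_iSup₂ z hz).trans ((le_iSup _ c).trans hC))
  simp_rw [← symFrameForm_symForm]
  rfl

/-- The coordinates of a section of `Sym^d E ⊗ L^k` in the frames at `c`. -/
def sectionCoord (n d k : ℕ) {E : X → Type*} [TopologicalSpace (TotalSpace (Fin (n + 1) → ℂ) E)]
    [∀ x, AddCommGroup (E x)] [∀ x, Module ℂ (E x)] [∀ x, TopologicalSpace (E x)]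
    [FiberBundle (Fin (n + 1) → ℂ) E] [VectorBundle ℂ (Fin (n + 1) → ℂ) E]
    {L : X → Type*} [TopologicalSpace (TotalSpace ℂ L)] [∀ x, AddCommGroup (L x)]
    [∀ x, Module ℂ (L x)] [∀ x, TopologicalSpace (L x)] [FiberBundle ℂ L] [VectorBundle ℂ ℂ L]
    (s : ∀ x, (Sym[ℂ]^d (E x)) ⊗[ℂ] (⨂[ℂ]^k (L x))) (c : X) (z : ℂ) :
    Sym[ℂ]^d (Fin (n + 1) → ℂ) :=
  twistCoord d k (frameCoord E L d k c ((chartAt ℂ c).symm z) (s ((chartAt ℂ c).symm z)))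

/-- Only continuity of holomorphic sections enters the estimate. -/
theorem isWeaklyContinuousAt_sectionCoord
    {s : ∀ x, (Sym[ℂ]^d (E x)) ⊗[ℂ] (⨂[ℂ]^k (L x))} (hs : s ∈ holSections n E L d k)
    (hz : z ∈ frameDom (Fin (n + 1) → ℂ) E c ∩ frameDom ℂ L c) :
    IsWeaklyContinuousAt (sectionCoord n d k s c) z := fun φ =>
  ((hs c (φ ∘ₗ twistCoord d k)).differentiableAt
    (((isOpen_frameDom c).inter (isOpen_frameDom c)).mem_nhds hz)).continuousAt

variable (s t : ∀ x, (Sym[ℂ]^d (E x)) ⊗[ℂ] (⨂[ℂ]^k (L x)))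

theorem linearMapAt_smul_symmₗ_one (hz : z ∈ frameDom ℂ L c) (v : L ((chartAt ℂ c).symm z)) :
    (trivializationAt ℂ L c).linearMapAt ℂ ((chartAt ℂ c).symm z) v
      • (trivializationAt ℂ L c).symmₗ ℂ ((chartAt ℂ c).symm z) 1 = v := by
  rw [← map_smul, smul_eq_mul, mul_one]
  exact (trivializationAt ℂ L c).symmₗ_linearMapAt (symm_mem_baseSet hz) v

theorem symMap_sectionCoord_tmul (hz : z ∈ frameDom (Fin (n + 1) → ℂ) E c ∩ frameDom ℂ L c) :
    symMap d ((trivializationAt (Fin (n + 1) → ℂ) E c).symmₗ ℂ ((chartAt ℂ c).symm z))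
        (sectionCoord n d k s c z) ⊗ₜ[ℂ] PiTensorProduct.tprod ℂ
          (fun _ => (trivializationAt ℂ L c).symmₗ ℂ ((chartAt ℂ c).symm z) 1)
      = s ((chartAt ℂ c).symm z) :=
  symMap_twistCoord_tmul d k (symmₗ_comp_linearMapAt hz.1) (linearMapAt_smul_symmₗ_one hz.2) _

theorem form_symmₗ_one (hz : z ∈ frameDom ℂ L c) :
    (g ((chartAt ℂ c).symm z)).form ((trivializationAt ℂ L c).symmₗ ℂ ((chartAt ℂ c).symm z) 1)
        ((trivializationAt ℂ L c).symmₗ ℂ ((chartAt ℂ c).symm z) 1) = (lineNormSq g c z : ℂ) := by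
  obtain ⟨h', hh'⟩ := exists_metric_frameForm g hz
  rw [lineNormSq, ← hh', ← h'.self_eq_ofReal, hh']
  rfl

theorem twistForm_eq (hz : z ∈ frameDom (Fin (n + 1) → ℂ) E c ∩ frameDom ℂ L c) :
    twistForm d k H g ((chartAt ℂ c).symm z) (s ((chartAt ℂ c).symm z))
        (t ((chartAt ℂ c).symm z))
      = symFrameForm (Fin (n + 1) → ℂ) d (fun x => (H x).form) c z
        (sectionCoord n d k s c z) (sectionCoord n d k t c z) * (lineNormSq g c z : ℂ) ^ k := by
  rw [← symMap_sectionCoord_tmul s hz, ← symMap_sectionCoord_tmul t hz, twistForm,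
    tensorForm_symMap_tmul, form_symmₗ_one hz.2]
  rfl

variable {ζ : Fin (n + 1) → ℂ}

theorem hatFrameNormSq_eq (hz : ζ 0 ∈ frameDom (Fin (n + 1) → ℂ) E c) :
    hatFrameNormSq d k H g c ζ = affineNormSq d k
      (symFrameForm (Fin (n + 1) → ℂ) d (fun x => (H x).form) c) (lineNormSq g c) ζ := by
  rw [hatFrameNormSq, affineNormSq, frameCovector, affinePower, dualNormSq_covecPow_comp d
    (linearMapAt_comp_symmₗ hz) (symmₗ_comp_linearMapAt hz)]
  rfl

theorem volCoeff_congr {m : ℕ} {N N' : (Fin m → ℂ) → ℝ} {ζ : Fin m → ℂ} (hN : N =ᶠ[𝓝 ζ] N') :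
    volCoeff N ζ = volCoeff N' ζ := by
  have : curvMatrix N ζ = curvMatrix N' ζ := by
    ext a b
    simp only [curvMatrix, Matrix.of_apply]
    refine congrArg Neg.neg (dHol_congr ?_ _)
    filter_upwards [hN.eventuallyEq_nhds] with y hy
    refine dAnti_congr ?_ _
    filter_upwards [hy] with x hx
    rw [hx]
  rw [volCoeff, volCoeff, this]

theorem hatPairing_mul_volCoeff
    (hz : ζ 0 ∈ frameDom (Fin (n + 1) → ℂ) E c ∩ frameDom ℂ L c) :
    hatPairing d k H g s t ((chartAt ℂ c).symm (ζ 0)) (frameCovector c ζ)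
        * volCoeff (hatFrameNormSq d k H g c) ζ
      = chartIntegrand d k (symFrameForm (Fin (n + 1) → ℂ) d (fun x => (H x).form) c)
        (lineNormSq g c) (sectionCoord n d k s c) (sectionCoord n d k t c) ζ := by
  -- The two norms agree only over the frame domain. It is open, so they agree as germs, and the
  -- curvature sees nothing else.
  have hN : hatFrameNormSq d k H g c =ᶠ[𝓝 ζ] affineNormSq d k
      (symFrameForm (Fin (n + 1) → ℂ) d (fun x => (H x).form) c) (lineNormSq g c) := by
    filter_upwards [(continuous_apply 0).continuousAt.preimage_mem_nhds
      ((isOpen_frameDom c).mem_nhds hz.1)] with y hy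
    exact hatFrameNormSq_eq hy
  rw [volCoeff_congr hN, hatPairing, frameCovector, ← symMap_sectionCoord_tmul s hz,
    ← symMap_sectionCoord_tmul t hz, hatInnerTwist_symMap_tmul d k
    (linearMapAt_comp_symmₗ hz.1) (symmₗ_comp_linearMapAt hz.1), form_symmₗ_one hz.2,
    chartIntegrand]
  push_cast
  rfl

namespace FrameCover

variable (𝒰 : FrameCover n E L) (i : Fin 𝒰.m)

theorem image_subset : chartAt ℂ (𝒰.center i) '' 𝒰.compactSet i
    ⊆ frameDom (Fin (n + 1) → ℂ) E (𝒰.center i) ∩ frameDom ℂ L (𝒰.center i) :=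
  Set.subset_inter (Set.image_mono fun _ hx => (𝒰.subset i hx).1)
    (Set.image_mono fun _ hx => (𝒰.subset i hx).2)

theorem isCompact_image : IsCompact (chartAt ℂ (𝒰.center i) '' 𝒰.compactSet i) :=
  (𝒰.isCompact i).image_of_continuousOn
    ((chartAt ℂ (𝒰.center i)).continuousOn.mono fun _ hx => (𝒰.subset i hx).1.1)

theorem piece_subset : 𝒰.piece i ⊆ chartAt ℂ (𝒰.center i) '' 𝒰.compactSet i :=
  Set.image_mono Set.sdiff_subset

/-- The chart is injective on its source, so the image of a difference of compact sets is the
difference of two compact images. -/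
theorem measurableSet_piece [T2Space X] : MeasurableSet (𝒰.piece i) := by
  have hsrc : 𝒰.compactSet i ⊆ (chartAt ℂ (𝒰.center i)).source :=
    fun _ hx => (𝒰.subset i hx).1.1
  have hcl : IsClosed (⋃ j < i, 𝒰.compactSet j) :=
    (Set.toFinite (Set.Iio i)).isClosed_biUnion fun j _ => (𝒰.isCompact j).isClosed
  have hK := (𝒰.isCompact i).inter_right hcl
  have hK' : IsCompact (chartAt ℂ (𝒰.center i) '' (𝒰.compactSet i ∩ ⋃ j < i, 𝒰.compactSet j)) :=
    hK.image_of_continuousOn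
      ((chartAt ℂ (𝒰.center i)).continuousOn.mono (Set.inter_subset_left.trans hsrc))
  rw [piece, ← Set.sdiff_self_inter, ((chartAt ℂ (𝒰.center i)).injOn.mono hsrc).image_sdiff_subset
    Set.inter_subset_left]
  exact (𝒰.isCompact_image i).measurableSet.diff hK'.measurableSet

end FrameCover

end TwoBundles

end Frames

end

/-! ### Integrals over the surface and over the projective bundle -/

noncomputable section

open Filter Topology

variable {X : Type*} [TopologicalSpace X] [T2Space X] [ChartedSpace ℂ X] {n : ℕ}
  {E : X → Type*} [TopologicalSpace (TotalSpace (Fin (n + 1) → ℂ) E)]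
  [∀ x, AddCommGroup (E x)] [∀ x, Module ℂ (E x)] [∀ x, TopologicalSpace (E x)]
  [FiberBundle (Fin (n + 1) → ℂ) E] [VectorBundle ℂ (Fin (n + 1) → ℂ) E]
  {L : X → Type*} [TopologicalSpace (TotalSpace ℂ L)] [∀ x, AddCommGroup (L x)]
  [∀ x, Module ℂ (L x)] [∀ x, TopologicalSpace (L x)] [FiberBundle ℂ L] [VectorBundle ℂ ℂ L]
  {g : ∀ x, HermitianMetric (L x)} {h : ∀ x, HermitianMetric (E x)} {d k : ℕ} {μ e : ℝ}
  {H : ∀ x, HermitianMetric (Sym[ℂ]^d (E x))}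

namespace FrameCover

variable (𝒰 : FrameCover n E L)

theorem integralBase_twistForm (s t : ∀ x, (Sym[ℂ]^d (E x)) ⊗[ℂ] (⨂[ℂ]^k (L x))) :
    𝒰.integralBase g (fun x => twistForm d k H g x (s x) (t x))
      = ∑ i, ∫ z in 𝒰.piece i,
        symFrameForm (Fin (n + 1) → ℂ) d (fun x => (H x).form) (𝒰.center i) z
          (sectionCoord n d k s (𝒰.center i) z) (sectionCoord n d k t (𝒰.center i) z)
          * (weightDensity k (lineNormSq g (𝒰.center i)) z : ℂ) := by
  refine Finset.sum_congr rfl fun i _ => setIntegral_congr_fun (𝒰.measurableSet_piece i)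
    fun z hz => ?_
  simp only [twistForm_eq s t (𝒰.image_subset i (𝒰.piece_subset i hz)), weightDensity, mul_assoc]
  push_cast
  rfl

theorem integralProj_hatPairing (s t : ∀ x, (Sym[ℂ]^d (E x)) ⊗[ℂ] (⨂[ℂ]^k (L x))) :
    𝒰.integralProj d k H g (hatPairing d k H g s t)
      = ∑ i, ∫ ζ in {ζ : Fin (n + 1) → ℂ | ζ 0 ∈ 𝒰.piece i},
        chartIntegrand d k
          (symFrameForm (Fin (n + 1) → ℂ) d (fun x => (H x).form) (𝒰.center i))
          (lineNormSq g (𝒰.center i)) (sectionCoord n d k s (𝒰.center i))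
          (sectionCoord n d k t (𝒰.center i)) ζ :=
  Finset.sum_congr rfl fun i _ => setIntegral_congr_fun
    (measurable_pi_apply 0 (𝒰.measurableSet_piece i))
    fun _ hζ => hatPairing_mul_volCoeff s t (𝒰.image_subset i (𝒰.piece_subset i hζ))

/-- Both sides are additive over the pieces. As the local error is a multiple of the local diagonal
integrals, it sums to global ones, and the constant does not see the number of pieces or the charts.
-/
theorem norm_integralProj_sub_le (hd : 0 < d) (hlam : 1 / ((n : ℝ) + 1) ≤ d * μ + k)
    (he : 0 ≤ e) (he2 : e ≤ 1 / 2) (hE : IsHermitianEinstein n h g μ)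
    (hg : IsSmoothMetric ℂ g) (hg' : IsPositiveMetric g)
    (hh : IsSmoothMetric (Fin (n + 1) → ℂ) h) (hH : IsSmoothSymMetric (Fin (n + 1) → ℂ) d H)
    (hC : symC2Dist n d H h g ≤ ENNReal.ofReal e)
    {s t : ∀ x, (Sym[ℂ]^d (E x)) ⊗[ℂ] (⨂[ℂ]^k (L x))}
    (hs : s ∈ holSections n E L d k) (ht : t ∈ holSections n E L d k) :
    ‖𝒰.integralProj d k H g (hatPairing d k H g s t)
        - ((fibreConstant n d * (d * μ + k) : ℝ) : ℂ)
          * 𝒰.integralBase g (fun x => twistForm d k H g x (s x) (t x))‖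
      ≤ fibreConstant n d * (5 * volumeErrorConstant n + 11) * e * (d * μ + k)
        * ((𝒰.integralBase g (fun x => twistForm d k H g x (s x) (s x))).re
          + (𝒰.integralBase g (fun x => twistForm d k H g x (t x) (t x))).re) := by
  rw [integralProj_hatPairing, integralBase_twistForm, integralBase_twistForm,
    integralBase_twistForm, Finset.mul_sum, ← Finset.sum_sub_distrib, Complex.re_sum,
    Complex.re_sum, ← Finset.sum_add_distrib, Finset.mul_sum]
  refine (norm_sum_le _ _).trans (Finset.sum_le_sum fun i _ => ?_)
  exact chart_integral_estimate hd hlam he he2 (𝒰.isCompact_image i) (𝒰.piece_subset i)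
    (𝒰.measurableSet_piece i) (fun z hz => hE.isEinsteinChart hg hg' hh (𝒰.image_subset i hz))
    (fun z hz => hH.isMetricChart (𝒰.image_subset i hz).1)
    (fun z hz => C2NormAt_le_of_symC2Dist_le hC (𝒰.image_subset i hz))
    (fun z hz => isWeaklyContinuousAt_sectionCoord hs (𝒰.image_subset i hz))
    (fun z hz => isWeaklyContinuousAt_sectionCoord ht (𝒰.image_subset i hz))

end FrameCover

end

/-! ### The estimate for an orthonormal basis of sections. -/

theorem proposition4p1 (n d : ℕ) (hd : 0 < d) :
    ∃ Crd C : ℝ, IsFibreConstant n d Crd ∧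
      ∀ (X : Type*) [TopologicalSpace X] [T2Space X] [CompactSpace X] [ConnectedSpace X]
        [ChartedSpace ℂ X] [IsManifold 𝓘(ℂ) ω X]
        (E : X → Type*) [TopologicalSpace (TotalSpace (Fin (n + 1) → ℂ) E)]
        [∀ x, AddCommGroup (E x)] [∀ x, Module ℂ (E x)] [∀ x, TopologicalSpace (E x)]
        [FiberBundle (Fin (n + 1) → ℂ) E] [VectorBundle ℂ (Fin (n + 1) → ℂ) E]
        [ContMDiffVectorBundle ω (Fin (n + 1) → ℂ) E 𝓘(ℂ)]
        (L : X → Type*) [TopologicalSpace (TotalSpace ℂ L)]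
        [∀ x, AddCommGroup (L x)] [∀ x, Module ℂ (L x)] [∀ x, TopologicalSpace (L x)]
        [FiberBundle ℂ L] [VectorBundle ℂ ℂ L] [ContMDiffVectorBundle ω ℂ L 𝓘(ℂ)]
        (g : ∀ x, HermitianMetric (L x)) (_ : IsSmoothMetric ℂ g) (_ : IsPositiveMetric g)
        (h : ∀ x, HermitianMetric (E x)) (_ : IsSmoothMetric (Fin (n + 1) → ℂ) h)
        (μ : ℝ) (_ : IsHermitianEinstein n h g μ)
        (k : ℕ) (_ : 1 / ((n : ℝ) + 1) ≤ d * μ + k)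
        (H : ∀ x, HermitianMetric (Sym[ℂ]^d (E x)))
        (_ : IsSmoothSymMetric (Fin (n + 1) → ℂ) d H)
        (ε : ℝ) (_ : 0 ≤ ε)
        (_ : symC2Dist n d H h g ≤ ENNReal.ofReal (min ε (1 / 2)))
        (𝒰 : FrameCover n E L)
        (N : ℕ) (s : Module.Basis (Fin N) ℂ (holSections n E L d k))
        (_ : ∀ i j, 𝒰.integralBase g (fun x => twistForm d k H g x ((s i).1 x) ((s j).1 x))
          = if i = j then 1 else 0),
        ∀ i j, ‖𝒰.integralProj d k H g (hatPairing d k H g (s i).1 (s j).1)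
            - ((Crd * (d * μ + k) : ℝ) : ℂ) * (if i = j then 1 else 0)‖
          ≤ C * ε * (d * μ + k) := by
  refine ⟨fibreConstant n d, 2 * (fibreConstant n d * (5 * volumeErrorConstant n + 11)),
    isFibreConstant_fibreConstant n d, ?_⟩
  intro X _ _ _ _ _ _ E _ _ _ _ _ _ _ L _ _ _ _ _ _ _ g hg hg' h hh μ hE k hlam H hH ε hε hC 𝒰 N s
    hs i j
  have he : 0 ≤ min ε (1 / 2) := le_min hε (by norm_num)
  have key := 𝒰.norm_integralProj_sub_le hd hlam he (min_le_right _ _) hE hg hg' hh hH hC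
    (s i).2 (s j).2
  -- Orthonormality turns the main term into `δ_{ij}` and each of the two diagonal integrals into
  -- `1`, which is the origin of the factor `2` in `C`.
  rw [hs, hs, hs, if_pos rfl, if_pos rfl, Complex.one_re] at key
  refine key.trans ?_
  have hlam0 : 0 ≤ d * μ + k := le_trans (by positivity) hlam
  have hF : 0 ≤ fibreConstant n d * (5 * volumeErrorConstant n + 11) := by
    have := fibreConstant_nonneg n d
    have := volumeErrorConstant_nonneg n
    positivity
  calc _ = 2 * (fibreConstant n d * (5 * volumeErrorConstant n + 11)) * min ε (1 / 2)
          * (d * μ + k) := by ring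
    _ ≤ _ := by gcongr; exact min_le_left _ _
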